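/- Let $\rho>0$ be a constant and use the vertical travel time $y\ge 0$ as depth coordinate in the half-space. Let $n_0\in C^3([0,\infty))$ be positive, let $\bar n=(n_1,n_2)\in C([0,\infty);\mathbb R^2)$, and put $\sigma=n_0/\rho$. For $\xi\in\mathbb R^2$ let $U^{(0)}(y,t;\xi)$ be the weak solution, continuous off the front $t=y$, of $$U^{(0)}_{tt}-\tfrac1\sigma(\sigma U^{(0)}_y)_y+\tfrac{|\xi|^2}{n_0^2}U^{(0)}=0\ (y>0),\qquad U^{(0)}|_{y=0}=\theta(t)\sqrt{\rho/n_0(0)},\qquad U^{(0)}=0\ (t\le 0),$$ where $\theta$ is the Heaviside function, and let $U^{(1)}(y,t;\xi)$ be a locally integrable weak solution of $$U^{(1)}_{tt}-\tfrac1\sigma(\sigma U^{(1)}_y)_y+\tfrac{|\xi|^2}{n_0^2}U^{(1)}=\tfrac1{n_0^2}\langle\bar n,\nabla_\xi U^{(0)}_{tt}\rangle\ (y>0),\qquad U^{(1)}|_{y=0}=0,\qquad U^{(1)}=0\ (t\le 0),$$ with response $U^{(1)}_y|_{y=0}=\hat r_1(t,\xi)/n_0(0)$, where $\hat r_1(\cdot,\xi)$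 is continuous on $[0,\infty)$ (since the source is a step, $\hat r_1$ is the time integral of the first-order response to the impulsive source). For $\eta\ge 0$ let $G(y,\eta,t;\xi)$ be the space-causal Green's function, $$G_{tt}-\tfrac1\sigma(\sigma G_y)_y+\tfrac{|\xi|^2}{n_0^2}G=\delta(t)\,\delta(y-\eta),\qquad G=0\ \text{ if } y<\eta,$$ understood weakly as a locally integrable function that is continuous on the closed cone $|t|\le y-\eta$ (so that its values on the characteristics $t=\pm(y-\eta)$ are the limits from inside the cone). Put $G_1=\sqrt{\sigma(y)}\,G$, $G_2=\partial_tG_1+\partial_yG_1$ (classical derivatives inside the cone), $$p(y)=-\frac1{2n_0^2(y)}\int_0^y\frac{d\eta}{n_0^2(\eta)},\qquad \bar\varphi(y)=(\varphi_1(y),\varphi_2(y))=p(y)\,\bar n(y),$$ so that $p$ depends only on $n_0$. Let $a\ne0$, $\xi_1=(a,0)$, $\xi_2=(0,a)$. Then the derivatives $U^{(0)}_{tt}(\eta,\tau;\xi)$ and $\nabla_\xi U^{(0)}_{tt}(\eta,\tau;\xi)$ exist in the classical sense for $0<\eta<\tau$, the function $G_1(\cdot,\eta,\cdot;\xi)$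 is $C^1$ in the open cone $|t|<y-\eta$ for every $\eta\ge0$, and $\bar\varphi$ satisfies the system of linear Volterra integral equations $$a\varphi_i(y)=2\int_0^y G_1(y,\eta,\eta-y;\xi_i)\frac{\langle\bar\varphi(\eta),\nabla_\xi U^{(0)}_{tt}(\eta,2y-\eta;\xi_i)\rangle}{n_0^2(\eta)p(\eta)}\,d\eta-\frac2{n_0(0)}G_1(y,0,-y;\xi_i)\,\hat r_1(2y,\xi_i)$$ $$+\int_0^y\!\int_\eta^{2y-\eta}G_2(y,\eta,y-\tau;\xi_i)\frac{\langle\bar\varphi(\eta),\nabla_\xi U^{(0)}_{tt}(\eta,\tau;\xi_i)\rangle}{n_0^2(\eta)p(\eta)}\,d\tau\,d\eta-\frac1{n_0(0)}\int_0^{2y}G_2(y,0,y-\tau;\xi_i)\,\hat r_1(\tau,\xi_i)\,d\tau$$ for every $y>0$ and $i=1,2$, where all the integrals converge. -/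

import Mathlib

open Set MeasureTheory

noncomputable section

namespace LayeredWave

/-- The plane of the horizontal dual variable `ξ = (ξ₁, ξ₂)`. -/
abbrev Plane := EuclideanSpace ℝ (Fin 2)

/-- The half-space `y ≥ 0` (`y` is the vertical travel time), with coordinates `(y, t)`. -/
def halfSpace : Set (ℝ × ℝ) := Ici 0 ×ˢ univ

/-- The acoustic admittance `σ(y) = n₀(y) / ρ`. -/
def admittance (ρ : ℝ) (n₀ : ℝ → ℝ) (y : ℝ) : ℝ := n₀ y / ρ

/-- `σ` times the zero-order wave operator:
`σ w_tt - (σ w_y)_y + σ |ξ|² n₀⁻² w`, which is formally symmetric with respect to `dy dt`. -/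
def waveOp (ρ : ℝ) (n₀ : ℝ → ℝ) (ξ : Plane) (w : ℝ → ℝ → ℝ) (y t : ℝ) : ℝ :=
  admittance ρ n₀ y * iteratedDeriv 2 (fun s => w y s) t
    - deriv (fun x => admittance ρ n₀ x * deriv (fun x' => w x' t) x) y
    + admittance ρ n₀ y * (‖ξ‖ ^ 2 / n₀ y ^ 2) * w y t

/-- Test functions: compactly supported functions of class `C²` of `(y, t) ∈ ℝ²`; they need not
vanish on the boundary `y = 0`. -/
def IsTest (w : ℝ → ℝ → ℝ) : Prop :=
  ContDiff ℝ 2 (fun x : ℝ × ℝ => w x.1 x.2) ∧ HasCompactSupport (fun x : ℝ × ℝ => w x.1 x.2)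

/-- `U(y, t)` is the solution of the zero-order problem with parameter `ξ` and the step source:
`U_tt - σ⁻¹ (σ U_y)_y + |ξ|² n₀⁻² U = 0` for `y > 0`,
`U = θ(t) √(ρ / n₀(0))` at `y = 0`, and `U = 0` for `t ≤ 0`.
The equation and the boundary condition are understood in the weak sense (Green's formula against
test functions vanishing at `y = 0`); off the front `t = y` the continuous representative is
taken. -/
structure IsZeroOrderWave (ρ : ℝ) (n₀ : ℝ → ℝ) (ξ : Plane) (U : ℝ → ℝ → ℝ) : Prop where
  locallyIntegrable : LocallyIntegrableOn (fun x : ℝ × ℝ => U x.1 x.2) halfSpace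
  continuousOn : ContinuousOn (fun x : ℝ × ℝ => U x.1 x.2) {x | 0 < x.1 ∧ x.2 ≠ x.1}
  initial : ∀ y t : ℝ, 0 < y → t ≤ 0 → U y t = 0
  weak : ∀ w : ℝ → ℝ → ℝ, IsTest w → (∀ t, w 0 t = 0) →
    ∫ x in halfSpace, U x.1 x.2 * waveOp ρ n₀ ξ w x.1 x.2
      = ∫ t in Ioi (0 : ℝ),
          admittance ρ n₀ 0 * √(ρ / n₀ 0) * deriv (fun y => w y t) 0

/-- `U(y, t)` is the solution of the first-order problem with parameter `ξ`, and
`r(t)` its (time-integrated) response: for `y > 0`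
`U_tt - σ⁻¹ (σ U_y)_y + |ξ|² n₀⁻² U = n₀⁻² ⟨n̄, ∇_ξ U⁰_tt⟩`,
with `U = 0` and `U_y = r(t) / n₀(0)` at `y = 0`, and `U = 0` for `t ≤ 0`.
Here `U⁰(y, t, ξ)` is the zero-order wave. The equation and both boundary conditions are understood
in the weak sense (Green's formula against test functions that are arbitrary at `y = 0`); the two
time derivatives of the source term, which is singular on the front `t = y`, are moved to the test
function. -/
structure IsFirstOrderWave (ρ : ℝ) (n₀ : ℝ → ℝ) (nbar : ℝ → Plane) (U₀ : ℝ → ℝ → Plane → ℝ)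
    (ξ : Plane) (U : ℝ → ℝ → ℝ) (r : ℝ → ℝ) : Prop where
  locallyIntegrable : LocallyIntegrableOn (fun x : ℝ × ℝ => U x.1 x.2) halfSpace
  initial : ∀ y t : ℝ, 0 < y → t ≤ 0 → U y t = 0
  response_continuousOn : ContinuousOn r (Ici 0)
  weak : ∀ w : ℝ → ℝ → ℝ, IsTest w →
    ∫ x in halfSpace, U x.1 x.2 * waveOp ρ n₀ ξ w x.1 x.2
      = (∫ x in halfSpace, admittance ρ n₀ x.1 *
            (inner ℝ (nbar x.1) (gradient (fun ζ => U₀ x.1 x.2 ζ) ξ) / n₀ x.1 ^ 2) *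
            iteratedDeriv 2 (fun s => w x.1 s) x.2)
        - ∫ t in Ioi (0 : ℝ), admittance ρ n₀ 0 * (r t / n₀ 0) * w 0 t

/-- `g(y, t)` is the space-causal Green's function with source point `η ≥ 0`:
`g_tt - σ⁻¹ (σ g_y)_y + |ξ|² n₀⁻² g = δ(t) δ(y - η)`, `g = 0` if `y < η`.
The equation is understood in the weak sense. The representative is continuous on the closed cone
`|t| ≤ y - η`, so that the values of `g` on the characteristics `t = ±(y - η)` are its limits from
inside the cone. -/
structure IsSpaceCausalGreen (ρ : ℝ) (n₀ : ℝ → ℝ) (ξ : Plane) (η : ℝ) (g : ℝ → ℝ → ℝ) :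
    Prop where
  locallyIntegrable : LocallyIntegrableOn (fun x : ℝ × ℝ => g x.1 x.2) halfSpace
  continuousOn : ContinuousOn (fun x : ℝ × ℝ => g x.1 x.2) {x | |x.2| ≤ x.1 - η}
  causal : ∀ y t : ℝ, y < η → g y t = 0
  weak : ∀ w : ℝ → ℝ → ℝ, IsTest w →
    ∫ x in halfSpace, g x.1 x.2 * waveOp ρ n₀ ξ w x.1 x.2 = admittance ρ n₀ η * w η 0

/-- `p(y) = -(1 / (2 n₀(y)²)) ∫₀^y dη / n₀(η)²`. -/
def pFactor (n₀ : ℝ → ℝ) (y : ℝ) : ℝ :=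
  -(1 / (2 * n₀ y ^ 2)) * ∫ η in (0 : ℝ)..y, 1 / n₀ η ^ 2

/-- The unknown `φ̄(y) = (φ₁(y), φ₂(y)) = p(y) n̄(y)`. -/
def phiBar (n₀ : ℝ → ℝ) (nbar : ℝ → Plane) (y : ℝ) : Plane := pFactor n₀ y • nbar y

/-- `U⁰_tt(y, t, ξ)`, off the front. -/
def dtt (U₀ : ℝ → ℝ → Plane → ℝ) (y t : ℝ) (ξ : Plane) : ℝ :=
  iteratedDeriv 2 (fun s => U₀ y s ξ) t

/-- `⟨φ̄(η), ∇_ξ U⁰_tt(η, τ, ξ)⟩ / (n₀(η)² p(η))`. -/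
def forcing (n₀ : ℝ → ℝ) (φ : ℝ → Plane) (U₀ : ℝ → ℝ → Plane → ℝ) (η τ : ℝ) (ξ : Plane) : ℝ :=
  inner ℝ (φ η) (gradient (fun ζ => dtt U₀ η τ ζ) ξ) / (n₀ η ^ 2 * pFactor n₀ η)

/-- `G₁(y, η, t; ξ) = √σ(y) G(y, η, t; ξ)`. -/
def green₁ (ρ : ℝ) (n₀ : ℝ → ℝ) (G : ℝ → ℝ → ℝ → Plane → ℝ) (y η t : ℝ) (ξ : Plane) : ℝ :=
  √(admittance ρ n₀ y) * G y η t ξ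

/-- `G₂ = ∂_t G₁ + ∂_y G₁`. -/
def green₂ (ρ : ℝ) (n₀ : ℝ → ℝ) (G : ℝ → ℝ → ℝ → Plane → ℝ) (y η t : ℝ) (ξ : Plane) : ℝ :=
  deriv (fun s => green₁ ρ n₀ G y η s ξ) t + deriv (fun x => green₁ ρ n₀ G x η t ξ) y

end LayeredWave

end

/-!
The equations are put in canonical form: with `s = √σ` and `V = s U` the operator becomes
`∂ₜ² - ∂ᵧ² + q`, `q = s''/s + |ξ|²/n₀²`, and in the characteristic variables `x = t - y`,
`z = t + y` it is `4 ∂ₓ∂_z + q`. Only the continuity of `q`, which is extended evenly to the line,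
is available, but solutions of Goursat problems are nevertheless of class `C²`
(`goursat_regularity`), because an integral of `q((z' - x)/2) f(x, z')` along a characteristic may
be differentiated after the substitution `w = (z' - x)/2`. All Goursat problems are treated as
Volterra equations on rectangles (`volterra_exists`, `volterra_unique`), and their solutions, cut
off and divided by `s`, serve as test functions in the weak formulations.

The weak solutions are identified by testing with solutions of inhomogeneous Goursat problems, whose
right-hand sides are products of bumps in `x` and `z` (`eq_of_integral_bump_eq`).
* The space-causal Green's function is `-½ √(σ(η)/σ(y)) R` on its closed cone, where `R` is the
  Riemann function (`IsSpaceCausalGreen.eq_riemann`). Hence `G₁ = -½ s(η)` on the characteristic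
  `t = η - y`, and `G₂ = -½ s(η) ∂R/∂p` in the characteristic coordinate `p = (y - η + t)/2`, since
  `∂ₜ + ∂ᵧ = ∂/∂p`.
* The zero-order wave is `(1 + u)/s` behind the front and zero ahead of it
  (`IsZeroOrderWave.eq_profile`). Continuing the wave oddly to `y < 0` turns the boundary condition
  into a Volterra equation for `u` with vanishing data on both axes. The equation is affine in
  `|ξ|²`, so that difference quotients in `|ξ|²` solve an equation of the same kind; this gives the
  gradient in `ξ` of `U⁰` and of `U⁰_tt` (`exists_stepProfile`). The `|ξ|²`-derivative of `u`
  vanishes on the front, and its time derivative there is `-½ ∫₀ʸ n₀⁻²`: this is the origin of the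
  factor `p(y)` of `φ̄`.

The first-order problem is tested with solutions `W` of the homogeneous equation that have arbitrary
values `Ψ` on the front and vanish for large `t + y`. They do not see `U¹`, so only the source and
the response remain. Two integrations by parts in `t` move the derivatives back to the source; the
jump of its velocity on the front gives the term `2⟨φ̄, ξ⟩`, and Riemann's representation
`W = Ψ + ∫ Ψ ∂R/∂p` (`exists_backward_goursat`) gives the integral terms. Since `Ψ` is arbitrary,
the identity holds pointwise (`IsFirstOrderWave.front_identity`), and at `ξ = ξᵢ` it is the claimed
Volterra equation.
-/

namespace LayeredWave

/-! ### Volterra equations on rectangles -/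

/-- Each integration of `|t - x₀|ⁿ` gains a factor `|x - x₀| / (n + 1)`, for `x` on either side of
`x₀`. -/
lemma abs_integral_le_pow {h : ℝ → ℝ} {x₀ x c : ℝ} {n : ℕ}
    (hh : ∀ t ∈ uIcc x₀ x, |h t| ≤ c * |t - x₀| ^ n) :
    |∫ t in x₀..x, h t| ≤ c * |x - x₀| ^ (n + 1) / (n + 1) := by
  have hc : Continuous fun t => c * |t - x₀| ^ n := by fun_prop
  have h2 := intervalIntegral.norm_integral_le_abs_of_norm_le (f := h) (μ := volume)
    (MeasureTheory.ae_restrict_of_forall_mem measurableSet_uIoc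
      fun t ht => hh t (uIoc_subset_uIcc ht)) (hc.intervalIntegrable x₀ x)
  rw [Real.norm_eq_abs] at h2
  have hc0 : 0 ≤ c * |x - x₀| ^ n := le_trans (abs_nonneg _) (hh x right_mem_uIcc)
  refine h2.trans (le_of_eq ?_)
  rcases le_total x₀ x with hx | hx
  · have : ∫ t in x₀..x, c * |t - x₀| ^ n = ∫ t in x₀..x, c * (t - x₀) ^ n := by
      refine intervalIntegral.integral_congr fun t ht => ?_
      rw [uIcc_of_le hx] at ht
      simp only [abs_of_nonneg (sub_nonneg.2 ht.1)]
    rw [this, intervalIntegral.integral_const_mul,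
      intervalIntegral.integral_comp_sub_right (fun t => t ^ n), integral_pow]
    rw [abs_of_nonneg (sub_nonneg.2 hx)] at hc0 ⊢
    simp only [sub_self, ne_eq, Nat.add_eq_zero_iff, one_ne_zero, and_false, not_false_eq_true,
      zero_pow, sub_zero]
    rw [abs_of_nonneg]
    · ring
    · rw [← mul_div_assoc]
      have := mul_nonneg hc0 (sub_nonneg.2 hx)
      rw [pow_succ]
      apply div_nonneg _ (by positivity)
      nlinarith
  · have : ∫ t in x₀..x, c * |t - x₀| ^ n = ∫ t in x₀..x, c * (x₀ - t) ^ n := by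
      refine intervalIntegral.integral_congr fun t ht => ?_
      rw [uIcc_of_ge hx] at ht
      simp only [abs_of_nonpos (sub_nonpos.2 ht.2), neg_sub]
    rw [this, intervalIntegral.integral_const_mul,
      intervalIntegral.integral_comp_sub_left (fun t => t ^ n), integral_pow]
    rw [abs_of_nonpos (sub_nonpos.2 hx)] at hc0 ⊢
    simp only [sub_self, ne_eq, Nat.add_eq_zero_iff, one_ne_zero, and_false, not_false_eq_true,
      zero_pow, zero_sub, neg_sub] at hc0 ⊢
    rw [abs_of_nonpos]
    · ring
    · rw [← mul_div_assoc]
      have := mul_nonneg hc0 (sub_nonneg.2 hx)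
      rw [pow_succ]
      apply div_nonpos_of_nonpos_of_nonneg _ (by positivity)
      nlinarith

/-- One step of the Picard iteration gains a factor `|x - x₀| / (n + 1)`. -/
lemma abs_volterra_step_le {κ h : ℝ → ℝ → ℝ} {x₀ z₀ X Z x z C c : ℝ} {n : ℕ}
    (hx : x ∈ uIcc x₀ X) (hz : z ∈ uIcc z₀ Z) (hc : 0 ≤ c)
    (hκ : ∀ x ∈ uIcc x₀ X, ∀ z ∈ uIcc z₀ Z, |κ x z| ≤ C)
    (hh : ∀ x ∈ uIcc x₀ X, ∀ z ∈ uIcc z₀ Z, |h x z| ≤ c * |x - x₀| ^ n) :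
    |∫ x' in x₀..x, ∫ z' in z₀..z, κ x' z' * h x' z'|
      ≤ C * |Z - z₀| * c * |x - x₀| ^ (n + 1) / (n + 1) := by
  have hC : 0 ≤ C := (abs_nonneg _).trans (hκ x₀ left_mem_uIcc z₀ left_mem_uIcc)
  refine abs_integral_le_pow fun x' hx' => ?_
  have hx'' : x' ∈ uIcc x₀ X := uIcc_subset_uIcc_left hx hx'
  have : |∫ z' in z₀..z, κ x' z' * h x' z'| ≤ (C * (c * |x' - x₀| ^ n)) * |z - z₀| := by
    refine intervalIntegral.norm_integral_le_of_norm_le_const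
      (f := fun z' => κ x' z' * h x' z') fun z' hz' => ?_
    have hz'' : z' ∈ uIcc z₀ Z := uIcc_subset_uIcc_left hz (uIoc_subset_uIcc hz')
    rw [Real.norm_eq_abs, abs_mul]
    exact mul_le_mul (hκ _ hx'' _ hz'') (hh _ hx'' _ hz'') (abs_nonneg _) hC
  refine this.trans ?_
  have h3 : |z - z₀| ≤ |Z - z₀| := abs_sub_left_of_mem_uIcc hz
  calc C * (c * |x' - x₀| ^ n) * |z - z₀| ≤ C * (c * |x' - x₀| ^ n) * |Z - z₀| := by gcongr
    _ = _ := by ring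

/-- The homogeneous Volterra equation on a rectangle has only the zero solution. -/
theorem volterra_unique {κ f : ℝ → ℝ → ℝ} {x₀ z₀ X Z : ℝ}
    (hκ : Continuous fun v : ℝ × ℝ => κ v.1 v.2) (hf : Continuous fun v : ℝ × ℝ => f v.1 v.2)
    (h : ∀ x ∈ uIcc x₀ X, ∀ z ∈ uIcc z₀ Z,
      f x z = ∫ x' in x₀..x, ∫ z' in z₀..z, κ x' z' * f x' z') :
    ∀ x ∈ uIcc x₀ X, ∀ z ∈ uIcc z₀ Z, f x z = 0 := by
  have hcomp : IsCompact (uIcc x₀ X ×ˢ uIcc z₀ Z) := isCompact_uIcc.prod isCompact_uIcc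
  obtain ⟨C, hC⟩ := hcomp.exists_bound_of_continuousOn hκ.continuousOn
  obtain ⟨S, hS⟩ := hcomp.exists_bound_of_continuousOn hf.continuousOn
  have hS0 : 0 ≤ S := (norm_nonneg _).trans (hS (x₀, z₀) ⟨left_mem_uIcc, left_mem_uIcc⟩)
  have hC0 : 0 ≤ C := (norm_nonneg _).trans (hC (x₀, z₀) ⟨left_mem_uIcc, left_mem_uIcc⟩)
  have key : ∀ n : ℕ, ∀ x ∈ uIcc x₀ X, ∀ z ∈ uIcc z₀ Z,
      |f x z| ≤ ((C * |Z - z₀|) ^ n * S / n.factorial) * |x - x₀| ^ n := by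
    intro n
    induction n with
    | zero => intro x hx z hz; simpa using hS (x, z) ⟨hx, hz⟩
    | succ n ih =>
      intro x hx z hz
      rw [h x hx z hz]
      refine (abs_volterra_step_le hx hz (by positivity)
        (fun x hx z hz => hC (x, z) ⟨hx, hz⟩) ih).trans (le_of_eq ?_)
      rw [Nat.factorial_succ]
      push_cast
      field_simp
      ring
  intro x hx z hz
  have hlim : Filter.Tendsto (fun n : ℕ => S * ((C * |Z - z₀| * |x - x₀|) ^ n / n.factorial))
      Filter.atTop (nhds (S * 0)) :=
    (FloorSemiring.tendsto_pow_div_factorial_atTop _).const_mul S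
  have h0 : |f x z| ≤ S * 0 := by
    refine ge_of_tendsto hlim (Filter.Eventually.of_forall fun n => ?_)
    refine (key n x hx z hz).trans (le_of_eq ?_)
    rw [mul_pow _ |x - x₀|]
    ring
  rw [mul_zero] at h0
  exact abs_eq_zero.1 (le_antisymm h0 (abs_nonneg _))

/-- The Picard iterates of the Volterra equation on rectangles with corner `(x₀, z₀)`. -/
noncomputable def picard (κ g : ℝ → ℝ → ℝ → ℝ) (x₀ z₀ : ℝ) : ℕ → ℝ → ℝ → ℝ → ℝ
  | 0 => g
  | n + 1 => fun θ x z => ∫ x' in x₀..x, ∫ z' in z₀..z, κ θ x' z' * picard κ g x₀ z₀ n θ x' z'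

/-- The Volterra equation on rectangles with corner `(x₀, z₀)` is solvable on the whole plane, and
the solution depends continuously on a real parameter `θ`. -/
theorem volterra_exists (κ g : ℝ → ℝ → ℝ → ℝ) (x₀ z₀ : ℝ)
    (hκ : Continuous fun v : ℝ × ℝ × ℝ => κ v.1 v.2.1 v.2.2)
    (hg : Continuous fun v : ℝ × ℝ × ℝ => g v.1 v.2.1 v.2.2) :
    ∃ f : ℝ → ℝ → ℝ → ℝ, (Continuous fun v : ℝ × ℝ × ℝ => f v.1 v.2.1 v.2.2) ∧
      ∀ θ x z, f θ x z = g θ x z + ∫ x' in x₀..x, ∫ z' in z₀..z, κ θ x' z' * f θ x' z' := by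
  set a := picard κ g x₀ z₀ with ha
  have acont : ∀ n, Continuous fun v : ℝ × ℝ × ℝ => a n v.1 v.2.1 v.2.2 := by
    intro n
    induction n with
    | zero => exact hg
    | succ n ih =>
      have hF : Continuous fun v : ℝ × ℝ × ℝ => κ v.1 v.2.1 v.2.2 * a n v.1 v.2.1 v.2.2 :=
        hκ.mul ih
      have hin : Continuous fun w : (ℝ × ℝ × ℝ) × ℝ =>
          ∫ z' in z₀..w.1.2.2, κ w.1.1 w.2 z' * a n w.1.1 w.2 z' := by
        refine intervalIntegral.continuous_parametric_intervalIntegral_of_continuous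
          (f := fun (w : (ℝ × ℝ × ℝ) × ℝ) z' => κ w.1.1 w.2 z' * a n w.1.1 w.2 z') ?_ (by fun_prop)
        exact hF.comp (f := fun u : ((ℝ × ℝ × ℝ) × ℝ) × ℝ => (u.1.1.1, u.1.2, u.2)) (by fun_prop)
      exact intervalIntegral.continuous_parametric_intervalIntegral_of_continuous
          (f := fun (v : ℝ × ℝ × ℝ) x' => ∫ z' in z₀..v.2.2, κ v.1 x' z' * a n v.1 x' z')
          hin (by fun_prop)
  -- factorial bounds on the box `|θ|, |x - x₀|, |z - z₀| ≤ N`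
  have bound : ∀ N : ℝ, 0 ≤ N → ∃ b : ℕ → ℝ, Summable b ∧ ∀ n θ x z, |θ| ≤ N → |x - x₀| ≤ N →
      |z - z₀| ≤ N → |a n θ x z| ≤ b n := by
    intro N hN
    have hcomp : IsCompact (Icc (-N) N ×ˢ Icc (x₀ - N) (x₀ + N) ×ˢ Icc (z₀ - N) (z₀ + N)) :=
      isCompact_Icc.prod (isCompact_Icc.prod isCompact_Icc)
    obtain ⟨C, hC⟩ := hcomp.exists_bound_of_continuousOn hκ.continuousOn
    obtain ⟨S, hS⟩ := hcomp.exists_bound_of_continuousOn hg.continuousOn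
    have mem : ∀ θ x z, |θ| ≤ N → |x - x₀| ≤ N → |z - z₀| ≤ N →
        (θ, x, z) ∈ (Icc (-N) N ×ˢ Icc (x₀ - N) (x₀ + N) ×ˢ Icc (z₀ - N) (z₀ + N)) := by
      intro θ x z h1 h2 h3
      rw [abs_le] at h1 h2 h3
      exact ⟨⟨h1.1, h1.2⟩, ⟨by linarith, by linarith⟩, ⟨by linarith, by linarith⟩⟩
    have hm0 := mem 0 x₀ z₀ (by simpa) (by simpa) (by simpa)
    have hS0 : 0 ≤ S := (norm_nonneg _).trans (hS _ hm0)
    have hC0 : 0 ≤ C := (norm_nonneg _).trans (hC _ hm0)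
    refine ⟨fun n => S * ((C * N * N) ^ n / n.factorial),
      (Real.summable_pow_div_factorial _).mul_left S, ?_⟩
    have key : ∀ n : ℕ, ∀ θ x z, |θ| ≤ N → |x - x₀| ≤ N → |z - z₀| ≤ N →
        |a n θ x z| ≤ ((C * N) ^ n * S / n.factorial) * |x - x₀| ^ n := by
      intro n
      induction n with
      | zero =>
        intro θ x z h1 h2 h3
        simpa [ha, picard] using hS _ (mem θ x z h1 h2 h3)
      | succ n ih =>
        intro θ x z h1 h2 h3
        refine (abs_volterra_step_le (κ := κ θ) (h := a n θ) (C := C)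
          (c := (C * N) ^ n * S / n.factorial) (n := n) (X := x) (Z := z)
          right_mem_uIcc right_mem_uIcc (by positivity) ?_ ?_).trans ?_
        · intro x' hx' z' hz'
          exact hC _ (mem θ x' z' h1 ((abs_sub_left_of_mem_uIcc hx').trans h2)
            ((abs_sub_left_of_mem_uIcc hz').trans h3))
        · intro x' hx' z' hz'
          exact ih θ x' z' h1 ((abs_sub_left_of_mem_uIcc hx').trans h2)
            ((abs_sub_left_of_mem_uIcc hz').trans h3)
        · calc C * |z - z₀| * ((C * N) ^ n * S / n.factorial) * |x - x₀| ^ (n + 1) / (n + 1)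
              ≤ C * N * ((C * N) ^ n * S / n.factorial) * |x - x₀| ^ (n + 1) / (n + 1) := by
                gcongr
            _ = _ := by
                rw [Nat.factorial_succ]
                push_cast
                field_simp
                ring
    intro n θ x z h1 h2 h3
    refine (key n θ x z h1 h2 h3).trans ?_
    calc (C * N) ^ n * S / n.factorial * |x - x₀| ^ n
        ≤ (C * N) ^ n * S / n.factorial * N ^ n := by gcongr
      _ = _ := by rw [mul_pow _ N]; ring
  have hsum : ∀ θ x z, Summable fun n => a n θ x z := by
    intro θ x z
    obtain ⟨b, hb, hab⟩ := bound (|θ| + |x - x₀| + |z - z₀|) (by positivity)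
    refine Summable.of_norm_bounded hb fun n => hab n θ x z ?_ ?_ ?_ <;>
    linarith [abs_nonneg θ, abs_nonneg (x - x₀), abs_nonneg (z - z₀)]
  have fcont : Continuous fun v : ℝ × ℝ × ℝ => ∑' n, a n v.1 v.2.1 v.2.2 := by
    rw [continuous_iff_continuousAt]
    rintro ⟨θ, x, z⟩
    set N := |θ| + |x - x₀| + |z - z₀| + 1 with hN
    obtain ⟨b, hb, hab⟩ := bound N (by positivity)
    have hopen : IsOpen {v : ℝ × ℝ × ℝ | |v.1| < N ∧ |v.2.1 - x₀| < N ∧ |v.2.2 - z₀| < N} :=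
      (isOpen_lt (by fun_prop) (by fun_prop)).and
        ((isOpen_lt (by fun_prop) (by fun_prop)).and (isOpen_lt (by fun_prop) (by fun_prop)))
    have hcon : ContinuousOn (fun v : ℝ × ℝ × ℝ => ∑' n, a n v.1 v.2.1 v.2.2)
        {v : ℝ × ℝ × ℝ | |v.1| < N ∧ |v.2.1 - x₀| < N ∧ |v.2.2 - z₀| < N} :=
      continuousOn_tsum (fun n => (acont n).continuousOn) hb
        fun n v hv => hab n v.1 v.2.1 v.2.2 hv.1.le hv.2.1.le hv.2.2.le
    refine hcon.continuousAt (hopen.mem_nhds ?_)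
    rw [mem_ofPred_eq]
    simp only [hN]
    refine ⟨?_, ?_, ?_⟩ <;> linarith [abs_nonneg θ, abs_nonneg (x - x₀), abs_nonneg (z - z₀)]
  refine ⟨fun θ x z => ∑' n, a n θ x z, fcont, fun θ x z => ?_⟩
  obtain ⟨b, hb, hab⟩ := bound (|θ| + |x - x₀| + |z - z₀|) (by positivity)
  obtain ⟨C, hC⟩ := (isCompact_uIcc.prod isCompact_uIcc :
    IsCompact (uIcc x₀ x ×ˢ uIcc z₀ z)).exists_bound_of_continuousOn
      (f := fun v : ℝ × ℝ => κ θ v.1 v.2)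
      (hκ.comp (f := fun v : ℝ × ℝ => (θ, v.1, v.2)) (by fun_prop)).continuousOn
  have hC0 : 0 ≤ C := (norm_nonneg _).trans (hC (x₀, z₀) ⟨left_mem_uIcc, left_mem_uIcc⟩)
  have hb' : ∀ n, ∀ x' ∈ uIcc x₀ x, ∀ z' ∈ uIcc z₀ z, ‖κ θ x' z' * a n θ x' z'‖ ≤ C * b n := by
    intro n x' hx' z' hz'
    rw [norm_mul]
    refine mul_le_mul (hC (x', z') ⟨hx', hz'⟩) (hab n θ x' z' ?_ ?_ ?_) (norm_nonneg _) hC0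
    · linarith [abs_nonneg (x - x₀), abs_nonneg (z - z₀)]
    · linarith [abs_sub_left_of_mem_uIcc hx', abs_nonneg θ, abs_nonneg (z - z₀)]
    · linarith [abs_sub_left_of_mem_uIcc hz', abs_nonneg θ, abs_nonneg (x - x₀)]
  have hκa : ∀ n, Continuous fun v : ℝ × ℝ => κ θ v.1 v.2 * a n θ v.1 v.2 := fun n =>
    (hκ.mul (acont n)).comp (f := fun v : ℝ × ℝ => (θ, v.1, v.2)) (by fun_prop)
  have inner : ∀ x' ∈ uIcc x₀ x, HasSum (fun n => ∫ z' in z₀..z, κ θ x' z' * a n θ x' z')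
      (∫ z' in z₀..z, κ θ x' z' * ∑' n, a n θ x' z') := by
    intro x' hx'
    refine intervalIntegral.hasSum_integral_of_dominated_convergence (fun n _ => C * b n)
      (fun n => ((hκa n).comp (f := fun z' => (x', z')) (by fun_prop)).aestronglyMeasurable)
      (fun n => Filter.Eventually.of_forall fun z' hz' =>
        hb' n x' hx' z' (uIoc_subset_uIcc hz'))
      (Filter.Eventually.of_forall fun _ _ => hb.mul_left C)
      (continuous_const.intervalIntegrable _ _)
      (Filter.Eventually.of_forall fun z' _ => ((hsum θ x' z').hasSum).mul_left _)
  have outer : HasSum (fun n => a (n + 1) θ x z)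
      (∫ x' in x₀..x, ∫ z' in z₀..z, κ θ x' z' * ∑' n, a n θ x' z') := by
    have hcin : ∀ n, Continuous fun x' => ∫ z' in z₀..z, κ θ x' z' * a n θ x' z' := fun n =>
      intervalIntegral.continuous_parametric_intervalIntegral_of_continuous'
        (f := fun x' z' => κ θ x' z' * a n θ x' z') (hκa n) z₀ z
    refine intervalIntegral.hasSum_integral_of_dominated_convergence
      (fun n _ => C * b n * |z - z₀|)
      (fun n => (hcin n).aestronglyMeasurable)
      (fun n => Filter.Eventually.of_forall fun x' hx' => ?_)
      (Filter.Eventually.of_forall fun _ _ => (hb.mul_left C).mul_right _)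
      (continuous_const.intervalIntegrable _ _)
      (Filter.Eventually.of_forall fun x' hx' => inner x' (uIoc_subset_uIcc hx'))
    exact intervalIntegral.norm_integral_le_of_norm_le_const fun z' hz' =>
      hb' n x' (uIoc_subset_uIcc hx') z' (uIoc_subset_uIcc hz')
  change ∑' n, a n θ x z = _
  rw [(hsum θ x z).tsum_eq_zero_add, outer.tsum_eq]
  rfl

/-! ### Functions of two variables with continuous partial derivatives -/

/-- `f` has the continuous partial derivatives `fx` and `fz`. -/
structure HasPartials (f fx fz : ℝ → ℝ → ℝ) : Prop where
  fst : ∀ x z, HasDerivAt (fun x => f x z) (fx x z) x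
  snd : ∀ x z, HasDerivAt (fun z => f x z) (fz x z) z
  cont_fst : Continuous fun v : ℝ × ℝ => fx v.1 v.2
  cont_snd : Continuous fun v : ℝ × ℝ => fz v.1 v.2

namespace HasPartials

variable {f fx fz g gx gz : ℝ → ℝ → ℝ}

lemma hasFDerivAt (h : HasPartials f fx fz) (v : ℝ × ℝ) :
    HasFDerivAt (fun v : ℝ × ℝ => f v.1 v.2)
      (fx v.1 v.2 • ContinuousLinearMap.fst ℝ ℝ ℝ + fz v.1 v.2 • ContinuousLinearMap.snd ℝ ℝ ℝ)
      v := by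
  have hc : ∀ {F : ℝ → ℝ → ℝ}, (Continuous fun v : ℝ × ℝ => F v.1 v.2) →
      Continuous fun v : ℝ × ℝ => ContinuousLinearMap.toSpanSingleton ℝ (F v.1 v.2) := by
    intro F hF
    exact (ContinuousLinearMap.toSpanSingletonCLE (𝕜 := ℝ) (E := ℝ)).continuous.comp hF
  have := hasStrictFDerivAt_uncurry_coprod (𝕜 := ℝ) (u := v) (f := f)
    (f₁ := fun x z => ContinuousLinearMap.toSpanSingleton ℝ (fx x z))
    (f₂ := fun x z => ContinuousLinearMap.toSpanSingleton ℝ (fz x z))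
    (Filter.Eventually.of_forall fun v => (h.fst v.1 v.2).hasFDerivAt)
    (Filter.Eventually.of_forall fun v => (h.snd v.1 v.2).hasFDerivAt)
    (hc h.cont_fst).continuousAt (hc h.cont_snd).continuousAt
  refine this.hasFDerivAt.congr_fderiv ?_
  ext <;> simp [Function.HasUncurry.uncurry]

lemma continuous (h : HasPartials f fx fz) : Continuous fun v : ℝ × ℝ => f v.1 v.2 :=
  continuous_iff_continuousAt.2 fun v => (h.hasFDerivAt v).continuousAt

lemma fderiv_eq (h : HasPartials f fx fz) : fderiv ℝ (fun v : ℝ × ℝ => f v.1 v.2) =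
    fun v => fx v.1 v.2 • ContinuousLinearMap.fst ℝ ℝ ℝ
      + fz v.1 v.2 • ContinuousLinearMap.snd ℝ ℝ ℝ :=
  funext fun v => (h.hasFDerivAt v).fderiv

lemma contDiff (h : HasPartials f fx fz) : ContDiff ℝ 1 fun v : ℝ × ℝ => f v.1 v.2 := by
  rw [contDiff_one_iff_fderiv]
  refine ⟨fun v => (h.hasFDerivAt v).differentiableAt, ?_⟩
  rw [h.fderiv_eq]
  exact (h.cont_fst.smul continuous_const).add (h.cont_snd.smul continuous_const)

/-- The chain rule along a curve `(a(t), b(t))`. -/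
lemma comp_hasDerivAt (h : HasPartials f fx fz) {a b : ℝ → ℝ} {a' b' t : ℝ}
    (ha : HasDerivAt a a' t) (hb : HasDerivAt b b' t) :
    HasDerivAt (fun t => f (a t) (b t)) (fx (a t) (b t) * a' + fz (a t) (b t) * b') t := by
  refine ((h.hasFDerivAt (a t, b t)).comp_hasDerivAt t (ha.prodMk hb)).congr_deriv ?_
  simp

lemma add (hf : HasPartials f fx fz) (hg : HasPartials g gx gz) :
    HasPartials (fun x z => f x z + g x z) (fun x z => fx x z + gx x z)
      (fun x z => fz x z + gz x z) :=
  ⟨fun x z => (hf.fst x z).add (hg.fst x z), fun x z => (hf.snd x z).add (hg.snd x z),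
    hf.cont_fst.add hg.cont_fst, hf.cont_snd.add hg.cont_snd⟩

lemma const_mul (hf : HasPartials f fx fz) (c : ℝ) :
    HasPartials (fun x z => c * f x z) (fun x z => c * fx x z) (fun x z => c * fz x z) :=
  ⟨fun x z => (hf.fst x z).const_mul c, fun x z => (hf.snd x z).const_mul c,
    continuous_const.mul hf.cont_fst, continuous_const.mul hf.cont_snd⟩

lemma swap (hf : HasPartials f fx fz) :
    HasPartials (fun z x => f x z) (fun z x => fz x z) (fun z x => fx x z) :=
  ⟨fun z x => hf.snd x z, fun z x => hf.fst x z, hf.cont_snd.comp continuous_swap,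
    hf.cont_fst.comp continuous_swap⟩

/-- Substitution of affine functions of two variables. -/
lemma comp_affine (h : HasPartials f fx fz) (a b c a' b' c' : ℝ) :
    HasPartials (fun x w => f (a * x + b * w + c) (a' * x + b' * w + c'))
      (fun x w => fx (a * x + b * w + c) (a' * x + b' * w + c') * a
        + fz (a * x + b * w + c) (a' * x + b' * w + c') * a')
      (fun x w => fx (a * x + b * w + c) (a' * x + b' * w + c') * b
        + fz (a * x + b * w + c) (a' * x + b' * w + c') * b') := by
  have hl : ∀ (a b : ℝ) x, HasDerivAt (fun x => a * x + b) a x := fun a b x => by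
    simpa using ((hasDerivAt_id x).const_mul a).add_const b
  have hl' : ∀ (a b c : ℝ) x w, HasDerivAt (fun x => a * x + b * w + c) a x := fun a b c x w => by
    simpa [add_assoc] using hl a (b * w + c) x
  have hr' : ∀ (a b c : ℝ) x w, HasDerivAt (fun w => a * x + b * w + c) b w := fun a b c x w => by
    simpa [add_assoc, add_left_comm, add_comm] using hl b (a * x + c) w
  refine ⟨fun x w => h.comp_hasDerivAt (hl' _ _ _ _ _) (hl' _ _ _ _ _),
    fun x w => h.comp_hasDerivAt (hr' _ _ _ _ _) (hr' _ _ _ _ _), ?_, ?_⟩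
  all_goals
    refine Continuous.add (Continuous.mul ?_ continuous_const) (Continuous.mul ?_ continuous_const)
    · exact h.cont_fst.comp (f := fun v : ℝ × ℝ =>
        (a * v.1 + b * v.2 + c, a' * v.1 + b' * v.2 + c')) (by fun_prop)
    · exact h.cont_snd.comp (f := fun v : ℝ × ℝ =>
        (a * v.1 + b * v.2 + c, a' * v.1 + b' * v.2 + c')) (by fun_prop)

end HasPartials

/-- Differentiation under the integral sign for a continuously differentiable integrand. -/
lemma hasDerivAt_integral_param {F Fx : ℝ → ℝ → ℝ} (hF : Continuous fun v : ℝ × ℝ => F v.1 v.2)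
    (hFx : Continuous fun v : ℝ × ℝ => Fx v.1 v.2)
    (hd : ∀ x w, HasDerivAt (fun x => F x w) (Fx x w) x) (a b x : ℝ) :
    HasDerivAt (fun x => ∫ w in a..b, F x w) (∫ w in a..b, Fx x w) x := by
  obtain ⟨C, hC⟩ := ((isCompact_Icc.prod isCompact_uIcc :
    IsCompact (Icc (x - 1) (x + 1) ×ˢ uIcc a b))).exists_bound_of_continuousOn hFx.continuousOn
  refine (intervalIntegral.hasDerivAt_integral_of_dominated_loc_of_deriv_le
    (bound := fun _ => C) (Icc_mem_nhds (by linarith : x - 1 < x) (by linarith : x < x + 1))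
    (Filter.Eventually.of_forall fun y => ?_) ?_ ?_ ?_ ?_ ?_).2
  · exact (hF.comp (f := fun w => (y, w)) (by fun_prop)).aestronglyMeasurable
  · exact (hF.comp (f := fun w => (x, w)) (by fun_prop)).intervalIntegrable _ _
  · exact (hFx.comp (f := fun w => (x, w)) (by fun_prop)).aestronglyMeasurable
  · exact Filter.Eventually.of_forall fun w hw y hy => hC (y, w) ⟨hy, uIoc_subset_uIcc hw⟩
  · exact continuous_const.intervalIntegrable _ _
  · exact Filter.Eventually.of_forall fun w hw y hy => hd y w

/-- Fubini's theorem for a continuous integrand. -/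
lemma integral_swap_of_continuous {F : ℝ → ℝ → ℝ} (hF : Continuous fun v : ℝ × ℝ => F v.1 v.2)
    (a b c d : ℝ) : ∫ x in a..b, ∫ z in c..d, F x z = ∫ z in c..d, ∫ x in a..b, F x z := by
  refine intervalIntegral_intervalIntegral_swap ?_
  exact (hF.continuousOn.integrableOn_compact (isCompact_uIcc.prod isCompact_uIcc)).mono_set
    (Set.prod_mono uIoc_subset_uIcc uIoc_subset_uIcc)

/-- The primitive `∫∫ F` over rectangles has the one-fold primitives as partial derivatives. -/
lemma hasPartials_double_primitive {F : ℝ → ℝ → ℝ} (hF : Continuous fun v : ℝ × ℝ => F v.1 v.2)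
    (x₀ z₀ : ℝ) :
    HasPartials (fun x z => ∫ x' in x₀..x, ∫ z' in z₀..z, F x' z')
      (fun x z => ∫ z' in z₀..z, F x z') (fun x z => ∫ x' in x₀..x, F x' z) := by
  have h1 : Continuous fun v : ℝ × ℝ => ∫ z' in z₀..v.2, F v.1 z' := by
    refine intervalIntegral.continuous_parametric_intervalIntegral_of_continuous
      (f := fun (v : ℝ × ℝ) z' => F v.1 z') ?_ (by fun_prop)
    exact hF.comp (f := fun u : (ℝ × ℝ) × ℝ => (u.1.1, u.2)) (by fun_prop)
  have h2 : Continuous fun v : ℝ × ℝ => ∫ x' in x₀..v.1, F x' v.2 := by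
    refine intervalIntegral.continuous_parametric_intervalIntegral_of_continuous
      (f := fun (v : ℝ × ℝ) x' => F x' v.2) ?_ (by fun_prop)
    exact hF.comp (f := fun u : (ℝ × ℝ) × ℝ => (u.2, u.1.2)) (by fun_prop)
  refine ⟨fun x z => ?_, fun x z => ?_, h1, h2⟩
  · have hc : Continuous fun x' => ∫ z' in z₀..z, F x' z' :=
      h1.comp (f := fun x' => (x', z)) (by fun_prop)
    exact intervalIntegral.integral_hasDerivAt_right (hc.intervalIntegrable _ _)
      hc.stronglyMeasurable.stronglyMeasurableAtFilter hc.continuousAt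
  · have hc : Continuous fun z' => ∫ x' in x₀..x, F x' z' :=
      h2.comp (f := fun z' => (x, z')) (by fun_prop)
    simp_rw [integral_swap_of_continuous hF]
    exact intervalIntegral.integral_hasDerivAt_right (hc.intervalIntegrable _ _)
      hc.stronglyMeasurable.stronglyMeasurableAtFilter hc.continuousAt

lemma hasPartials_weighted_primitive {q : ℝ → ℝ} (hq : Continuous q) {h hx hw : ℝ → ℝ → ℝ}
    (hh : HasPartials h hx hw) :
    HasPartials (fun x β => ∫ w in (0 : ℝ)..β, q w * h x w)
      (fun x β => ∫ w in (0 : ℝ)..β, q w * hx x w) (fun x β => q β * h x β) := by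
  have hc := hh.continuous
  have hcx := hh.cont_fst
  have c1 : Continuous fun v : ℝ × ℝ => q v.2 * h v.1 v.2 := (hq.comp continuous_snd).mul hc
  have c2 : Continuous fun v : ℝ × ℝ => q v.2 * hx v.1 v.2 := (hq.comp continuous_snd).mul hcx
  refine ⟨fun x β => ?_, fun x β => ?_, ?_, c1⟩
  · exact hasDerivAt_integral_param (F := fun x w => q w * h x w) c1 c2
      (fun x w => (hh.fst x w).const_mul (q w)) 0 β x
  · have hc : Continuous fun w => q w * h x w := c1.comp (f := fun w => (x, w)) (by fun_prop)
    exact intervalIntegral.integral_hasDerivAt_right (hc.intervalIntegrable _ _)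
      hc.stronglyMeasurable.stronglyMeasurableAtFilter hc.continuousAt
  · refine intervalIntegral.continuous_parametric_intervalIntegral_of_continuous
      (f := fun (v : ℝ × ℝ) w => q w * hx v.1 w) ?_ (by fun_prop)
    exact c2.comp (f := fun u : (ℝ × ℝ) × ℝ => (u.1.1, u.2)) (by fun_prop)

/-- The substitution `w = (z' - x) / 2` moves the variable `x` out of the coefficient `q`. -/
lemma integral_char_eq (q : ℝ → ℝ) (f : ℝ → ℝ → ℝ) (z₀ x z : ℝ) :
    ∫ z' in z₀..z, q ((z' - x) / 2) * f x z'
      = 2 * ∫ w in ((z₀ - x) / 2)..((z - x) / 2), q w * f x (x + 2 * w) := by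
  have := intervalIntegral.integral_comp_div_sub (a := z₀) (b := z)
    (fun w => q w * f x (x + 2 * w)) (two_ne_zero (α := ℝ)) (x / 2)
  simp only [smul_eq_mul] at this
  rw [← sub_div, ← sub_div] at this
  rw [← this]
  refine intervalIntegral.integral_congr fun z' _ => ?_
  rw [← sub_div]
  congr 2
  ring

/-- Integrals of `q((z' - x)/2) f(x, z')` along a characteristic are `C¹` as soon as `f` is: no
derivative of `q` is needed. -/
lemma exists_hasPartials_char {q : ℝ → ℝ} (hq : Continuous q) {f fx fz : ℝ → ℝ → ℝ}
    (hf : HasPartials f fx fz) (z₀ : ℝ) :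
    ∃ Ax, HasPartials (fun x z => ∫ z' in z₀..z, q ((z' - x) / 2) * f x z') Ax
      (fun x z => q ((z - x) / 2) * f x z) := by
  have hh := hf.comp_affine 1 0 0 1 2 0
  have hJ := hasPartials_weighted_primitive hq hh
  have hA := ((hJ.comp_affine 1 0 0 (-1 / 2) (1 / 2) 0).add
    ((hJ.comp_affine 1 0 0 (-1 / 2) 0 (z₀ / 2)).const_mul (-1))).const_mul 2
  obtain ⟨F, Fx, Fz, hA, hF⟩ : ∃ F Fx Fz, HasPartials F Fx Fz ∧
      ∀ x z, ∫ z' in z₀..z, q ((z' - x) / 2) * f x z' = F x z := by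
    refine ⟨_, _, _, hA, fun x z => ?_⟩
    rw [integral_char_eq]
    have hc : Continuous fun w => q w * f x (x + 2 * w) :=
      hq.mul (hf.continuous.comp (f := fun w => (x, x + 2 * w)) (by fun_prop))
    rw [← intervalIntegral.integral_interval_sub_left (a := 0) (hc.intervalIntegrable _ _)
      (hc.intervalIntegrable _ _)]
    simp only [one_mul, zero_mul, add_zero, neg_mul]
    rw [show -1 / 2 * x + 1 / 2 * z = (z - x) / 2 by ring,
      show -1 / 2 * x + z₀ / 2 = (z₀ - x) / 2 by ring]
    ring
  refine ⟨Fx, ?_, ?_, hA.cont_fst, ?_⟩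
  · intro x z
    refine (hA.fst x z).congr_of_eventuallyEq (Filter.Eventually.of_forall fun x => hF x z)
  · intro x z
    have hc : Continuous fun z' => q ((z' - x) / 2) * f x z' :=
      (hq.comp (by fun_prop)).mul (hf.continuous.comp (f := fun z' => (x, z')) (by fun_prop))
    exact intervalIntegral.integral_hasDerivAt_right (hc.intervalIntegrable _ _)
      hc.stronglyMeasurable.stronglyMeasurableAtFilter hc.continuousAt
  · exact (hq.comp (by fun_prop)).mul hf.continuous

/-- The derivative in `t`, for fixed `y`, where `x = t - y` and `z = t + y`. -/
lemma hasDerivAt_char_time {q : ℝ → ℝ} (hq : Continuous q) {f fx fz : ℝ → ℝ → ℝ}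
    (hf : HasPartials f fx fz) (z₀ y t : ℝ) :
    HasDerivAt (fun t => ∫ z' in z₀..(t + y), q ((z' - (t - y)) / 2) * f (t - y) z')
      ((∫ z' in z₀..(t + y), q ((z' - (t - y)) / 2) * (fx (t - y) z' + fz (t - y) z'))
        + q ((z₀ - (t - y)) / 2) * f (t - y) z₀) t := by
  have hh := hf.comp_affine 1 0 0 1 2 0
  have hJ := hasPartials_weighted_primitive hq hh
  have hx : HasDerivAt (fun t => t - y) 1 t := (hasDerivAt_id t).sub_const y
  have hb : HasDerivAt (fun t => (z₀ - (t - y)) / 2) (-1 / 2) t := by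
    simpa using (hx.const_sub z₀).div_const 2
  have h1 := hJ.comp_hasDerivAt hx (hasDerivAt_const t y)
  have h2 := hJ.comp_hasDerivAt hx hb
  have h3 := (h1.sub h2).const_mul 2
  refine (h3.congr_of_eventuallyEq (Filter.Eventually.of_forall fun t => ?_)).congr_deriv ?_
  · simp only
    rw [integral_char_eq]
    have hc : Continuous fun w => q w * f (t - y) (t - y + 2 * w) :=
      hq.mul (hf.continuous.comp (f := fun w => (t - y, t - y + 2 * w)) (by fun_prop))
    rw [← intervalIntegral.integral_interval_sub_left (a := 0) (hc.intervalIntegrable _ _)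
      (hc.intervalIntegrable _ _)]
    simp only [one_mul, zero_mul, add_zero, Pi.sub_apply]
    rw [show (t + y - (t - y)) / 2 = y by ring]
  · have hc : Continuous fun w => q w * (fx (t - y) (t - y + 2 * w)
        + fz (t - y) (t - y + 2 * w)) :=
      hq.mul ((hf.cont_fst.comp (f := fun w => (t - y, t - y + 2 * w)) (by fun_prop)).add
        (hf.cont_snd.comp (f := fun w => (t - y, t - y + 2 * w)) (by fun_prop)))
    rw [integral_char_eq q (fun x z => fx x z + fz x z)]
    rw [← intervalIntegral.integral_interval_sub_left (a := 0) (hc.intervalIntegrable _ _)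
      (hc.intervalIntegrable _ _)]
    simp only [one_mul, zero_mul, add_zero, mul_one, mul_zero]
    rw [show (t + y - (t - y)) / 2 = y by ring,
      show t - y + 2 * ((z₀ - (t - y)) / 2) = z₀ by ring]
    ring

/-! ### Goursat problems -/

/-- `W` is a `C²` function of the characteristic variables `(x, z)`, with first derivatives `P`,
`Q` and mixed derivative `B`. -/
structure HasCharDerivs (W P Q B : ℝ → ℝ → ℝ) : Prop where
  first : HasPartials W P Q
  second_fst : ∃ Px, HasPartials P Px B
  second_snd : ∃ Qz, HasPartials Q B Qz

namespace HasCharDerivs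

variable {W P Q B : ℝ → ℝ → ℝ}

lemma contDiff (h : HasCharDerivs W P Q B) : ContDiff ℝ 2 fun v : ℝ × ℝ => W v.1 v.2 := by
  obtain ⟨Px, hP⟩ := h.second_fst
  obtain ⟨Qz, hQ⟩ := h.second_snd
  rw [show (2 : WithTop ℕ∞) = 1 + 1 by norm_num, contDiff_succ_iff_fderiv]
  refine ⟨fun v => (h.first.hasFDerivAt v).differentiableAt, by simp, ?_⟩
  rw [h.first.fderiv_eq]
  exact (hP.contDiff.smul contDiff_const).add (hQ.contDiff.smul contDiff_const)

/-- In the variables `y`, `t` the mixed derivative is a quarter of the wave operator. -/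
lemma wave (h : HasCharDerivs W P Q B) : ∃ Wt Wtt Wy Wyy : ℝ → ℝ → ℝ,
    (∀ y t, HasDerivAt (fun t => W (t - y) (t + y)) (Wt y t) t) ∧
    (∀ y t, HasDerivAt (fun t => Wt y t) (Wtt y t) t) ∧
    (∀ y t, HasDerivAt (fun y => W (t - y) (t + y)) (Wy y t) y) ∧
    (∀ y t, HasDerivAt (fun y => Wy y t) (Wyy y t) y) ∧
    (∀ y t, Wy y t = Q (t - y) (t + y) - P (t - y) (t + y)) ∧
    (∀ y t, Wtt y t - Wyy y t = 4 * B (t - y) (t + y)) := by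
  obtain ⟨Px, hP⟩ := h.second_fst
  obtain ⟨Qz, hQ⟩ := h.second_snd
  have t1 : ∀ y t : ℝ, HasDerivAt (fun t => t - y) 1 t := fun y t => (hasDerivAt_id t).sub_const y
  have t2 : ∀ y t : ℝ, HasDerivAt (fun t => t + y) 1 t := fun y t => (hasDerivAt_id t).add_const y
  have y1 : ∀ y t : ℝ, HasDerivAt (fun y => t - y) (-1) y :=
    fun y t => (hasDerivAt_id y).const_sub t
  have y2 : ∀ y t : ℝ, HasDerivAt (fun y => t + y) 1 y := fun y t => (hasDerivAt_id y).const_add t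
  refine ⟨fun y t => P (t - y) (t + y) * 1 + Q (t - y) (t + y) * 1, _,
    fun y t => P (t - y) (t + y) * (-1) + Q (t - y) (t + y) * 1, _,
    fun y t => h.first.comp_hasDerivAt (t1 y t) (t2 y t),
    fun y t => ((hP.comp_hasDerivAt (t1 y t) (t2 y t)).mul_const 1).add
      ((hQ.comp_hasDerivAt (t1 y t) (t2 y t)).mul_const 1),
    fun y t => h.first.comp_hasDerivAt (y1 y t) (y2 y t),
    fun y t => ((hP.comp_hasDerivAt (y1 y t) (y2 y t)).mul_const (-1)).add
      ((hQ.comp_hasDerivAt (y1 y t) (y2 y t)).mul_const 1), ?_, ?_⟩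
  · intro y t; ring
  · intro y t; ring

end HasCharDerivs

/-- A continuous solution of the Goursat problem in integral form is `C²` when the data `g` are,
although the potential `q` is merely continuous. -/
theorem goursat_regularity {q : ℝ → ℝ} (hq : Continuous q) {g gx gz gxz W : ℝ → ℝ → ℝ}
    (hg : HasCharDerivs g gx gz gxz) (hW : Continuous fun v : ℝ × ℝ => W v.1 v.2) (c x₀ z₀ : ℝ)
    (h : ∀ x z, W x z
      = g x z + ∫ x' in x₀..x, ∫ z' in z₀..z, c * q ((z' - x') / 2) * W x' z') :
    HasCharDerivs W (fun x z => gx x z + c * ∫ z' in z₀..z, q ((z' - x) / 2) * W x z')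
      (fun x z => gz x z + c * ∫ x' in x₀..x, q ((z - x') / 2) * W x' z)
      (fun x z => gxz x z + c * (q ((z - x) / 2) * W x z)) := by
  have hF : Continuous fun v : ℝ × ℝ => q ((v.2 - v.1) / 2) * W v.1 v.2 :=
    (hq.comp (by fun_prop)).mul hW
  have hWeq : W = fun x z =>
      g x z + c * ∫ x' in x₀..x, ∫ z' in z₀..z, q ((z' - x') / 2) * W x' z' := by
    funext x z
    rw [h x z]
    simp only [mul_assoc, intervalIntegral.integral_const_mul]
  have first : HasPartials W (fun x z => gx x z + c * ∫ z' in z₀..z, q ((z' - x) / 2) * W x z')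
      (fun x z => gz x z + c * ∫ x' in x₀..x, q ((z - x') / 2) * W x' z) := by
    have := hg.first.add ((hasPartials_double_primitive
      (F := fun x z => q ((z - x) / 2) * W x z) hF x₀ z₀).const_mul c)
    rwa [← hWeq] at this
  refine ⟨first, ?_, ?_⟩
  · obtain ⟨Px, hP⟩ := hg.second_fst
    obtain ⟨Ax, hA⟩ := exists_hasPartials_char hq first z₀
    exact ⟨_, hP.add (hA.const_mul c)⟩
  · obtain ⟨Qz, hQ⟩ := hg.second_snd
    obtain ⟨Az, hA⟩ := exists_hasPartials_char (q := fun w => q (-w)) (by fun_prop) first.swap x₀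
    have hA' := hA.swap
    have e : ∀ x z : ℝ, -((x - z) / 2) = (z - x) / 2 := fun x z => by ring
    simp only [e] at hA'
    exact ⟨_, hQ.add (hA'.const_mul c)⟩

/-! ### Reduction to canonical form -/

/-- Functions of class `Cⁿ` on a half-line extend to the line. -/
lemma exists_contDiff_extension (n : ℕ) : ∀ f : ℝ → ℝ, ContDiffOn ℝ n f (Ici 0) →
    ∃ g : ℝ → ℝ, ContDiff ℝ n g ∧ EqOn g f (Ici 0) := by
  induction n with
  | zero =>
    intro f hf
    refine ⟨fun x => f (max x 0), ?_, fun x hx => by simp [max_eq_left (mem_Ici.1 hx)]⟩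
    simp only [CharP.cast_eq_zero, contDiff_zero] at hf ⊢
    exact (contDiffOn_zero.1 hf).comp_continuous (by fun_prop) fun x => mem_Ici.2 (le_max_right _ _)
  | succ n ih =>
    intro f hf
    push_cast at hf
    rw [contDiffOn_succ_iff_derivWithin (uniqueDiffOn_Ici 0)] at hf
    obtain ⟨hd, -, hf'⟩ := hf
    obtain ⟨h, hh, heq⟩ := ih _ hf'
    have hderiv : ∀ x, HasDerivAt (fun x => f 0 + ∫ t in (0 : ℝ)..x, h t) (h x) x := fun x =>
      (intervalIntegral.integral_hasDerivAt_right (hh.continuous.intervalIntegrable _ _)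
        hh.continuous.stronglyMeasurable.stronglyMeasurableAtFilter
        hh.continuous.continuousAt).const_add _
    refine ⟨fun x => f 0 + ∫ t in (0 : ℝ)..x, h t, ?_, fun x hx => ?_⟩
    · push_cast
      rw [contDiff_succ_iff_deriv]
      refine ⟨fun x => (hderiv x).differentiableAt, by simp, ?_⟩
      rwa [show deriv _ = h from funext fun x => (hderiv x).deriv]
    · have := intervalIntegral.integral_eq_sub_of_hasDerivAt_of_le (f := f) (f' := h) (mem_Ici.1 hx)
        (hd.continuousOn.mono Icc_subset_Ici_self) (fun t ht => ?_)
        (hh.continuous.intervalIntegrable _ _)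
      · simp only [this]; ring
      · rw [heq (mem_Ici.2 ht.1.le)]
        exact ((hd t ht.1.le).hasDerivWithinAt).hasDerivAt (Ici_mem_nhds ht.1)

/-- `s` is a `C²` positive function on the line that equals `√σ` for `y ≥ 0`. -/
structure IsAmplitude (ρ : ℝ) (n₀ s : ℝ → ℝ) : Prop where
  contDiff : ContDiff ℝ 2 s
  pos : ∀ y, 0 < s y
  eq : ∀ y, 0 ≤ y → s y = √(admittance ρ n₀ y)

/-- It is `log n₀` that is extended, which keeps `s` positive. -/
lemma exists_isAmplitude {ρ : ℝ} (hρ : 0 < ρ) {n₀ : ℝ → ℝ} (hpos : ∀ y, 0 ≤ y → 0 < n₀ y)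
    (hn₀ : ContDiffOn ℝ 3 n₀ (Ici 0)) : ∃ s, IsAmplitude ρ n₀ s := by
  have h1 : ContDiffOn ℝ (2 : ℕ) (fun y => Real.log (n₀ y)) (Ici 0) :=
    (hn₀.of_le (by norm_num)).log fun y hy => (hpos y hy).ne'
  obtain ⟨L, hL, heq⟩ := exists_contDiff_extension 2 _ h1
  have h2 : ∀ y, 0 < Real.exp (L y) / ρ := fun y => div_pos (Real.exp_pos _) hρ
  refine ⟨fun y => √(Real.exp (L y) / ρ), ?_, fun y => Real.sqrt_pos.2 (h2 y), fun y hy => ?_⟩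
  · exact ((Real.contDiff_exp.comp hL).div_const ρ).sqrt fun y => (h2 y).ne'
  · simp only [heq (mem_Ici.2 hy), Real.exp_log (hpos y hy), admittance]

lemma IsAmplitude.sq {ρ : ℝ} (hρ : 0 < ρ) {n₀ s : ℝ → ℝ} (hpos : ∀ y, 0 ≤ y → 0 < n₀ y)
    (hs : IsAmplitude ρ n₀ s) {y : ℝ} (hy : 0 ≤ y) : admittance ρ n₀ y = s y ^ 2 := by
  rw [hs.eq y hy, Real.sq_sqrt (show 0 ≤ admittance ρ n₀ y from (div_pos (hpos y hy) hρ).le)]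

/-- The part `(√σ)'' / √σ` of the potential, extended evenly. -/
noncomputable def basePotential (s : ℝ → ℝ) (w : ℝ) : ℝ := deriv (deriv s) |w| / s |w|

/-- The part of the potential that multiplies `|ξ|²`, extended evenly. -/
noncomputable def slowness (n₀ : ℝ → ℝ) (w : ℝ) : ℝ := 1 / n₀ |w| ^ 2

/-- The potential `(√σ)'' / √σ + l / n₀²` of the wave equation in canonical form, `l = |ξ|²`,
extended evenly to the line. -/
noncomputable def potential (n₀ s : ℝ → ℝ) (l w : ℝ) : ℝ := basePotential s w + l * slowness n₀ w

lemma IsAmplitude.hasDerivAt {ρ : ℝ} {n₀ s : ℝ → ℝ} (hs : IsAmplitude ρ n₀ s) (y : ℝ) :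
    HasDerivAt s (deriv s y) y :=
  (hs.contDiff.differentiable (by norm_num) y).hasDerivAt

lemma IsAmplitude.contDiff_deriv {ρ : ℝ} {n₀ s : ℝ → ℝ} (hs : IsAmplitude ρ n₀ s) :
    ContDiff ℝ 1 (deriv s) := by
  have h := hs.contDiff
  rw [show (2 : WithTop ℕ∞) = 1 + 1 by norm_num, contDiff_succ_iff_deriv] at h
  exact h.2.2

lemma IsAmplitude.hasDerivAt_deriv {ρ : ℝ} {n₀ s : ℝ → ℝ} (hs : IsAmplitude ρ n₀ s) (y : ℝ) :
    HasDerivAt (deriv s) (deriv (deriv s) y) y :=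
  (hs.contDiff_deriv.differentiable (by norm_num) y).hasDerivAt

lemma IsAmplitude.continuous_basePotential {ρ : ℝ} {n₀ s : ℝ → ℝ} (hs : IsAmplitude ρ n₀ s) :
    Continuous (basePotential s) :=
  ((hs.contDiff_deriv.continuous_deriv (by norm_num)).comp continuous_abs).div₀
    (hs.contDiff.continuous.comp continuous_abs) fun w => (hs.pos _).ne'

lemma continuous_slowness {n₀ : ℝ → ℝ} (hpos : ∀ y, 0 ≤ y → 0 < n₀ y)
    (hn₀ : ContinuousOn n₀ (Ici 0)) : Continuous (slowness n₀) :=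
  continuous_const.div₀ ((hn₀.comp_continuous continuous_abs fun w =>
    mem_Ici.2 (abs_nonneg w)).pow 2) fun w => (pow_pos (hpos _ (abs_nonneg w)) 2).ne'

lemma basePotential_neg (s : ℝ → ℝ) (w : ℝ) : basePotential s (-w) = basePotential s w := by
  simp [basePotential]

lemma slowness_neg (n₀ : ℝ → ℝ) (w : ℝ) : slowness n₀ (-w) = slowness n₀ w := by
  simp [slowness]

lemma potential_neg (n₀ s : ℝ → ℝ) (l w : ℝ) : potential n₀ s l (-w) = potential n₀ s l w := by
  simp [potential, basePotential_neg, slowness_neg]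

section Canonical

variable {ρ : ℝ} {n₀ s : ℝ → ℝ} {W P Q B : ℝ → ℝ → ℝ}

/-- The wave operator on `W / √σ`. -/
lemma waveOp_eq (hρ : 0 < ρ) (hpos : ∀ y, 0 ≤ y → 0 < n₀ y) (hs : IsAmplitude ρ n₀ s)
    (hW : HasCharDerivs W P Q B) (ξ : Plane) {w : ℝ → ℝ → ℝ} {y t : ℝ} (hy : 0 < y)
    (h : ∀ᶠ v : ℝ × ℝ in nhds (y, t), w v.1 v.2 = W (v.2 - v.1) (v.2 + v.1) / s v.1) :
    waveOp ρ n₀ ξ w y t = s y * (4 * B (t - y) (t + y)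
      + potential n₀ s (‖ξ‖ ^ 2) y * W (t - y) (t + y)) := by
  obtain ⟨Wt, Wtt, Wy, Wyy, h1, h2, h3, h4, -, h5⟩ := hW.wave
  have ht : ∀ᶠ τ in nhds t, w y τ = W (τ - y) (τ + y) / s y :=
    (Continuous.tendsto (f := fun τ => (y, τ)) (by fun_prop) t).eventually h
  have ht2 : iteratedDeriv 2 (fun τ => w y τ) t = Wtt y t / s y := by
    rw [iteratedDeriv_succ, iteratedDeriv_one]
    have : deriv (fun τ => w y τ) =ᶠ[nhds t] fun τ => Wt y τ / s y := by
      filter_upwards [ht.eventually_nhds] with τ hτ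
      rw [Filter.EventuallyEq.deriv_eq hτ]
      exact ((h1 y τ).div_const _).deriv
    rw [this.deriv_eq]
    exact ((h2 y t).div_const _).deriv
  have hy' : ∀ᶠ x in nhds y, w x t = W (t - x) (t + x) / s x :=
    (Continuous.tendsto (f := fun x => (x, t)) (by fun_prop) y).eventually h
  have hy2 : deriv (fun x => admittance ρ n₀ x * deriv (fun x' => w x' t) x) y
      = Wyy y t * s y - W (t - y) (t + y) * deriv (deriv s) y := by
    have : (fun x => admittance ρ n₀ x * deriv (fun x' => w x' t) x) =ᶠ[nhds y]
        fun x => Wy x t * s x - W (t - x) (t + x) * deriv s x := by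
      filter_upwards [hy'.eventually_nhds, Ioi_mem_nhds hy] with x hx hx0
      rw [Filter.EventuallyEq.deriv_eq hx, hs.sq hρ hpos (mem_Ioi.1 hx0).le]
      have := ((h3 x t).div (hs.hasDerivAt x) (hs.pos x).ne').deriv
      rw [show (fun x => W (t - x) (t + x) / s x)
        = (fun x => W (t - x) (t + x)) / s from rfl, this]
      field_simp [(hs.pos x).ne']
    rw [this.deriv_eq]
    refine (((h4 y t).mul (hs.hasDerivAt y)).sub
      ((h3 y t).mul (hs.hasDerivAt_deriv y))).deriv.trans ?_
    ring
  have h0 : w y t = W (t - y) (t + y) / s y := h.self_of_nhds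
  rw [waveOp, ht2, hy2, h0, hs.sq hρ hpos hy.le, ← h5, potential, basePotential, slowness,
    abs_of_pos hy]
  have := (hs.pos y).ne'
  have := (hpos y hy.le).ne'
  field_simp
  ring

/-- A `C²` function `W` of the characteristic variables whose support in `{y ≥ 0, t ∈ T}` is
bounded gives rise to a test function that equals `W / √σ` there. -/
lemma exists_isTest (hρ : 0 < ρ) (hpos : ∀ y, 0 ≤ y → 0 < n₀ y) (hs : IsAmplitude ρ n₀ s)
    (hW : HasCharDerivs W P Q B) {T : Set ℝ} (hT : IsOpen T) (Z : ℝ)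
    (hZ : ∀ y t, 0 ≤ y → t ∈ T → Z ≤ max y |t| → W (t - y) (t + y) = 0) :
    ∃ w : ℝ → ℝ → ℝ, IsTest w ∧
      (∀ y t, 0 ≤ y → t ∈ T → w y t = W (t - y) (t + y) / s y) ∧
      (∀ (ξ : Plane) (y t : ℝ), 0 < y → t ∈ T → waveOp ρ n₀ ξ w y t
        = s y * (4 * B (t - y) (t + y) + potential n₀ s (‖ξ‖ ^ 2) y * W (t - y) (t + y))) ∧
      (∀ y t, 0 < y → t ∈ T → ∀ Wt Wtt : ℝ → ℝ → ℝ,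
        (∀ y t, HasDerivAt (fun t => W (t - y) (t + y)) (Wt y t) t) →
        (∀ y t, HasDerivAt (fun t => Wt y t) (Wtt y t) t) →
        iteratedDeriv 2 (fun τ => w y τ) t = Wtt y t / s y) ∧
      (∀ t, W t t = 0 → w 0 t = 0) ∧
      (∀ t, |t| ≤ Z → W t t = 0 → deriv (fun y => w y t) 0 = (Q t t - P t t) / s 0) ∧
      (∀ t, (∀ y, W (t - y) (t + y) = 0) → deriv (fun y => w y t) 0 = 0) := by
  let χ : ContDiffBump (0 : ℝ × ℝ) := ⟨|Z| + 1, |Z| + 2, by positivity, by linarith⟩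
  set w : ℝ → ℝ → ℝ := fun y t => χ (y, t) * (W (t - y) (t + y) / s y) with hw
  have hWc : ContDiff ℝ 2 fun v : ℝ × ℝ => W (v.2 - v.1) (v.2 + v.1) :=
    hW.contDiff.comp (contDiff_snd.sub contDiff_fst |>.prodMk (contDiff_snd.add contDiff_fst))
  have e1 : ∀ y t, 0 ≤ y → t ∈ T → w y t = W (t - y) (t + y) / s y := by
    intro y t hy ht
    simp only [hw]
    by_cases hb : Z ≤ max y |t|
    · simp [hZ y t hy ht hb]
    · rw [χ.one_of_mem_closedBall, one_mul]
      rw [mem_closedBall_zero_iff, Prod.norm_mk, Real.norm_eq_abs, Real.norm_eq_abs,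
        abs_of_nonneg hy]
      change max y |t| ≤ |Z| + 1
      push Not at hb
      linarith [le_abs_self Z]
  have e2 : ∀ y t, 0 < y → t ∈ T → ∀ᶠ v : ℝ × ℝ in nhds (y, t),
      w v.1 v.2 = W (v.2 - v.1) (v.2 + v.1) / s v.1 := by
    intro y t hy ht
    filter_upwards [(isOpen_Ioi.prod hT).mem_nhds (show (y, t) ∈ Ioi 0 ×ˢ T from ⟨hy, ht⟩)]
      with v hv
    exact e1 v.1 v.2 (mem_Ioi.1 hv.1).le hv.2
  refine ⟨w, ⟨?_, ?_⟩, e1, fun ξ y t hy ht => waveOp_eq hρ hpos hs hW ξ hy (e2 y t hy ht), ?_, ?_,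
    ?_, ?_⟩
  · exact χ.contDiff.mul (hWc.div (hs.contDiff.comp contDiff_fst) fun v => (hs.pos _).ne')
  · exact χ.hasCompactSupport.mul_right
  · intro y t hy ht Wt Wtt h1 h2
    have ht : ∀ᶠ τ in nhds t, w y τ = W (τ - y) (τ + y) / s y :=
      (Continuous.tendsto (f := fun τ => (y, τ)) (by fun_prop) t).eventually (e2 y t hy ht)
    rw [iteratedDeriv_succ, iteratedDeriv_one]
    have : deriv (fun τ => w y τ) =ᶠ[nhds t] fun τ => Wt y τ / s y := by
      filter_upwards [ht.eventually_nhds] with τ hτ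
      rw [Filter.EventuallyEq.deriv_eq hτ]
      exact ((h1 y τ).div_const _).deriv
    rw [this.deriv_eq]
    exact ((h2 y t).div_const _).deriv
  · intro t ht
    simp [hw, ht]
  · intro t ht h0
    obtain ⟨Wt, Wtt, Wy, Wyy, -, -, h3, -, h4, -⟩ := hW.wave
    have hmem : Metric.ball (0 : ℝ × ℝ) (|Z| + 1) ∈ nhds ((0 : ℝ), t) := by
      refine Metric.isOpen_ball.mem_nhds ?_
      rw [mem_ball_zero_iff, Prod.norm_mk, Real.norm_eq_abs, Real.norm_eq_abs, abs_zero,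
        max_eq_right (abs_nonneg t)]
      linarith [le_abs_self Z]
    have hev : ∀ᶠ y in nhds (0 : ℝ), w y t = W (t - y) (t + y) / s y := by
      filter_upwards [(Continuous.tendsto (f := fun y : ℝ => (y, t)) (by fun_prop) 0).eventually
        hmem] with y hy
      simp only [hw]
      rw [χ.one_of_mem_closedBall (Metric.ball_subset_closedBall hy), one_mul]
    rw [Filter.EventuallyEq.deriv_eq hev]
    have := ((h3 0 t).div (hs.hasDerivAt 0) (hs.pos 0).ne').deriv
    rw [show (fun x => W (t - x) (t + x) / s x)
        = (fun x => W (t - x) (t + x)) / s from rfl, this, h4]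
    simp only [sub_zero, add_zero, h0, zero_mul]
    have := (hs.pos 0).ne'
    field_simp
  · intro t h0
    simp [hw, h0]

lemma setIntegral_halfSpace_eq_quarter {f f' : ℝ × ℝ → ℝ}
    (h1 : ∀ y t, 0 < y → 0 < t → f (y, t) = f' (y, t)) (h2 : ∀ y t, 0 < y → t ≤ 0 → f (y, t) = 0) :
    ∫ x in halfSpace, f x = ∫ x in Ioi 0 ×ˢ Ioi 0, f' x := by
  have e1 : (halfSpace : Set (ℝ × ℝ)) =ᵐ[volume] (Ioi (0 : ℝ) ×ˢ (univ : Set ℝ) : Set (ℝ × ℝ)) :=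
    (Measure.set_prod_ae_eq Ioi_ae_eq_Ici (Filter.EventuallyEq.rfl)).symm
  rw [setIntegral_congr_set e1]
  have e2 : ∫ x in Ioi (0 : ℝ) ×ˢ Ioi (0 : ℝ), f' x = ∫ x in Ioi (0 : ℝ) ×ˢ Ioi (0 : ℝ), f x :=
    setIntegral_congr_fun (measurableSet_Ioi.prod measurableSet_Ioi)
      fun x hx => (h1 x.1 x.2 hx.1 hx.2).symm
  rw [e2]
  refine setIntegral_eq_of_subset_of_forall_sdiff_eq_zero (measurableSet_Ioi.prod .univ)
    (Set.prod_mono subset_rfl (subset_univ _)) fun x hx => ?_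
  exact h2 x.1 x.2 hx.1.1 (not_lt.1 fun h => hx.2 ⟨hx.1.1, h⟩)

lemma setIntegral_halfSpace_eq_open {f f' : ℝ × ℝ → ℝ}
    (h1 : ∀ y t, 0 < y → f (y, t) = f' (y, t)) :
    ∫ x in halfSpace, f x = ∫ x in Ioi 0 ×ˢ univ, f' x := by
  have e1 : (halfSpace : Set (ℝ × ℝ)) =ᵐ[volume] (Ioi (0 : ℝ) ×ˢ (univ : Set ℝ) : Set (ℝ × ℝ)) :=
    (Measure.set_prod_ae_eq Ioi_ae_eq_Ici (Filter.EventuallyEq.rfl)).symm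
  rw [setIntegral_congr_set e1]
  exact setIntegral_congr_fun (measurableSet_Ioi.prod .univ) fun x hx => h1 x.1 x.2 hx.1

/-- The zero-order problem in canonical form, tested with `W` vanishing at `y = 0`. -/
lemma IsZeroOrderWave.canonical (hρ : 0 < ρ) (hpos : ∀ y, 0 ≤ y → 0 < n₀ y)
    (hs : IsAmplitude ρ n₀ s) {ξ : Plane} {U : ℝ → ℝ → ℝ} (hU : IsZeroOrderWave ρ n₀ ξ U)
    (hW : HasCharDerivs W P Q B) {Z : ℝ} (hdiag : ∀ t, W t t = 0)
    (hx : ∀ x z, Z ≤ x → W x z = 0) (hz : ∀ x z, Z ≤ z → W x z = 0) :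
    ∫ v in Ioi (0 : ℝ) ×ˢ Ioi (0 : ℝ), s v.1 * U v.1 v.2 * (4 * B (v.2 - v.1) (v.2 + v.1)
        + potential n₀ s (‖ξ‖ ^ 2) v.1 * W (v.2 - v.1) (v.2 + v.1))
      = ∫ t in Ioi (0 : ℝ), (Q t t - P t t) := by
  obtain ⟨w, hw, e1, e2, -, e4, e5, e6⟩ := exists_isTest hρ hpos hs hW isOpen_Ioi Z
    (fun y t hy ht hZ => by
      refine hz _ _ ?_
      rw [abs_of_pos (mem_Ioi.1 ht)] at hZ
      rcases le_max_iff.1 hZ with h | h <;> linarith [mem_Ioi.1 ht])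
  have := hU.weak w hw fun t => e4 t (hdiag t)
  rw [setIntegral_halfSpace_eq_quarter (f' := fun v => s v.1 * U v.1 v.2 *
    (4 * B (v.2 - v.1) (v.2 + v.1)
        + potential n₀ s (‖ξ‖ ^ 2) v.1 * W (v.2 - v.1) (v.2 + v.1)))] at this
  · rw [this]
    refine setIntegral_congr_fun measurableSet_Ioi fun t ht => ?_
    have hs0 := hs.pos 0
    have hrt : √(ρ / n₀ 0) = 1 / s 0 := by
      rw [hs.eq 0 le_rfl, admittance, ← Real.sqrt_one, ← Real.sqrt_div (by norm_num), one_div_div]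
    rw [hs.sq hρ hpos le_rfl, hrt]
    by_cases htZ : t ≤ Z
    · rw [e5 t (by rwa [abs_of_pos (mem_Ioi.1 ht)]) (hdiag t)]
      field_simp
    · have h0 : ∀ y, W (t - y) (t + y) = 0 := fun y => by
        rcases le_total y 0 with h | h
        · exact hx _ _ (by linarith)
        · exact hz _ _ (by linarith)
      obtain ⟨-, -, Wy, -, -, -, h3, -, h4, -⟩ := hW.wave
      have h5 := h3 0 t
      simp only [h0] at h5
      have h6 := h5.unique (hasDerivAt_const 0 0)
      rw [h4] at h6
      simp only [sub_zero, add_zero] at h6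
      rw [e6 t h0, h6, mul_zero]
  · intro y t hy ht
    simp only
    rw [e2 ξ y t hy ht]
    ring
  · intro y t hy ht
    simp only
    rw [hU.initial y t hy ht, zero_mul]

/-- The equation of the space-causal Green's function in canonical form. -/
lemma IsSpaceCausalGreen.canonical (hρ : 0 < ρ) (hpos : ∀ y, 0 ≤ y → 0 < n₀ y)
    (hs : IsAmplitude ρ n₀ s) {ξ : Plane} {η : ℝ} (hη : 0 ≤ η) {g : ℝ → ℝ → ℝ}
    (hg : IsSpaceCausalGreen ρ n₀ ξ η g)
    (hW : HasCharDerivs W P Q B) {Z : ℝ}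
    (hx : ∀ x z, x ≤ -Z → W x z = 0) (hz : ∀ x z, Z ≤ z → W x z = 0) :
    ∫ v in Ioi (0 : ℝ) ×ˢ (univ : Set ℝ), s v.1 * g v.1 v.2 * (4 * B (v.2 - v.1) (v.2 + v.1)
        + potential n₀ s (‖ξ‖ ^ 2) v.1 * W (v.2 - v.1) (v.2 + v.1))
      = s η * W (-η) η := by
  have hZW : ∀ y t, 0 ≤ y → t ∈ (univ : Set ℝ) → Z ≤ max y |t| → W (t - y) (t + y) = 0 := by
    intro y t hy _ hZ
    rcases le_max_iff.1 hZ with h | h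
    · rcases le_total t 0 with h0 | h0
      · exact hx _ _ (by linarith)
      · exact hz _ _ (by linarith)
    · rcases le_abs'.1 h with h' | h'
      · exact hx _ _ (by linarith)
      · exact hz _ _ (by linarith)
  obtain ⟨w, hw, e1, e2, -⟩ := exists_isTest hρ hpos hs hW isOpen_univ Z hZW
  have := hg.weak w hw
  rw [e1 η 0 hη (mem_univ _), hs.sq hρ hpos hη, setIntegral_halfSpace_eq_open (f' := fun v =>
    s v.1 * g v.1 v.2 * (4 * B (v.2 - v.1) (v.2 + v.1)
        + potential n₀ s (‖ξ‖ ^ 2) v.1 * W (v.2 - v.1) (v.2 + v.1)))] at this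
  · rw [this, zero_sub, zero_add]
    have := (hs.pos η).ne'
    field_simp
  · intro y t hy
    simp only
    rw [e2 ξ y t hy (mem_univ _)]
    ring

/-- The first-order problem in canonical form, tested with a solution `W` of the homogeneous
equation. -/
lemma IsFirstOrderWave.canonical (hρ : 0 < ρ) (hpos : ∀ y, 0 ≤ y → 0 < n₀ y)
    (hs : IsAmplitude ρ n₀ s) {nbar : ℝ → Plane} {U₀ : ℝ → ℝ → Plane → ℝ} {ξ : Plane}
    {U : ℝ → ℝ → ℝ} {r : ℝ → ℝ} (hU : IsFirstOrderWave ρ n₀ nbar U₀ ξ U r)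
    (hU₀ : ∀ ζ y t, 0 < y → t ≤ 0 → U₀ y t ζ = 0)
    (hW : HasCharDerivs W P Q B) {Z : ℝ} (hz : ∀ x z, Z ≤ z → W x z = 0)
    (hom : ∀ y t, 0 < y → 0 < t → 4 * B (t - y) (t + y)
        + potential n₀ s (‖ξ‖ ^ 2) y * W (t - y) (t + y) = 0)
    {Wt Wtt : ℝ → ℝ → ℝ} (h1 : ∀ y t, HasDerivAt (fun t => W (t - y) (t + y)) (Wt y t) t)
    (h2 : ∀ y t, HasDerivAt (fun t => Wt y t) (Wtt y t) t) :
    ∫ v in Ioi (0 : ℝ) ×ˢ Ioi (0 : ℝ), s v.1 * (inner ℝ (nbar v.1)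
        (gradient (fun ζ => U₀ v.1 v.2 ζ) ξ) / n₀ v.1 ^ 2) * Wtt v.1 v.2
      = ∫ t in Ioi (0 : ℝ), s 0 * (r t / n₀ 0) * W t t := by
  obtain ⟨w, hw, e1, e2, e3, -⟩ := exists_isTest hρ hpos hs hW isOpen_Ioi Z
    (fun y t hy ht hZ => by
      refine hz _ _ ?_
      rw [abs_of_pos (mem_Ioi.1 ht)] at hZ
      rcases le_max_iff.1 hZ with h | h <;> linarith [mem_Ioi.1 ht])
  have := hU.weak w hw
  rw [setIntegral_halfSpace_eq_quarter (f' := fun _ => 0)] at this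
  · rw [setIntegral_halfSpace_eq_quarter (f' := fun v => s v.1 * (inner ℝ (nbar v.1)
        (gradient (fun ζ => U₀ v.1 v.2 ζ) ξ) / n₀ v.1 ^ 2) * Wtt v.1 v.2)] at this
    · rw [integral_zero, eq_comm, sub_eq_zero] at this
      rw [this]
      refine setIntegral_congr_fun measurableSet_Ioi fun t ht => ?_
      rw [e1 0 t le_rfl ht, hs.sq hρ hpos le_rfl, sub_zero, add_zero]
      have := (hs.pos 0).ne'
      field_simp
    · intro y t hy ht
      simp only
      rw [e3 y t hy ht Wt Wtt h1 h2, hs.sq hρ hpos hy.le]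
      have := (hs.pos y).ne'
      field_simp
    · intro y t hy ht
      have : (fun ζ => U₀ y t ζ) = fun _ => 0 := funext fun ζ => hU₀ ζ y t hy ht
      simp only [this]
      rw [gradient_fun_const]
      simp
  · intro y t hy ht
    simp only
    rw [e2 ξ y t hy ht, hom y t hy ht, mul_zero, mul_zero]
  · intro y t hy ht
    simp only
    rw [hU.initial y t hy ht, zero_mul]

end Canonical

/-! ### Duality on rectangles -/

lemma integral_triangle_swap {F : ℝ → ℝ → ℝ} {a b : ℝ} (hab : a ≤ b)
    (hF : IntegrableOn (fun v : ℝ × ℝ => F v.1 v.2) (Ioc a b ×ˢ Ioc a b)) :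
    ∫ x in a..b, ∫ y in a..x, F x y = ∫ y in a..b, ∫ x in y..b, F x y := by
  have hm : MeasurableSet {v : ℝ × ℝ | v.2 ≤ v.1} := measurableSet_le measurable_snd measurable_fst
  have hint : Integrable (Function.uncurry fun x y => {v : ℝ × ℝ | v.2 ≤ v.1}.indicator
      (fun v : ℝ × ℝ => F v.1 v.2) (x, y))
      ((volume.restrict (Ioc a b)).prod (volume.restrict (Ioc a b))) := by
    rw [Measure.prod_restrict]
    exact Integrable.indicator hF hm
  have := integral_integral_swap hint
  simp only [indicator] at this
  rw [intervalIntegral.integral_of_le hab, intervalIntegral.integral_of_le hab]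
  refine Eq.trans (setIntegral_congr_fun measurableSet_Ioc fun x hx => ?_)
    (this.trans (setIntegral_congr_fun measurableSet_Ioc fun y hy => ?_))
  · simp only [mem_ofPred_eq]
    rw [intervalIntegral.integral_of_le hx.1.le, ← integral_indicator measurableSet_Ioc,
      ← integral_indicator measurableSet_Ioc]
    congr 1
    funext y
    simp only [indicator, mem_Ioc]
    split_ifs with h1 h2 h3 h4 <;> grind
  · simp only [mem_ofPred_eq]
    rw [intervalIntegral.integral_of_le hy.2, ← integral_indicator measurableSet_Ioc,
      ← integral_Icc_eq_integral_Ioc, ← integral_indicator measurableSet_Icc]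
    congr 1
    funext x
    simp only [indicator, mem_Ioc, mem_Icc]
    split_ifs with h1 h2 h3 h4 <;> grind

lemma integral_triangle_swap_of_continuous {F : ℝ → ℝ → ℝ} {a b : ℝ} (hab : a ≤ b)
    (hF : Continuous fun v : ℝ × ℝ => F v.1 v.2) :
    ∫ x in a..b, ∫ y in a..x, F x y = ∫ y in a..b, ∫ x in y..b, F x y :=
  integral_triangle_swap hab <| (hF.continuousOn.integrableOn_compact
    (isCompact_Icc.prod isCompact_Icc)).mono_set (Set.prod_mono Ioc_subset_Icc_self
      Ioc_subset_Icc_self)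

/-- The adjoint of `f ↦ ∫ₐˣ f` is `h ↦ ∫ₓᵇ h`. -/
lemma integral_primitive_mul {f h : ℝ → ℝ} {a b : ℝ} (hab : a ≤ b)
    (hf : IntervalIntegrable f volume a b) (hh : Continuous h) :
    ∫ x in a..b, (∫ y in a..x, f y) * h x = ∫ y in a..b, f y * ∫ x in y..b, h x := by
  have hint : IntegrableOn (fun v : ℝ × ℝ => f v.2 * h v.1) (Ioc a b ×ˢ Ioc a b) := by
    have h1 : Integrable h (volume.restrict (Ioc a b)) :=
      (intervalIntegrable_iff_integrableOn_Ioc_of_le hab).1 (hh.intervalIntegrable _ _)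
    have h2 : Integrable f (volume.restrict (Ioc a b)) :=
      (intervalIntegrable_iff_integrableOn_Ioc_of_le hab).1 hf
    have := h1.mul_prod h2
    rw [Measure.prod_restrict] at this
    simpa only [mul_comm] using! this
  have := integral_triangle_swap (F := fun x y => f y * h x) hab hint
  simpa only [intervalIntegral.integral_mul_const, intervalIntegral.integral_const_mul] using this

/-- The adjoint of integration over the rectangles below a point is integration over the rectangles
above it. The function `F` need not be continuous. -/
lemma integral_double_primitive_mul {F h : ℝ → ℝ → ℝ} {a b c d : ℝ} (hab : a ≤ b) (hcd : c ≤ d)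
    (hF1 : Continuous fun v : ℝ × ℝ => ∫ z in c..v.2, F v.1 z)
    (hF : ∀ x, IntervalIntegrable (F x) volume c d)
    (hh : Continuous fun v : ℝ × ℝ => h v.1 v.2) :
    ∫ x in a..b, ∫ z in c..d, (∫ x' in a..x, ∫ z' in c..z, F x' z') * h x z
      = ∫ x in a..b, ∫ z in c..d, F x z * ∫ x' in x..b, ∫ z' in z..d, h x' z' := by
  have hc1 : Continuous fun v : ℝ × ℝ => ∫ x' in a..v.1, ∫ z' in c..v.2, F x' z' := by
    refine intervalIntegral.continuous_parametric_intervalIntegral_of_continuous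
      (f := fun (v : ℝ × ℝ) x' => ∫ z' in c..v.2, F x' z') ?_ (by fun_prop)
    exact hF1.comp (f := fun u : (ℝ × ℝ) × ℝ => (u.2, u.1.2)) (by fun_prop)
  have hc2 : Continuous fun v : ℝ × ℝ => ∫ x' in v.1..b, h x' v.2 := by
    have e : (fun v : ℝ × ℝ => ∫ x' in v.1..b, h x' v.2)
        = fun v : ℝ × ℝ => -∫ x' in b..v.1, h x' v.2 :=
      funext fun v => intervalIntegral.integral_symm _ _
    rw [e]
    refine (intervalIntegral.continuous_parametric_intervalIntegral_of_continuous
      (f := fun (v : ℝ × ℝ) x' => h x' v.2) ?_ (by fun_prop)).neg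
    exact hh.comp (f := fun u : (ℝ × ℝ) × ℝ => (u.2, u.1.2)) (by fun_prop)
  rw [integral_swap_of_continuous (hc1.mul hh)]
  have s1 : ∀ z, ∫ x in a..b, (∫ x' in a..x, ∫ z' in c..z, F x' z') * h x z
      = ∫ x in a..b, (∫ z' in c..z, F x z') * ∫ x' in x..b, h x' z := fun z =>
    integral_primitive_mul hab
      ((hF1.comp (f := fun x => (x, z)) (by fun_prop)).intervalIntegrable _ _)
      (hh.comp (f := fun x => (x, z)) (by fun_prop))
  simp_rw [s1]
  rw [← integral_swap_of_continuous (F := fun x z => (∫ z' in c..z, F x z') * ∫ x' in x..b, h x' z)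
    (hF1.mul hc2)]
  refine intervalIntegral.integral_congr fun x _ => ?_
  refine (integral_primitive_mul hcd (hF x) (h := fun z => ∫ x' in x..b, h x' z)
    (hc2.comp (f := fun z => (x, z)) (by fun_prop))).trans ?_
  refine intervalIntegral.integral_congr fun z _ => ?_
  rw [integral_swap_of_continuous hh]

lemma integral_double_primitive_mul_of_continuous {F h : ℝ → ℝ → ℝ} {a b c d : ℝ} (hab : a ≤ b)
    (hcd : c ≤ d) (hF : Continuous fun v : ℝ × ℝ => F v.1 v.2)
    (hh : Continuous fun v : ℝ × ℝ => h v.1 v.2) :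
    ∫ x in a..b, ∫ z in c..d, (∫ x' in a..x, ∫ z' in c..z, F x' z') * h x z
      = ∫ x in a..b, ∫ z in c..d, F x z * ∫ x' in x..b, ∫ z' in z..d, h x' z' := by
  refine integral_double_primitive_mul hab hcd ?_ (fun x => ?_) hh
  · exact (hasPartials_double_primitive hF a c).cont_fst
  · exact (hF.comp (f := fun z => (x, z)) (by fun_prop)).intervalIntegrable _ _

lemma continuous_slice_fst {F : ℝ → ℝ → ℝ} (hF : Continuous fun v : ℝ × ℝ => F v.1 v.2) (x : ℝ) :
    Continuous fun z => F x z := hF.comp (f := fun z => (x, z)) (by fun_prop)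

lemma continuous_slice_integral {F : ℝ → ℝ → ℝ} (hF : Continuous fun v : ℝ × ℝ => F v.1 v.2)
    (c d : ℝ) : Continuous fun x => ∫ z in c..d, F x z :=
  intervalIntegral.continuous_parametric_intervalIntegral_of_continuous' hF c d

lemma integral_integral_sub {F G : ℝ → ℝ → ℝ} (hF : Continuous fun v : ℝ × ℝ => F v.1 v.2)
    (hG : Continuous fun v : ℝ × ℝ => G v.1 v.2) (a b c d : ℝ) :
    ∫ x in a..b, ∫ z in c..d, (F x z - G x z)
      = (∫ x in a..b, ∫ z in c..d, F x z) - ∫ x in a..b, ∫ z in c..d, G x z := by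
  rw [← intervalIntegral.integral_sub ((continuous_slice_integral hF c d).intervalIntegrable _ _)
    ((continuous_slice_integral hG c d).intervalIntegrable _ _)]
  refine intervalIntegral.integral_congr fun x _ => ?_
  exact intervalIntegral.integral_sub ((continuous_slice_fst hF x).intervalIntegrable _ _)
    ((continuous_slice_fst hG x).intervalIntegrable _ _)

/-- The solution of a Volterra equation posed from the top corner `(a, b)` of a rectangle, evaluated
at the bottom corner, in terms of the Riemann function `R` with that bottom corner. -/
theorem volterra_resolvent {κ R w g : ℝ → ℝ → ℝ} {a b : ℝ} (ha : 0 ≤ a) (hb : 0 ≤ b)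
    (hκ : Continuous fun v : ℝ × ℝ => κ v.1 v.2) (hR : Continuous fun v : ℝ × ℝ => R v.1 v.2)
    (hw : Continuous fun v : ℝ × ℝ => w v.1 v.2) (hg : Continuous fun v : ℝ × ℝ => g v.1 v.2)
    (eR : ∀ p m, R p m = 1 + ∫ p' in (0 : ℝ)..p, ∫ m' in (0 : ℝ)..m, κ p' m' * R p' m')
    (ew : ∀ p m, w p m = g p m + ∫ p' in p..a, ∫ m' in m..b, κ p' m' * w p' m') :
    w 0 0 = g 0 0 + ∫ p in (0 : ℝ)..a, ∫ m in (0 : ℝ)..b, κ p m * R p m * g p m := by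
  have hκR := hκ.mul hR
  have hκw := hκ.mul hw
  have dual := integral_double_primitive_mul_of_continuous (F := fun p m => κ p m * R p m)
    (h := fun p m => κ p m * w p m) ha hb hκR hκw
  have e1 : ∀ p m, (∫ p' in (0 : ℝ)..p, ∫ m' in (0 : ℝ)..m, κ p' m' * R p' m') * (κ p m * w p m)
      = κ p m * R p m * w p m - κ p m * w p m := by
    intro p m
    have := eR p m
    rw [← sub_eq_iff_eq_add'] at this
    rw [← this]
    ring
  have e2 : ∀ p m, κ p m * R p m * ∫ p' in p..a, ∫ m' in m..b, κ p' m' * w p' m'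
      = κ p m * R p m * w p m - κ p m * R p m * g p m := by
    intro p m
    have := ew p m
    rw [← sub_eq_iff_eq_add'] at this
    rw [← this]
    ring
  simp only [e1, e2] at dual
  rw [integral_integral_sub (F := fun p m => κ p m * R p m * w p m)
    (G := fun p m => κ p m * w p m) (hκR.mul hw) hκw,
    integral_integral_sub (F := fun p m => κ p m * R p m * w p m)
    (G := fun p m => κ p m * R p m * g p m) (hκR.mul hw) (hκR.mul hg)] at dual
  rw [ew 0 0]
  linarith

/-! ### Localization -/

/-- Integration in characteristic variables. -/
lemma integral_char_coords {F : ℝ × ℝ → ℝ} (hF : Continuous F) (hc : HasCompactSupport F) :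
    ∫ v, F v = 1 / 2 * ∫ x, ∫ z, F ((z - x) / 2, (z + x) / 2) := by
  have hint := hF.integrable_of_hasCompactSupport (μ := volume) hc
  rw [Measure.volume_eq_prod, integral_prod _ (by rwa [← Measure.volume_eq_prod])]
  have s1 : ∀ y, ∫ t, F (y, t) = ∫ x, F (y, x + y) := fun y =>
    (integral_add_right_eq_self (fun t => F (y, t)) y).symm
  simp_rw [s1]
  have hcont : Continuous (Function.uncurry fun y x : ℝ => F (y, x + y)) :=
    hF.comp (f := fun v : ℝ × ℝ => (v.1, v.2 + v.1)) (by fun_prop)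
  have hcs : HasCompactSupport (Function.uncurry fun y x : ℝ => F (y, x + y)) := by
    let e : (ℝ × ℝ) ≃ₜ (ℝ × ℝ) :=
      { toFun := fun v => (v.1, v.2 + v.1), invFun := fun v => (v.1, v.2 - v.1)
        left_inv := fun v => by simp
        right_inv := fun v => by simp
        continuous_toFun := by fun_prop
        continuous_invFun := by fun_prop }
    exact hc.comp_homeomorph e
  rw [integral_integral_swap_of_hasCompactSupport hcont hcs, ← integral_const_mul]
  congr 1
  funext x
  have := Measure.integral_comp_mul_left (fun y => F (y, x + y)) (1 / 2 : ℝ)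
  have h2 := integral_sub_right_eq_self (fun z => F ((1 / 2 : ℝ) * z, x + (1 / 2 : ℝ) * z)) x
    (μ := volume)
  rw [this] at h2
  norm_num at h2
  rw [show ∫ z, F ((z - x) / 2, (z + x) / 2)
    = ∫ z, F (1 / 2 * (z - x), x + 1 / 2 * (z - x)) by congr 1; funext z; congr 2 <;> ring]
  norm_num
  rw [h2]
  ring

lemma bump_mul_continuous {F : ℝ × ℝ → ℝ} {x₀ z₀ ε δ : ℝ} (hδ : δ < ε)
    (hF : ContinuousOn F {v | |v.2 - v.1 - x₀| < ε ∧ |v.2 + v.1 - z₀| < ε}) {a b : ℝ → ℝ}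
    (ha : Continuous a) (hb : Continuous b) (ha0 : ∀ x, δ ≤ |x - x₀| → a x = 0)
    (hb0 : ∀ z, δ ≤ |z - z₀| → b z = 0) :
    Continuous (fun v => F v * (a (v.2 - v.1) * b (v.2 + v.1))) ∧
      HasCompactSupport (fun v => F v * (a (v.2 - v.1) * b (v.2 + v.1))) := by
  set K : Set (ℝ × ℝ) := {v | |v.2 - v.1 - x₀| ≤ δ ∧ |v.2 + v.1 - z₀| ≤ δ} with hK
  have hKc : IsClosed K :=
    (isClosed_le (by fun_prop) continuous_const).and (isClosed_le (by fun_prop) continuous_const)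
  have hKb : K ⊆ Metric.closedBall 0 (|x₀| + |z₀| + δ) := by
    rintro ⟨y, t⟩ ⟨h1, h2⟩
    simp only at h1 h2
    rw [mem_closedBall_zero_iff, Prod.norm_mk, Real.norm_eq_abs, Real.norm_eq_abs]
    rw [abs_le] at h1 h2
    have hx := abs_le.1 (le_refl |x₀|)
    have hz := abs_le.1 (le_refl |z₀|)
    refine max_le (abs_le.2 ⟨?_, ?_⟩) (abs_le.2 ⟨?_, ?_⟩) <;> linarith
  have hKcomp : IsCompact K := (isCompact_closedBall _ _).of_isClosed_subset hKc hKb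
  have hzero : ∀ v, v ∉ K → F v * (a (v.2 - v.1) * b (v.2 + v.1)) = 0 := by
    intro v hv
    by_cases h1 : |v.2 - v.1 - x₀| ≤ δ
    · have h2 : ¬ |v.2 + v.1 - z₀| ≤ δ := fun h => hv ⟨h1, h⟩
      rw [hb0 _ (not_le.1 h2).le, mul_zero, mul_zero]
    · rw [ha0 _ (not_le.1 h1).le, zero_mul, mul_zero]
  have htsupp : tsupport (fun v => F v * (a (v.2 - v.1) * b (v.2 + v.1))) ⊆ K :=
    closure_minimal (fun v hv => by_contra fun h => hv (hzero v h)) hKc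
  refine ⟨continuous_of_tsupport fun v hv => ?_, HasCompactSupport.intro hKcomp hzero⟩
  have hvK := htsupp hv
  have hopen : IsOpen {v : ℝ × ℝ | |v.2 - v.1 - x₀| < ε ∧ |v.2 + v.1 - z₀| < ε} :=
    (isOpen_lt (by fun_prop) continuous_const).and (isOpen_lt (by fun_prop) continuous_const)
  have hFv : ContinuousAt F v := hF.continuousAt
    (hopen.mem_nhds ⟨hvK.1.trans_lt hδ, hvK.2.trans_lt hδ⟩)
  exact hFv.mul (Continuous.continuousAt (by fun_prop))

/-- Two functions, continuous near a point, agree at that point if their integrals against products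
of bumps in the characteristic variables agree. -/
theorem eq_of_integral_bump_eq {F₁ F₂ : ℝ × ℝ → ℝ} {x₀ z₀ ε : ℝ} (hε : 0 < ε)
    (h₁ : ContinuousOn F₁ {v | |v.2 - v.1 - x₀| < ε ∧ |v.2 + v.1 - z₀| < ε})
    (h₂ : ContinuousOn F₂ {v | |v.2 - v.1 - x₀| < ε ∧ |v.2 + v.1 - z₀| < ε})
    (h : ∀ a b : ℝ → ℝ, ContDiff ℝ 1 a → ContDiff ℝ 1 b → (∀ x, ε / 2 ≤ |x - x₀| → a x = 0) →
      (∀ z, ε / 2 ≤ |z - z₀| → b z = 0) →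
      ∫ v, F₁ v * (a (v.2 - v.1) * b (v.2 + v.1)) = ∫ v, F₂ v * (a (v.2 - v.1) * b (v.2 + v.1))) :
    F₁ ((z₀ - x₀) / 2, (z₀ + x₀) / 2) = F₂ ((z₀ - x₀) / 2, (z₀ + x₀) / 2) := by
  set v₀ : ℝ × ℝ := ((z₀ - x₀) / 2, (z₀ + x₀) / 2) with hv₀
  have hv1 : v₀.2 - v₀.1 = x₀ := by simp only [hv₀]; ring
  have hv2 : v₀.2 + v₀.1 = z₀ := by simp only [hv₀]; ring
  set O : Set (ℝ × ℝ) := {v | |v.2 - v.1 - x₀| < ε ∧ |v.2 + v.1 - z₀| < ε} with hO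
  have hopen : IsOpen O :=
    (isOpen_lt (by fun_prop) continuous_const).and (isOpen_lt (by fun_prop) continuous_const)
  have hv₀O : v₀ ∈ O := by
    simp only [hO, mem_ofPred_eq, hv1, hv2, sub_self, abs_zero]
    exact ⟨hε, hε⟩
  set D₀ := F₁ v₀ - F₂ v₀ with hD₀
  by_contra hne
  have hD₀ne : D₀ ≠ 0 := sub_ne_zero.2 hne
  have hcont : ContinuousOn (fun v => D₀ * (F₁ v - F₂ v)) O :=
    continuousOn_const.mul (h₁.sub h₂)
  have hpos : ∀ᶠ v in nhds v₀, 0 < D₀ * (F₁ v - F₂ v) :=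
    (hcont.continuousAt (hopen.mem_nhds hv₀O)).eventually (lt_mem_nhds (mul_self_pos.2 hD₀ne))
  obtain ⟨r, hr, hball⟩ := Metric.eventually_nhds_iff_ball.1 hpos
  set δ := min (ε / 2) (r / 2) with hδ
  have hδ0 : 0 < δ := by positivity
  let a : ContDiffBump x₀ := ⟨δ / 2, δ, by positivity, by linarith⟩
  let b : ContDiffBump z₀ := ⟨δ / 2, δ, by positivity, by linarith⟩
  have ha0 : ∀ x, δ ≤ |x - x₀| → a x = 0 := fun x hx => a.zero_of_le_dist hx
  have hb0 : ∀ x, δ ≤ |x - z₀| → b x = 0 := fun x hx => b.zero_of_le_dist hx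
  have hδε : δ < ε := lt_of_le_of_lt (min_le_left _ _) (by linarith)
  have c1 := bump_mul_continuous hδε h₁ a.continuous b.continuous ha0 hb0
  have c2 := bump_mul_continuous hδε h₂ a.continuous b.continuous ha0 hb0
  have c := bump_mul_continuous hδε hcont a.continuous b.continuous ha0 hb0
  have hzero := h a b a.contDiff b.contDiff
    (fun x hx => ha0 x ((min_le_left _ _).trans hx))
    (fun x hx => hb0 x ((min_le_left _ _).trans hx))
  have hgt := c.1.integral_pos_of_hasCompactSupport_nonneg_nonzero (μ := volume) c.2 (x := v₀)
    (fun v => ?_) ?_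
  · have e : ∫ v, D₀ * (F₁ v - F₂ v) * (a (v.2 - v.1) * b (v.2 + v.1))
        = D₀ * ((∫ v, F₁ v * (a (v.2 - v.1) * b (v.2 + v.1)))
          - ∫ v, F₂ v * (a (v.2 - v.1) * b (v.2 + v.1))) := by
      rw [← integral_sub (c1.1.integrable_of_hasCompactSupport c1.2)
        (c2.1.integrable_of_hasCompactSupport c2.2), ← integral_const_mul]
      congr 1
      funext v
      ring
    rw [e, hzero, sub_self, mul_zero] at hgt
    exact lt_irrefl _ hgt
  · simp only [Pi.zero_apply]
    by_cases h1 : δ ≤ |v.2 - v.1 - x₀|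
    · rw [ha0 _ h1]; simp
    by_cases h2 : δ ≤ |v.2 + v.1 - z₀|
    · rw [hb0 _ h2]; simp
    refine mul_nonneg (hball v ?_).le (mul_nonneg a.nonneg b.nonneg)
    have hδr : δ ≤ r / 2 := min_le_right _ _
    rw [not_le, abs_lt] at h1 h2
    rw [mem_ball_iff_norm, Prod.norm_def, Real.norm_eq_abs, Real.norm_eq_abs]
    refine max_lt (abs_lt.2 ⟨?_, ?_⟩) (abs_lt.2 ⟨?_, ?_⟩) <;>
      simp only [Prod.fst_sub, Prod.snd_sub] <;> linarith [h1.1, h1.2, h2.1, h2.2]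
  · rw [hv1, hv2, a.one_of_mem_closedBall (Metric.mem_closedBall_self (by positivity)),
      b.one_of_mem_closedBall (Metric.mem_closedBall_self (by positivity)), one_mul, mul_one]
    exact mul_ne_zero hD₀ne hD₀ne

/-! ### The Riemann function and the space-causal Green's function -/

/-- `R η p m` is the Riemann function of `∂ₜ² - ∂ᵧ² + q` with vertex `(η, 0)`, at the point
`y = η + p + m`, `t = p - m`; it equals `1` on both characteristics through the vertex. -/
structure IsRiemann (q : ℝ → ℝ) (R : ℝ → ℝ → ℝ → ℝ) : Prop where
  cont : Continuous fun v : ℝ × ℝ × ℝ => R v.1 v.2.1 v.2.2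
  eq : ∀ η p m, R η p m = 1 + ∫ p' in (0 : ℝ)..p, ∫ m' in (0 : ℝ)..m, q (η + p' + m') * R η p' m'

lemma exists_isRiemann {q : ℝ → ℝ} (hq : Continuous q) : ∃ R, IsRiemann q R := by
  obtain ⟨R, h1, h2⟩ := volterra_exists (fun η p m => q (η + p + m)) (fun _ _ _ => 1) 0 0
    (by fun_prop) continuous_const
  exact ⟨R, h1, h2⟩

/-- The derivative `∂R/∂p` of the Riemann function, in the form given by its integral equation. -/
noncomputable def riemannDeriv (q : ℝ → ℝ) (R : ℝ → ℝ → ℝ → ℝ) (η p m : ℝ) : ℝ :=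
  ∫ m' in (0 : ℝ)..m, q (η + p + m') * R η p m'

namespace IsRiemann

variable {q : ℝ → ℝ} {R : ℝ → ℝ → ℝ → ℝ}

lemma cont_slice (hR : IsRiemann q R) (η : ℝ) : Continuous fun v : ℝ × ℝ => R η v.1 v.2 :=
  hR.cont.comp (f := fun v : ℝ × ℝ => (η, v.1, v.2)) (by fun_prop)

lemma hasPartials (hq : Continuous q) (hR : IsRiemann q R) (η : ℝ) :
    ∃ Rm, HasPartials (R η) (riemannDeriv q R η) Rm := by
  have h := hasPartials_double_primitive (F := fun p m => q (η + p + m) * R η p m)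
    ((hq.comp (by fun_prop)).mul (hR.cont_slice η)) 0 0
  refine ⟨fun p m => ∫ p' in (0 : ℝ)..p, q (η + p' + m) * R η p' m, ?_⟩
  refine ⟨fun p m => ?_, fun p m => ?_, h.cont_fst, h.cont_snd⟩
  · exact ((h.fst p m).const_add 1).congr_of_eventuallyEq
      (Filter.Eventually.of_forall fun p => hR.eq η p m)
  · exact ((h.snd p m).const_add 1).congr_of_eventuallyEq
      (Filter.Eventually.of_forall fun m => hR.eq η p m)

lemma continuous_deriv (hq : Continuous q) (hR : IsRiemann q R) :
    Continuous fun v : ℝ × ℝ × ℝ => riemannDeriv q R v.1 v.2.1 v.2.2 := by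
  refine intervalIntegral.continuous_parametric_intervalIntegral_of_continuous
    (f := fun (v : ℝ × ℝ × ℝ) m' => q (v.1 + v.2.1 + m') * R v.1 v.2.1 m') ?_ (by fun_prop)
  exact (hq.comp (by fun_prop)).mul
    (hR.cont.comp (f := fun u : (ℝ × ℝ × ℝ) × ℝ => (u.1.1, u.1.2.1, u.2)) (by fun_prop))

lemma zero_left (hR : IsRiemann q R) (η m : ℝ) : R η 0 m = 1 := by
  rw [hR.eq]; simp

end IsRiemann

lemma integral_affine_add (f : ℝ → ℝ) (c u v : ℝ) :
    ∫ z in (c + 2 * u)..(c + 2 * v), f z = 2 * ∫ p in u..v, f (c + 2 * p) := by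
  have := intervalIntegral.integral_comp_add_mul (a := u) (b := v) f (two_ne_zero (α := ℝ)) c
  rw [this, smul_eq_mul]
  ring

lemma integral_affine_sub (f : ℝ → ℝ) (c u v : ℝ) :
    ∫ z in (c - 2 * v)..(c - 2 * u), f z = 2 * ∫ p in u..v, f (c - 2 * p) := by
  have := intervalIntegral.integral_comp_sub_mul (a := u) (b := v) f (two_ne_zero (α := ℝ)) c
  rw [this, smul_eq_mul]
  ring

lemma hasDerivAt_primitive {a : ℝ → ℝ} (ha : Continuous a) (c x : ℝ) :
    HasDerivAt (fun x => ∫ t in c..x, a t) (a x) x :=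
  intervalIntegral.integral_hasDerivAt_right (ha.intervalIntegrable _ _)
    ha.stronglyMeasurable.stronglyMeasurableAtFilter ha.continuousAt

lemma hasPartials_mul {a b a' b' : ℝ → ℝ} (ha : ∀ x, HasDerivAt a (a' x) x)
    (hb : ∀ x, HasDerivAt b (b' x) x) (ca : Continuous a') (cb : Continuous b') :
    HasPartials (fun x z => a x * b z) (fun x z => a' x * b z) (fun x z => a x * b' z) := by
  have h1 : Continuous a := continuous_iff_continuousAt.2 fun x => (ha x).continuousAt
  have h2 : Continuous b := continuous_iff_continuousAt.2 fun x => (hb x).continuousAt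
  exact ⟨fun x z => (ha x).mul_const _, fun x z => (hb z).const_mul _, by fun_prop, by fun_prop⟩

/-- Data of Goursat problems of the form `(∫ a)(∫ b)`. -/
lemma hasCharDerivs_primitive_mul {a b : ℝ → ℝ} (ha : ContDiff ℝ 1 a) (hb : ContDiff ℝ 1 b)
    (c d : ℝ) : HasCharDerivs (fun x z => (∫ t in c..x, a t) * ∫ t in d..z, b t)
      (fun x z => a x * ∫ t in d..z, b t) (fun x z => (∫ t in c..x, a t) * b z)
      (fun x z => a x * b z) := by
  have da : ∀ x, HasDerivAt a (deriv a x) x := fun x =>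
    (ha.differentiable (by norm_num) x).hasDerivAt
  have db : ∀ x, HasDerivAt b (deriv b x) x := fun x =>
    (hb.differentiable (by norm_num) x).hasDerivAt
  have pa := hasDerivAt_primitive ha.continuous c
  have pb := hasDerivAt_primitive hb.continuous d
  exact ⟨hasPartials_mul pa pb ha.continuous hb.continuous,
    ⟨_, hasPartials_mul da pb (ha.continuous_deriv le_rfl) hb.continuous⟩,
    ⟨_, hasPartials_mul pa db ha.continuous (hb.continuous_deriv le_rfl)⟩⟩

lemma HasCharDerivs.const_mul {W P Q B : ℝ → ℝ → ℝ} (h : HasCharDerivs W P Q B) (c : ℝ) :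
    HasCharDerivs (fun x z => c * W x z) (fun x z => c * P x z) (fun x z => c * Q x z)
      (fun x z => c * B x z) := by
  obtain ⟨Px, hP⟩ := h.second_fst
  obtain ⟨Qz, hQ⟩ := h.second_snd
  exact ⟨h.first.const_mul c, ⟨_, hP.const_mul c⟩, ⟨_, hQ.const_mul c⟩⟩

/-- Solutions of `4 Wₓ_z + q W = 4 gₓ_z` with data `g`, posed from the corner `(x₀, z₀)`; `W`
vanishes wherever the data do so beyond the corner. -/
theorem exists_goursat {q : ℝ → ℝ} (hq : Continuous q) {g gx gz gxz : ℝ → ℝ → ℝ}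
    (hg : HasCharDerivs g gx gz gxz) (x₀ z₀ : ℝ) :
    ∃ W P Q B, HasCharDerivs W P Q B ∧
      (∀ x z, 4 * B x z + q ((z - x) / 2) * W x z = 4 * gxz x z) ∧
      (∀ x z, W x z = g x z
        + ∫ x' in x₀..x, ∫ z' in z₀..z, -(1 / 4) * q ((z' - x') / 2) * W x' z') ∧
      ((∀ x z, x ≤ x₀ → g x z = 0) → ∀ x z, x ≤ x₀ → W x z = 0) ∧
      ((∀ x z, x₀ ≤ x → g x z = 0) → ∀ x z, x₀ ≤ x → W x z = 0) ∧
      ((∀ x z, z₀ ≤ z → g x z = 0) → ∀ x z, z₀ ≤ z → W x z = 0) := by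
  have hκ : Continuous fun v : ℝ × ℝ => -(1 / 4) * q ((v.2 - v.1) / 2) :=
    continuous_const.mul (hq.comp (by fun_prop))
  obtain ⟨f, hf, ef⟩ := volterra_exists (fun _ x z => -(1 / 4) * q ((z - x) / 2))
    (fun _ x z => g x z) x₀ z₀ (hκ.comp continuous_snd)
    (hg.first.continuous.comp continuous_snd)
  have hW : Continuous fun v : ℝ × ℝ => f 0 v.1 v.2 :=
    hf.comp (f := fun v : ℝ × ℝ => ((0 : ℝ), v.1, v.2)) (by fun_prop)
  have vanish : ∀ X Z, (∀ x ∈ uIcc x₀ X, ∀ z ∈ uIcc z₀ Z, g x z = 0) → f 0 X Z = 0 := by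
    intro X Z h
    refine volterra_unique (κ := fun x z => -(1 / 4) * q ((z - x) / 2)) (f := f 0) hκ hW
      (x₀ := x₀) (z₀ := z₀) (X := X) (Z := Z) (fun x hx z hz => ?_) X right_mem_uIcc Z
      right_mem_uIcc
    rw [ef, h x hx z hz, zero_add]
  refine ⟨f 0, _, _, _, goursat_regularity hq hg hW (-(1 / 4)) x₀ z₀ (fun x z => ef 0 x z), ?_,
    fun x z => ef 0 x z, ?_, ?_, ?_⟩
  · intro x z
    ring
  · intro h X Z hX
    refine vanish X Z fun x hx z _ => h x z ?_
    rw [uIcc_of_ge hX] at hx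
    exact hx.2
  · intro h X Z hX
    refine vanish X Z fun x hx z _ => h x z ?_
    rw [uIcc_of_le hX] at hx
    exact hx.1
  · intro h X Z hZ
    refine vanish X Z fun x _ z hz => h x z ?_
    rw [uIcc_of_le hZ] at hz
    exact hz.1

/-- If `F` vanishes outside an interval, its integral over the line is the integral over the
interval. -/
lemma integral_eq_intervalIntegral {f : ℝ → ℝ} {a b : ℝ} (ha : ∀ x, x ≤ a → f x = 0)
    (hb : ∀ x, b ≤ x → f x = 0) : ∫ x, f x = ∫ x in a..b, f x := by
  refine (intervalIntegral.integral_eq_integral_of_support_subset fun x hx => ?_).symm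
  refine ⟨lt_of_not_ge fun h => hx (ha x h), le_of_not_ge fun h => hx (hb x h)⟩

/-- Riemann's representation of the solution of `4 Wₓ_z + q W = a(x) b(z)` that vanishes for
`x ≤ -Z` and for `z ≥ Z`. -/
lemma goursat_source_eq {q : ℝ → ℝ} (hq : Continuous q) {R : ℝ → ℝ → ℝ → ℝ} (hR : IsRiemann q R)
    {a b : ℝ → ℝ} (ha : Continuous a) (hb : Continuous b) {η Z : ℝ} (hηZ : η ≤ Z)
    {W : ℝ → ℝ → ℝ} (hW : Continuous fun v : ℝ × ℝ => W v.1 v.2)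
    (eW : ∀ x z, W x z = 1 / 4 * ((∫ t in (-Z)..x, a t) * ∫ t in Z..z, b t)
        + ∫ x' in (-Z)..x, ∫ z' in Z..z, -(1 / 4) * q ((z' - x') / 2) * W x' z') :
    W (-η) η = -∫ p in (0 : ℝ)..((Z - η) / 2), ∫ m in (0 : ℝ)..((Z - η) / 2),
      R η p m * (a (-η - 2 * m) * b (η + 2 * p)) := by
  set L := (Z - η) / 2 with hL
  have hL0 : 0 ≤ L := by rw [hL]; linarith
  have eZ : Z = η + 2 * L := by rw [hL]; ring
  have eZ' : -Z = -η - 2 * L := by rw [hL]; ring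
  set H : ℝ → ℝ → ℝ := fun p m => a (-η - 2 * m) * b (η + 2 * p) with hH
  have hHc : Continuous fun v : ℝ × ℝ => H v.1 v.2 := by
    simp only [hH]; fun_prop
  set κ : ℝ → ℝ → ℝ := fun p m => q (η + p + m) with hκ
  have hκc : Continuous fun v : ℝ × ℝ => κ v.1 v.2 := by
    simp only [hκ]; fun_prop
  set w : ℝ → ℝ → ℝ := fun p m => W (-η - 2 * m) (η + 2 * p) with hw
  have hwc : Continuous fun v : ℝ × ℝ => w v.1 v.2 :=
    hW.comp (f := fun v : ℝ × ℝ => (-η - 2 * v.2, η + 2 * v.1)) (by fun_prop)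
  set g : ℝ → ℝ → ℝ := fun p m => -∫ p' in p..L, ∫ m' in m..L, H p' m' with hg
  have eg : ∀ p m, 1 / 4 * ((∫ t in (-Z)..(-η - 2 * m), a t) * ∫ t in Z..(η + 2 * p), b t)
      = g p m := by
    intro p m
    rw [eZ', eZ, integral_affine_sub, integral_affine_add, intervalIntegral.integral_symm p L]
    simp only [hg, hH, intervalIntegral.integral_mul_const, intervalIntegral.integral_const_mul]
    ring
  have hgc : Continuous fun v : ℝ × ℝ => g v.1 v.2 := by
    simp only [← eg]
    have h1 := continuous_iff_continuousAt.2
      fun x => (hasDerivAt_primitive ha (-Z) x).continuousAt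
    have h2 := continuous_iff_continuousAt.2
      fun x => (hasDerivAt_primitive hb Z x).continuousAt
    exact continuous_const.mul ((h1.comp (f := fun v : ℝ × ℝ => -η - 2 * v.2) (by fun_prop)).mul
      (h2.comp (f := fun v : ℝ × ℝ => η + 2 * v.1) (by fun_prop)))
  have ew : ∀ p m, w p m = g p m + ∫ p' in p..L, ∫ m' in m..L, κ p' m' * w p' m' := by
    intro p m
    have hc : Continuous fun v : ℝ × ℝ => κ v.2 v.1 * w v.2 v.1 :=
      (hκc.comp continuous_swap).mul (hwc.comp continuous_swap)
    simp only [hw]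
    rw [eW, eg, ← integral_swap_of_continuous (F := fun m' p' => κ p' m' * w p' m') hc]
    congr 1
    rw [eZ', eZ, integral_affine_sub, ← intervalIntegral.integral_const_mul]
    refine intervalIntegral.integral_congr fun m' _ => ?_
    rw [integral_affine_add, intervalIntegral.integral_symm p L]
    rw [← sub_eq_zero]
    have : ∀ p', -(1 / 4) * q ((η + 2 * p' - (-η - 2 * m')) / 2) * W (-η - 2 * m') (η + 2 * p')
        = -(1 / 4) * (κ p' m' * w p' m') := by
      intro p'
      simp only [hκ, hw]
      rw [show (η + 2 * p' - (-η - 2 * m')) / 2 = η + p' + m' by ring]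
      ring
    simp only [this, intervalIntegral.integral_const_mul]
    ring
  have key := volterra_resolvent hL0 hL0 hκc (hR.cont_slice η) hwc hgc (fun p m => hR.eq η p m) ew
  have dual := integral_double_primitive_mul_of_continuous (F := fun p m => κ p m * R η p m)
    (h := H) hL0 hL0 (hκc.mul (hR.cont_slice η)) hHc
  have e1 : ∀ p m, (∫ p' in (0 : ℝ)..p, ∫ m' in (0 : ℝ)..m, κ p' m' * R η p' m') * H p m
      = R η p m * H p m - H p m := by
    intro p m
    have := hR.eq η p m
    rw [← sub_eq_iff_eq_add'] at this
    simp only [hκ]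
    rw [← this]
    ring
  have e2 : ∀ p m, κ p m * R η p m * ∫ p' in p..L, ∫ m' in m..L, H p' m'
      = -(κ p m * R η p m * g p m) := by
    intro p m
    simp only [hg]
    ring
  simp only [e1, e2, intervalIntegral.integral_neg] at dual
  rw [integral_integral_sub (F := fun p m => R η p m * H p m) ((hR.cont_slice η).mul hHc) hHc]
    at dual
  have hw0 : w 0 0 = W (-η) η := by simp [hw]
  rw [← hw0, key]
  have hg0 : g 0 0 = -∫ p in (0 : ℝ)..L, ∫ m in (0 : ℝ)..L, H p m := rfl
  linarith

section Green

variable {ρ : ℝ} {n₀ s : ℝ → ℝ} {ξ : Plane} {η : ℝ} {g : ℝ → ℝ → ℝ} {R : ℝ → ℝ → ℝ → ℝ}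

lemma IsSpaceCausalGreen.eq_riemann_interior (hρ : 0 < ρ) (hpos : ∀ y, 0 ≤ y → 0 < n₀ y)
    (hs : IsAmplitude ρ n₀ s) (hq : Continuous (potential n₀ s (‖ξ‖ ^ 2)))
    (hR : IsRiemann (potential n₀ s (‖ξ‖ ^ 2)) R) (hη : 0 ≤ η)
    (hg : IsSpaceCausalGreen ρ n₀ ξ η g) {y t : ℝ} (hyt : |t| < y - η) :
    s y * g y t = -(s η / 2) * R η ((y - η + t) / 2) ((y - η - t) / 2) := by
  set q := potential n₀ s (‖ξ‖ ^ 2) with hqdef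
  set x₀ := t - y with hx₀
  set z₀ := t + y with hz₀
  rw [abs_lt] at hyt
  set ε := min (-η - x₀) (z₀ - η) with hε
  have hε0 : 0 < ε := lt_min (by rw [hx₀]; linarith) (by rw [hz₀]; linarith)
  have hε1 : ε ≤ -η - x₀ := min_le_left _ _
  have hε2 : ε ≤ z₀ - η := min_le_right _ _
  have ey : y = (z₀ - x₀) / 2 := by rw [hz₀, hx₀]; ring
  have et : t = (z₀ + x₀) / 2 := by rw [hz₀, hx₀]; ring
  have hF1 : ContinuousOn (fun v : ℝ × ℝ => s v.1 * g v.1 v.2)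
      {v | |v.2 - v.1 - x₀| < ε ∧ |v.2 + v.1 - z₀| < ε} := by
    refine (hs.contDiff.continuous.comp continuous_fst).continuousOn.mul
      (hg.continuousOn.mono fun v hv => ?_)
    simp only [mem_ofPred_eq, abs_lt] at hv
    change |v.2| ≤ v.1 - η
    exact abs_le.2 ⟨by linarith [hv.2.1], by linarith [hv.1.2]⟩
  have hF2 : Continuous fun v : ℝ × ℝ => -(s η / 2) * R η ((v.1 - η + v.2) / 2)
      ((v.1 - η - v.2) / 2) :=
    continuous_const.mul ((hR.cont_slice η).comp (f := fun v : ℝ × ℝ =>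
      ((v.1 - η + v.2) / 2, (v.1 - η - v.2) / 2)) (by fun_prop))
  have := eq_of_integral_bump_eq hε0 hF1 hF2.continuousOn fun a b ha hb ha0 hb0 => ?_
  · rwa [← ey, ← et] at this
  set Z := |x₀| + |z₀| + ε with hZ
  have hx1 := abs_le.1 (le_refl |x₀|)
  have hz1 := abs_le.1 (le_refl |z₀|)
  have hηZ : η ≤ Z := by linarith
  have aZ : ∀ x, x ≤ -Z → a x = 0 := fun x hx => ha0 x (by rw [abs_of_nonpos] <;> linarith)
  have aη : ∀ x, -η ≤ x → a x = 0 := fun x hx => ha0 x (by rw [abs_of_nonneg] <;> linarith)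
  have bZ : ∀ z, Z ≤ z → b z = 0 := fun z hz => hb0 z (by rw [abs_of_nonneg] <;> linarith)
  have bη : ∀ z, z ≤ η → b z = 0 := fun z hz => hb0 z (by rw [abs_of_nonpos] <;> linarith)
  obtain ⟨W, P, Q, B, hW, hB, eW, hWx, -, hWz⟩ := exists_goursat hq
    ((hasCharDerivs_primitive_mul ha hb (-Z) Z).const_mul (1 / 4)) (-Z) Z
  have hWx' := hWx fun x z hx => by
    rw [intervalIntegral.integral_congr (g := fun _ => (0 : ℝ))]
    · simp
    · intro t ht
      rw [uIcc_of_ge hx] at ht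
      exact aZ t ht.2
  have hWz' := hWz fun x z hz => by
    rw [intervalIntegral.integral_congr (a := Z) (g := fun _ => (0 : ℝ))]
    · simp
    · intro t ht
      rw [uIcc_of_le hz] at ht
      exact bZ t ht.1
  have can := hg.canonical hρ hpos hs hη hW hWx' hWz'
  have e1 : ∫ v : ℝ × ℝ, s v.1 * g v.1 v.2 * (a (v.2 - v.1) * b (v.2 + v.1)) = s η * W (-η) η := by
    rw [← can, ← setIntegral_eq_integral_of_forall_compl_eq_zero
      (s := Ioi (0 : ℝ) ×ˢ (univ : Set ℝ))]
    · refine setIntegral_congr_fun (measurableSet_Ioi.prod .univ) fun v hv => ?_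
      have := hB (v.2 - v.1) (v.2 + v.1)
      rw [show (v.2 + v.1 - (v.2 - v.1)) / 2 = v.1 by ring] at this
      simp only [← hqdef]
      rw [this]
      ring
    · intro v hv
      have hv0 : v.1 ≤ 0 := not_lt.1 fun h => hv ⟨h, mem_univ _⟩
      rcases le_total v.2 0 with h | h
      · rw [bη _ (by linarith), mul_zero, mul_zero]
      · rw [aη _ (by linarith), zero_mul, mul_zero]
  rw [e1, goursat_source_eq hq hR ha.continuous hb.continuous hηZ hW.first.continuous eW]
  have hcc := bump_mul_continuous (half_lt_self hε0) hF2.continuousOn ha.continuous hb.continuous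
    ha0 hb0
  rw [integral_char_coords hcc.1 hcc.2]
  set L := (Z - η) / 2 with hL
  have eZ : Z = η + 2 * L := by rw [hL]; ring
  have eZ' : -Z = -η - 2 * L := by rw [hL]; ring
  have e2 : ∀ x, ∫ z, -(s η / 2) * R η (((z - x) / 2 - η + (z + x) / 2) / 2)
      (((z - x) / 2 - η - (z + x) / 2) / 2) * (a ((z + x) / 2 - (z - x) / 2)
        * b ((z + x) / 2 + (z - x) / 2))
      = -s η * ∫ p in (0 : ℝ)..L, R η p ((-η - x) / 2) * (a x * b (η + 2 * p)) := by
    intro x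
    rw [integral_eq_intervalIntegral (a := η + 2 * 0) (b := η + 2 * L), integral_affine_add,
      ← intervalIntegral.integral_const_mul, ← intervalIntegral.integral_const_mul]
    · refine intervalIntegral.integral_congr fun p _ => ?_
      rw [show ((η + 2 * p - x) / 2 - η + (η + 2 * p + x) / 2) / 2 = p by ring,
        show ((η + 2 * p - x) / 2 - η - (η + 2 * p + x) / 2) / 2 = (-η - x) / 2 by ring,
        show (η + 2 * p + x) / 2 - (η + 2 * p - x) / 2 = x by ring,
        show (η + 2 * p + x) / 2 + (η + 2 * p - x) / 2 = η + 2 * p by ring]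
      ring
    · intro z hz
      rw [show (z + x) / 2 + (z - x) / 2 = z by ring, bη z (by linarith), mul_zero, mul_zero]
    · intro z hz
      rw [show (z + x) / 2 + (z - x) / 2 = z by ring, bZ z (by linarith), mul_zero, mul_zero]
  simp only [e2]
  rw [integral_const_mul, integral_eq_intervalIntegral (a := -η - 2 * L) (b := -η - 2 * 0),
    integral_affine_sub]
  · have e3 : ∀ m, (-η - (-η - 2 * m)) / 2 = m := fun m => by ring
    simp only [e3]
    have hc : Continuous fun v : ℝ × ℝ => R η v.2 v.1 * (a (-η - 2 * v.1) * b (η + 2 * v.2)) :=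
      ((hR.cont_slice η).comp continuous_swap).mul
        ((ha.continuous.comp (by fun_prop)).mul (hb.continuous.comp (by fun_prop)))
    rw [integral_swap_of_continuous (F := fun m p => R η p m * (a (-η - 2 * m) * b (η + 2 * p))) hc]
    ring
  · intro x hx
    simp [aZ x (by linarith)]
  · intro x hx
    simp [aη x (by linarith)]

/-- The space-causal Green's function is `-½ √(σ(η) / σ(y))` times the Riemann function, up to the
boundary of its cone of support. -/
theorem IsSpaceCausalGreen.eq_riemann (hρ : 0 < ρ) (hpos : ∀ y, 0 ≤ y → 0 < n₀ y)
    (hs : IsAmplitude ρ n₀ s) (hq : Continuous (potential n₀ s (‖ξ‖ ^ 2)))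
    (hR : IsRiemann (potential n₀ s (‖ξ‖ ^ 2)) R) (hη : 0 ≤ η)
    (hg : IsSpaceCausalGreen ρ n₀ ξ η g) {y t : ℝ} (hyt : |t| ≤ y - η) :
    s y * g y t = -(s η / 2) * R η ((y - η + t) / 2) ((y - η - t) / 2) := by
  have hF1 : ContinuousOn (fun v : ℝ × ℝ => s v.1 * g v.1 v.2) {v | |v.2| ≤ v.1 - η} :=
    (hs.contDiff.continuous.comp continuous_fst).continuousOn.mul hg.continuousOn
  have hF2 : Continuous fun v : ℝ × ℝ => -(s η / 2) * R η ((v.1 - η + v.2) / 2)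
      ((v.1 - η - v.2) / 2) :=
    continuous_const.mul ((hR.cont_slice η).comp (f := fun v : ℝ × ℝ =>
      ((v.1 - η + v.2) / 2, (v.1 - η - v.2) / 2)) (by fun_prop))
  -- approach the point through `(y + δ, t)`, `δ ↓ 0`, which lies inside the cone
  have hpath : Filter.Tendsto (fun δ : ℝ => (y + δ, t)) (nhdsWithin 0 (Ioi 0))
      (nhdsWithin (y, t) {v : ℝ × ℝ | |v.2| ≤ v.1 - η}) := by
    refine tendsto_nhdsWithin_iff.2 ⟨?_, ?_⟩
    · have : Continuous fun δ : ℝ => (y + δ, t) := by fun_prop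
      have h := this.tendsto 0
      simp only [add_zero] at h
      exact h.mono_left nhdsWithin_le_nhds
    · filter_upwards [self_mem_nhdsWithin] with δ hδ
      have : 0 < δ := hδ
      change |t| ≤ y + δ - η
      linarith
  have l1 := (hF1 (y, t) hyt).tendsto.comp hpath
  have l2 := (hF2.continuousAt (x := (y, t))).tendsto.comp (hpath.mono_right nhdsWithin_le_nhds)
  refine tendsto_nhds_unique (l1.congr' ?_) l2
  filter_upwards [self_mem_nhdsWithin] with δ hδ
  have : 0 < δ := hδ
  exact hg.eq_riemann_interior hρ hpos hs hq hR hη (by linarith)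

end Green

/-! ### The wave behind the front -/

/-- The sign function, with value `-1` at `0`. -/
noncomputable def sgn (w : ℝ) : ℝ := if 0 < w then 1 else -1

/-- `∫₀^|w| q`, which for even `q` is the primitive `∫₀ʷ sgn q`; see `integral_sgn_mul`. -/
noncomputable def evenPrim (q : ℝ → ℝ) (w : ℝ) : ℝ := ∫ v in (0 : ℝ)..|w|, q v

/-- For even `q`, the double integral `-¼ ∫₀ˣ ∫₀ᶻ sgn(z' - x') q((z' - x')/2)`, the first-order
effect of the potential on a unit step that is continued oddly to `y < 0`; see `stepData_eq`. The
form chosen here has visibly continuous derivatives. -/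
noncomputable def stepData (q : ℝ → ℝ) (x z : ℝ) : ℝ :=
  (∫ w in (0 : ℝ)..((z - x) / 2), evenPrim q w) - (∫ w in (0 : ℝ)..(z / 2), evenPrim q w)
    + ∫ w in (0 : ℝ)..(x / 2), evenPrim q w

/-- The time derivative of `stepData`. -/
noncomputable def stepVel (q : ℝ → ℝ) (x z : ℝ) : ℝ :=
  1 / 2 * (evenPrim q (x / 2) - evenPrim q (z / 2))

/-- The second time derivative of `stepData`, for `x, z > 0`. -/
noncomputable def stepAcc (q : ℝ → ℝ) (x z : ℝ) : ℝ := 1 / 4 * (q (x / 2) - q (z / 2))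

/-- The time derivative of `-¼ ∫₀ˣ ∫₀ᶻ q f`: the integrals of `q f` over the two characteristics
that end at `(x, z)`. -/
noncomputable def charOp (q : ℝ → ℝ) (f : ℝ → ℝ → ℝ) (x z : ℝ) : ℝ :=
  -(1 / 4) * (∫ z' in (0 : ℝ)..z, q ((z' - x) / 2) * f x z')
    + -(1 / 4) * ∫ x' in (0 : ℝ)..x, q ((z - x') / 2) * f x' z

section Step

variable {q r : ℝ → ℝ}

lemma continuous_evenPrim (hq : Continuous q) : Continuous (evenPrim q) := by
  unfold evenPrim
  exact (intervalIntegral.continuous_primitive (fun a b => hq.intervalIntegrable a b) 0).comp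
    continuous_abs

lemma evenPrim_neg (q : ℝ → ℝ) (w : ℝ) : evenPrim q (-w) = evenPrim q w := by simp [evenPrim]

lemma evenPrim_zero (q : ℝ → ℝ) : evenPrim q 0 = 0 := by simp [evenPrim]

lemma hasDerivAt_evenPrim (hq : Continuous q) {w : ℝ} (hw : 0 < w) :
    HasDerivAt (evenPrim q) (q w) w := by
  refine (hasDerivAt_primitive hq 0 w).congr_of_eventuallyEq ?_
  filter_upwards [Ioi_mem_nhds hw] with v hv
  rw [evenPrim, abs_of_pos hv]

lemma monotone_sgn : Monotone sgn := by
  intro a b hab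
  unfold sgn
  split_ifs with h1 h2 <;> linarith

lemma intervalIntegrable_sgn_mul (hq : Continuous q) (c a b : ℝ) :
    IntervalIntegrable (fun z => sgn ((z - c) / 2) * q ((z - c) / 2)) volume a b := by
  refine IntervalIntegrable.mul_continuousOn ?_ (Continuous.continuousOn (by fun_prop))
  refine Monotone.intervalIntegrable (monotone_sgn.comp fun x y h => ?_)
  change (x - c) / 2 ≤ (y - c) / 2
  linarith

lemma integral_sgn_mul (he : ∀ w, q (-w) = q w) (w : ℝ) :
    ∫ v in (0 : ℝ)..w, sgn v * q v = evenPrim q w := by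
  rcases le_total 0 w with h | h
  · rw [evenPrim, abs_of_nonneg h, intervalIntegral.integral_of_le h,
      intervalIntegral.integral_of_le h]
    refine setIntegral_congr_fun measurableSet_Ioc fun v hv => ?_
    simp [sgn, hv.1]
  · rw [evenPrim, abs_of_nonpos h, intervalIntegral.integral_symm]
    have h1 : ∫ v in w..0, sgn v * q v = ∫ v in w..0, -q v := by
      refine intervalIntegral.integral_congr fun v hv => ?_
      rw [uIcc_of_le h] at hv
      simp [sgn, not_lt.2 hv.2]
    rw [h1, intervalIntegral.integral_neg, neg_neg]
    have h2 := intervalIntegral.integral_comp_neg (a := w) (b := 0) q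
    simp only [he, neg_zero] at h2
    exact h2

lemma integral_sgn_char (hq : Continuous q) (he : ∀ w, q (-w) = q w) (x z : ℝ) :
    ∫ z' in (0 : ℝ)..z, sgn ((z' - x) / 2) * q ((z' - x) / 2)
      = 2 * (evenPrim q ((z - x) / 2) - evenPrim q (x / 2)) := by
  have h := intervalIntegral.integral_comp_div_sub (a := 0) (b := z)
    (fun w => sgn w * q w) (two_ne_zero (α := ℝ)) (x / 2)
  simp only [← sub_div, smul_eq_mul] at h
  have hi : ∀ a b, IntervalIntegrable (fun w => sgn w * q w) volume a b := fun a b =>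
    (Monotone.intervalIntegrable monotone_sgn).mul_continuousOn hq.continuousOn
  rw [h, ← intervalIntegral.integral_interval_sub_left (a := 0) (hi _ _) (hi _ _),
    integral_sgn_mul he, integral_sgn_mul he, zero_sub, neg_div, evenPrim_neg]

lemma integral_evenPrim_neg (q : ℝ → ℝ) (w : ℝ) :
    ∫ v in (0 : ℝ)..(-w), evenPrim q v = -∫ v in (0 : ℝ)..w, evenPrim q v := by
  have h := intervalIntegral.integral_comp_neg (a := 0) (b := w) (evenPrim q)
  simp only [evenPrim_neg, neg_zero] at h
  rw [h, intervalIntegral.integral_symm]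

lemma stepData_eq (hq : Continuous q) (he : ∀ w, q (-w) = q w) (x z : ℝ) :
    stepData q x z = -(1 / 4) * ∫ x' in (0 : ℝ)..x, ∫ z' in (0 : ℝ)..z,
      sgn ((z' - x') / 2) * q ((z' - x') / 2) := by
  have hc := continuous_evenPrim hq
  simp_rw [integral_sgn_char hq he]
  rw [intervalIntegral.integral_const_mul, intervalIntegral.integral_sub
    (Continuous.intervalIntegrable (by fun_prop) _ _)
    (Continuous.intervalIntegrable (by fun_prop) _ _)]
  have h1 := intervalIntegral.integral_comp_sub_div (a := 0) (b := x) (evenPrim q)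
    (two_ne_zero (α := ℝ)) (z / 2)
  have h2 := intervalIntegral.integral_comp_div (a := 0) (b := x) (evenPrim q)
    (two_ne_zero (α := ℝ))
  simp only [← sub_div, smul_eq_mul, sub_zero, zero_div] at h1 h2
  rw [h1, h2, ← intervalIntegral.integral_interval_sub_left (a := 0) (hc.intervalIntegrable _ _)
    (hc.intervalIntegrable _ _), stepData]
  ring

lemma hasPartials_stepData (hq : Continuous q) :
    HasPartials (stepData q) (fun x z => 1 / 2 * (evenPrim q (x / 2) - evenPrim q ((z - x) / 2)))
      (fun x z => 1 / 2 * (evenPrim q ((z - x) / 2) - evenPrim q (z / 2))) := by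
  have hc := continuous_evenPrim hq
  have hd := hasDerivAt_primitive hc 0
  have hx : ∀ x : ℝ, HasDerivAt (fun x : ℝ => x / 2) (1 / 2) x := fun x =>
    (hasDerivAt_id x).div_const 2
  refine ⟨fun x z => ?_, fun x z => ?_, by fun_prop, by fun_prop⟩
  · have h1 : HasDerivAt (fun x : ℝ => (z - x) / 2) (-1 / 2) x :=
      ((hasDerivAt_id x).const_sub z).div_const 2
    refine ((((hd _).comp x h1).sub_const _).add ((hd _).comp x (hx x))).congr_deriv ?_
    ring
  · have h1 : HasDerivAt (fun z : ℝ => (z - x) / 2) (1 / 2) z :=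
      ((hasDerivAt_id z).sub_const x).div_const 2
    refine ((((hd _).comp z h1).sub ((hd _).comp z (hx z))).add_const _).congr_deriv ?_
    ring

lemma stepData_swap (q : ℝ → ℝ) (x z : ℝ) : stepData q z x = -stepData q x z := by
  have := integral_evenPrim_neg q ((z - x) / 2)
  rw [stepData, stepData, show (x - z) / 2 = -((z - x) / 2) by ring, this]
  ring

lemma stepData_zero_left (q : ℝ → ℝ) (z : ℝ) : stepData q 0 z = 0 := by simp [stepData]

lemma stepData_zero_right (q : ℝ → ℝ) (x : ℝ) : stepData q x 0 = 0 := by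
  rw [← neg_eq_zero, ← stepData_swap q, stepData_zero_left]

lemma evenPrim_add_mul (hq : Continuous q) (hr : Continuous r) (l w : ℝ) :
    evenPrim (fun w => q w + l * r w) w = evenPrim q w + l * evenPrim r w := by
  unfold evenPrim
  rw [intervalIntegral.integral_add (hq.intervalIntegrable _ _)
    (Continuous.intervalIntegrable (by fun_prop) _ _), intervalIntegral.integral_const_mul]

lemma stepData_add_mul (hq : Continuous q) (hr : Continuous r) (l x z : ℝ) :
    stepData (fun w => q w + l * r w) x z = stepData q x z + l * stepData r x z := by
  have h1 := continuous_evenPrim hq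
  have h2 := continuous_evenPrim hr
  have : ∀ a, ∫ w in (0 : ℝ)..a, evenPrim (fun w => q w + l * r w) w
      = (∫ w in (0 : ℝ)..a, evenPrim q w) + l * ∫ w in (0 : ℝ)..a, evenPrim r w := by
    intro a
    simp_rw [evenPrim_add_mul hq hr]
    rw [intervalIntegral.integral_add (h1.intervalIntegrable _ _)
      (Continuous.intervalIntegrable (by fun_prop) _ _), intervalIntegral.integral_const_mul]
  simp only [stepData, this]
  ring

lemma stepVel_add_mul (hq : Continuous q) (hr : Continuous r) (l x z : ℝ) :
    stepVel (fun w => q w + l * r w) x z = stepVel q x z + l * stepVel r x z := by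
  simp only [stepVel, evenPrim_add_mul hq hr]
  ring

lemma stepAcc_add_mul (q r : ℝ → ℝ) (l x z : ℝ) :
    stepAcc (fun w => q w + l * r w) x z = stepAcc q x z + l * stepAcc r x z := by
  simp only [stepAcc]
  ring

lemma continuous_stepVel (hq : Continuous q) : Continuous fun v : ℝ × ℝ => stepVel q v.1 v.2 := by
  have := continuous_evenPrim hq
  unfold stepVel
  fun_prop

lemma continuous_stepAcc (hq : Continuous q) : Continuous fun v : ℝ × ℝ => stepAcc q v.1 v.2 := by
  unfold stepAcc
  fun_prop

lemma hasDerivAt_stepVel (hq : Continuous q) {y t : ℝ} (hx : 0 < t - y) (hz : 0 < t + y) :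
    HasDerivAt (fun t => stepVel q (t - y) (t + y)) (stepAcc q (t - y) (t + y)) t := by
  have h1 : HasDerivAt (fun t => (t - y) / 2) (1 / 2) t :=
    ((hasDerivAt_id t).sub_const y).div_const 2
  have h2 : HasDerivAt (fun t => (t + y) / 2) (1 / 2) t :=
    ((hasDerivAt_id t).add_const y).div_const 2
  have d1 := (hasDerivAt_evenPrim hq (half_pos hx)).comp t h1
  have d2 := (hasDerivAt_evenPrim hq (half_pos hz)).comp t h2
  refine ((d1.sub d2).const_mul (1 / 2)).congr_deriv ?_
  rw [stepAcc]
  ring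

/-- `charOp` preserves continuity, jointly with a parameter. -/
lemma continuous_charOp {q : ℝ → ℝ → ℝ} {f : ℝ → ℝ → ℝ → ℝ}
    (hq : Continuous fun v : ℝ × ℝ => q v.1 v.2)
    (hf : Continuous fun v : ℝ × ℝ × ℝ => f v.1 v.2.1 v.2.2) :
    Continuous fun v : ℝ × ℝ × ℝ => charOp (q v.1) (f v.1) v.2.1 v.2.2 := by
  refine (continuous_const.mul ?_).add (continuous_const.mul ?_)
  · refine intervalIntegral.continuous_parametric_intervalIntegral_of_continuous
      (f := fun (v : ℝ × ℝ × ℝ) z' => q v.1 ((z' - v.2.1) / 2) * f v.1 v.2.1 z') ?_ (by fun_prop)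
    exact (hq.comp (f := fun u : (ℝ × ℝ × ℝ) × ℝ => (u.1.1, (u.2 - u.1.2.1) / 2)) (by fun_prop)).mul
      (hf.comp (f := fun u : (ℝ × ℝ × ℝ) × ℝ => (u.1.1, u.1.2.1, u.2)) (by fun_prop))
  · refine intervalIntegral.continuous_parametric_intervalIntegral_of_continuous
      (f := fun (v : ℝ × ℝ × ℝ) x' => q v.1 ((v.2.2 - x') / 2) * f v.1 x' v.2.2) ?_ (by fun_prop)
    exact (hq.comp (f := fun u : (ℝ × ℝ × ℝ) × ℝ => (u.1.1, (u.1.2.2 - u.2) / 2)) (by fun_prop)).mul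
      (hf.comp (f := fun u : (ℝ × ℝ × ℝ) × ℝ => (u.1.1, u.2, u.1.2.2)) (by fun_prop))

lemma charOp_add_mul_left (hq : Continuous q) (hr : Continuous r) {f : ℝ → ℝ → ℝ}
    (hf : Continuous fun v : ℝ × ℝ => f v.1 v.2) (l x z : ℝ) :
    charOp (fun w => q w + l * r w) f x z = charOp q f x z + l * charOp r f x z := by
  have h1 := continuous_slice_fst hf x
  have h2 : Continuous fun x => f x z := hf.comp (f := fun x => (x, z)) (by fun_prop)
  simp only [charOp, add_mul, mul_assoc]
  rw [intervalIntegral.integral_add (Continuous.intervalIntegrable (by fun_prop) _ _)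
    (Continuous.intervalIntegrable (by fun_prop) _ _), intervalIntegral.integral_add
    (Continuous.intervalIntegrable (by fun_prop) _ _)
    (Continuous.intervalIntegrable (by fun_prop) _ _), intervalIntegral.integral_const_mul,
    intervalIntegral.integral_const_mul]
  ring

lemma charOp_add_mul_right (hq : Continuous q) {f g : ℝ → ℝ → ℝ}
    (hf : Continuous fun v : ℝ × ℝ => f v.1 v.2) (hg : Continuous fun v : ℝ × ℝ => g v.1 v.2)
    (l x z : ℝ) :
    charOp q (fun x z => f x z + l * g x z) x z = charOp q f x z + l * charOp q g x z := by
  have h1 := continuous_slice_fst hf x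
  have h2 : Continuous fun x => f x z := hf.comp (f := fun x => (x, z)) (by fun_prop)
  have h3 := continuous_slice_fst hg x
  have h4 : Continuous fun x => g x z := hg.comp (f := fun x => (x, z)) (by fun_prop)
  simp only [charOp, mul_add, mul_left_comm _ l]
  rw [intervalIntegral.integral_add (Continuous.intervalIntegrable (by fun_prop) _ _)
    (Continuous.intervalIntegrable (by fun_prop) _ _), intervalIntegral.integral_add
    (Continuous.intervalIntegrable (by fun_prop) _ _)
    (Continuous.intervalIntegrable (by fun_prop) _ _), intervalIntegral.integral_const_mul,
    intervalIntegral.integral_const_mul]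
  ring

lemma charOp_zero_left {f : ℝ → ℝ → ℝ} (hf : ∀ z, f 0 z = 0) (z : ℝ) : charOp q f 0 z = 0 := by
  simp [charOp, hf]

/-- The time derivative commutes with `charOp` on functions that vanish on the axes. -/
lemma hasDerivAt_charOp (hq : Continuous q) {f fx fz : ℝ → ℝ → ℝ} (hf : HasPartials f fx fz)
    (h0 : ∀ z, f 0 z = 0) (h0' : ∀ x, f x 0 = 0) (y t : ℝ) :
    HasDerivAt (fun t => charOp q f (t - y) (t + y))
      (charOp q (fun x z => fx x z + fz x z) (t - y) (t + y)) t := by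
  have h1 := hasDerivAt_char_time hq hf 0 y t
  have h2 := hasDerivAt_char_time (q := fun w => q (-w)) (by fun_prop) hf.swap 0 (-y) t
  simp only [h0', mul_zero, add_zero] at h1
  simp only [h0, mul_zero, add_zero, sub_neg_eq_add] at h2
  have e : ∀ a b : ℝ, -((a - b) / 2) = (b - a) / 2 := fun a b => by ring
  simp only [e, ← sub_eq_add_neg, add_comm (fz _ _)] at h2
  exact (h1.const_mul (-(1 / 4))).add (h2.const_mul (-(1 / 4)))

/-- Regularity of the solution of the integral equation with the data of a step. -/
lemma step_regularity {r₁ : ℝ → ℝ} (hr : Continuous r) (hr₁ : Continuous r₁) (hq : Continuous q)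
    {u f : ℝ → ℝ → ℝ} (hu : Continuous fun v : ℝ × ℝ => u v.1 v.2)
    (hf : Continuous fun v : ℝ × ℝ => f v.1 v.2)
    (ef : ∀ x z, f x z = stepData r x z + -(1 / 4) * ∫ x' in (0 : ℝ)..x, ∫ z' in (0 : ℝ)..z,
      (r₁ ((z' - x') / 2) * u x' z' + q ((z' - x') / 2) * f x' z')) :
    (∀ z, f 0 z = 0) ∧ (∀ x, f x 0 = 0) ∧ ∃ fx fz, HasPartials f fx fz ∧
      ∀ x z, fx x z + fz x z = stepVel r x z + charOp r₁ u x z + charOp q f x z := by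
  have hF : Continuous fun v : ℝ × ℝ =>
      r₁ ((v.2 - v.1) / 2) * u v.1 v.2 + q ((v.2 - v.1) / 2) * f v.1 v.2 := by fun_prop
  refine ⟨fun z => by rw [ef, stepData_zero_left]; simp,
    fun x => by rw [ef, stepData_zero_right r]; simp, ?_⟩
  have h := (hasPartials_stepData hr).add ((hasPartials_double_primitive
    (F := fun x z => r₁ ((z - x) / 2) * u x z + q ((z - x) / 2) * f x z) hF 0 0).const_mul
    (-(1 / 4)))
  rw [show (fun x z => stepData r x z + -(1 / 4) * ∫ x' in (0 : ℝ)..x, ∫ z' in (0 : ℝ)..z,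
      (r₁ ((z' - x') / 2) * u x' z' + q ((z' - x') / 2) * f x' z')) = f from
    funext fun x => funext fun z => (ef x z).symm] at h
  refine ⟨_, _, h, fun x z => ?_⟩
  have h1 := continuous_slice_fst hf x
  have h2 : Continuous fun x => f x z := hf.comp (f := fun x => (x, z)) (by fun_prop)
  have h3 := continuous_slice_fst hu x
  have h4 : Continuous fun x => u x z := hu.comp (f := fun x => (x, z)) (by fun_prop)
  rw [intervalIntegral.integral_add (Continuous.intervalIntegrable (by fun_prop) _ _)
    (Continuous.intervalIntegrable (by fun_prop) _ _), intervalIntegral.integral_add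
    (Continuous.intervalIntegrable (by fun_prop) _ _)
    (Continuous.intervalIntegrable (by fun_prop) _ _)]
  simp only [stepVel, charOp]
  ring

end Step

/-- Carathéodory's criterion for differentiability. -/
lemma hasDerivAt_of_eq_add_mul {φ D : ℝ → ℝ} {μ : ℝ} (h : ∀ l, φ l = φ μ + (l - μ) * D l)
    (hD : ContinuousAt D μ) : HasDerivAt φ (D μ) μ := by
  rw [hasDerivAt_iff_tendsto_slope]
  refine (hD.tendsto.mono_left nhdsWithin_le_nhds).congr' ?_
  filter_upwards [self_mem_nhdsWithin] with l hl
  have : l - μ ≠ 0 := sub_ne_zero.2 hl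
  rw [slope_def_field, h l]
  field_simp
  ring

/-- The profile `u` of the wave behind the front, which is `1 + u`, as a function of the
characteristic variables `x = t - y`, `z = t + y`. The equation is the Goursat problem
`4 uₓ_z = -q (sgn + u)`, `u = 0` on both axes, obtained by continuing the potential evenly and the
wave oddly to `y < 0`; it encodes the boundary value at `y = 0`. -/
structure IsStepProfile (q : ℝ → ℝ) (u : ℝ → ℝ → ℝ) : Prop where
  cont : Continuous fun v : ℝ × ℝ => u v.1 v.2
  eq : ∀ x z, u x z = stepData q x z
    + -(1 / 4) * ∫ x' in (0 : ℝ)..x, ∫ z' in (0 : ℝ)..z, q ((z' - x') / 2) * u x' z'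

lemma IsStepProfile.swap {q : ℝ → ℝ} (hq : Continuous q) (he : ∀ w, q (-w) = q w)
    {u : ℝ → ℝ → ℝ} (hu : IsStepProfile q u) (x z : ℝ) : u z x = -u x z := by
  have hc := hu.cont
  have hc' : Continuous fun v : ℝ × ℝ => u v.2 v.1 := hc.comp continuous_swap
  have h0 := volterra_unique (κ := fun x z => -(1 / 4) * q ((z - x) / 2))
    (f := fun x z => u x z + u z x) (x₀ := 0) (z₀ := 0) (X := x) (Z := z) (by fun_prop)
    (hc.add hc') (fun x _ z _ => ?_) x right_mem_uIcc z right_mem_uIcc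
  · linarith
  have e1 : ∀ x' z', -(1 / 4) * q ((z' - x') / 2) * (u x' z' + u z' x')
      = -(1 / 4) * (q ((z' - x') / 2) * u x' z') + -(1 / 4) * (q ((x' - z') / 2) * u z' x') := by
    intro x' z'
    rw [show (x' - z') / 2 = -((z' - x') / 2) by ring, he]
    ring
  have c1 : Continuous fun v : ℝ × ℝ => q ((v.2 - v.1) / 2) * u v.1 v.2 := by fun_prop
  have c2 : Continuous fun v : ℝ × ℝ => q ((v.1 - v.2) / 2) * u v.2 v.1 := by fun_prop
  have e2 := integral_integral_sub
    (F := fun x' z' => -(1 / 4) * (q ((z' - x') / 2) * u x' z'))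
    (G := fun x' z' => (1 / 4) * (q ((x' - z') / 2) * u z' x')) (continuous_const.mul c1)
    (continuous_const.mul c2) 0 x 0 z
  have e3 := integral_swap_of_continuous (F := fun x' z' => q ((x' - z') / 2) * u z' x') c2 0 x 0 z
  simp only [e1]
  rw [hu.eq x z, hu.eq z x, stepData_swap q]
  simp only [sub_eq_add_neg, ← neg_mul] at e2
  simp only [sub_eq_add_neg] at e3 ⊢
  rw [e2]
  simp only [intervalIntegral.integral_const_mul, e3]
  ring

/-- The step profiles for the potentials `q₀ + l q₁` exist, with the time derivatives `k`, `kk` for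
`0 < y < t`, and are differentiable in `l` together with `kk`; the derivatives `Du`, `Dkk` are
related in the same way. -/
theorem exists_stepProfile {q₀ q₁ : ℝ → ℝ} (h₀ : Continuous q₀) (h₁ : Continuous q₁) :
    ∃ u k kk Du Dk Dkk : ℝ → ℝ → ℝ → ℝ,
      (∀ l, IsStepProfile (fun w => q₀ w + l * q₁ w) (u l)) ∧
      (∀ l y t, HasDerivAt (fun t => u l (t - y) (t + y)) (k l (t - y) (t + y)) t) ∧
      (∀ l y t, 0 < t - y → 0 < t + y →
        HasDerivAt (fun t => k l (t - y) (t + y)) (kk l (t - y) (t + y)) t) ∧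
      (∀ l x z, HasDerivAt (fun l => u l x z) (Du l x z) l) ∧
      (∀ l x z, HasDerivAt (fun l => kk l x z) (Dkk l x z) l) ∧
      (∀ l y t, HasDerivAt (fun t => Du l (t - y) (t + y)) (Dk l (t - y) (t + y)) t) ∧
      (∀ l y t, 0 < t - y → 0 < t + y →
        HasDerivAt (fun t => Dk l (t - y) (t + y)) (Dkk l (t - y) (t + y)) t) ∧
      (∀ l z, Du l 0 z = 0) ∧ (∀ l z, Dk l 0 z = -(1 / 2) * evenPrim q₁ (z / 2)) ∧
      (∀ l, Continuous fun v : ℝ × ℝ => kk l v.1 v.2) ∧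
      (∀ l, Continuous fun v : ℝ × ℝ => Du l v.1 v.2) ∧
      (∀ l, Continuous fun v : ℝ × ℝ => Dk l v.1 v.2) ∧
      (∀ l, Continuous fun v : ℝ × ℝ => Dkk l v.1 v.2) := by
  set q : ℝ → ℝ → ℝ := fun l w => q₀ w + l * q₁ w with hq
  have hqc : Continuous fun v : ℝ × ℝ => q v.1 v.2 := by simp only [hq]; fun_prop
  have hql : ∀ l, Continuous (q l) := fun l => continuous_slice_fst hqc l
  have hκ : Continuous fun v : ℝ × ℝ × ℝ => -(1 / 4) * q v.1 ((v.2.2 - v.2.1) / 2) :=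
    continuous_const.mul (hqc.comp (f := fun v : ℝ × ℝ × ℝ => (v.1, (v.2.2 - v.2.1) / 2))
      (by fun_prop))
  have hsd : ∀ {r : ℝ → ℝ}, Continuous r →
      Continuous fun v : ℝ × ℝ × ℝ => stepData r v.2.1 v.2.2 := fun hr =>
    (hasPartials_stepData hr).continuous.comp continuous_snd
  obtain ⟨u, huc, eu⟩ := volterra_exists (fun l x z => -(1 / 4) * q l ((z - x) / 2))
    (fun l x z => stepData q₀ x z + l * stepData q₁ x z) 0 0 hκ
    ((hsd h₀).add (continuous_fst.mul (hsd h₁)))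
  have hul : ∀ l, Continuous fun v : ℝ × ℝ => u l v.1 v.2 := fun l =>
    huc.comp (f := fun v : ℝ × ℝ => (l, v.1, v.2)) (by fun_prop)
  have hu : ∀ l, IsStepProfile (q l) (u l) := by
    intro l
    refine ⟨hul l, fun x z => ?_⟩
    rw [eu, stepData_add_mul h₀ h₁]
    simp only [mul_assoc, intervalIntegral.integral_const_mul]
  -- `D μ l` is the difference quotient `(u l - u μ) / (l - μ)`, which solves an equation of the
  -- same kind that makes sense for `l = μ` too.
  have hDex : ∀ μ, ∃ D : ℝ → ℝ → ℝ → ℝ, (Continuous fun v : ℝ × ℝ × ℝ => D v.1 v.2.1 v.2.2) ∧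
      ∀ l x z, D l x z = stepData q₁ x z + -(1 / 4) * ∫ x' in (0 : ℝ)..x, ∫ z' in (0 : ℝ)..z,
        (q₁ ((z' - x') / 2) * u μ x' z' + q l ((z' - x') / 2) * D l x' z') := by
    intro μ
    have hF : Continuous fun v : ℝ × ℝ => q₁ ((v.2 - v.1) / 2) * u μ v.1 v.2 := by
      have := hul μ
      fun_prop
    have hI := (hasPartials_double_primitive (F := fun x z => q₁ ((z - x) / 2) * u μ x z)
      hF 0 0).continuous
    obtain ⟨D, hD, eD⟩ := volterra_exists (fun l x z => -(1 / 4) * q l ((z - x) / 2))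
      (fun _ x z => stepData q₁ x z + -(1 / 4) * ∫ x' in (0 : ℝ)..x, ∫ z' in (0 : ℝ)..z,
        q₁ ((z' - x') / 2) * u μ x' z') 0 0 hκ
      ((hsd h₁).add (continuous_const.mul (hI.comp continuous_snd)))
    refine ⟨D, hD, fun l x z => ?_⟩
    have hG : Continuous fun v : ℝ × ℝ => -(q l ((v.2 - v.1) / 2) * D l v.1 v.2) :=
      (((hql l).comp (by fun_prop)).mul
        (hD.comp (f := fun v : ℝ × ℝ => (l, v.1, v.2)) (by fun_prop))).neg
    have e := integral_integral_sub (F := fun x z => q₁ ((z - x) / 2) * u μ x z)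
      (G := fun x z => -(q l ((z - x) / 2) * D l x z)) hF hG 0 x 0 z
    simp only [sub_neg_eq_add, intervalIntegral.integral_neg] at e
    rw [e, eD]
    simp only [mul_assoc, intervalIntegral.integral_const_mul]
    ring
  choose D hDc eD using hDex
  have hDl : ∀ μ l, Continuous fun v : ℝ × ℝ => D μ l v.1 v.2 := fun μ l =>
    (hDc μ).comp (f := fun v : ℝ × ℝ => (l, v.1, v.2)) (by fun_prop)
  have hD : ∀ μ l x z, u l x z = u μ x z + (l - μ) * D μ l x z := by
    intro μ l x z
    have h0 := volterra_unique (κ := fun x z => -(1 / 4) * q l ((z - x) / 2))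
      (f := fun x z => u l x z - (u μ x z + (l - μ) * D μ l x z)) (x₀ := 0) (z₀ := 0) (X := x)
      (Z := z) (by have := hql l; fun_prop)
      ((hul l).sub ((hul μ).add (continuous_const.mul (hDl μ l)))) (fun x _ z _ => ?_) x
      right_mem_uIcc z right_mem_uIcc
    · linarith
    have c1 : Continuous fun v : ℝ × ℝ => q l ((v.2 - v.1) / 2) * u l v.1 v.2 := by
      have := hql l; have := hul l; fun_prop
    have c2 : Continuous fun v : ℝ × ℝ => q μ ((v.2 - v.1) / 2) * u μ v.1 v.2 := by
      have := hql μ; have := hul μ; fun_prop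
    have c3 : Continuous fun v : ℝ × ℝ => (l - μ) * (q₁ ((v.2 - v.1) / 2) * u μ v.1 v.2
        + q l ((v.2 - v.1) / 2) * D μ l v.1 v.2) := by
      have := hql l; have := hul μ; have := hDl μ l; fun_prop
    have e1 := integral_integral_sub (F := fun x z => q l ((z - x) / 2) * u l x z)
      (G := fun x z => q μ ((z - x) / 2) * u μ x z) c1 c2 0 x 0 z
    have e2 := integral_integral_sub (F := fun x z => q l ((z - x) / 2) * u l x z
        - q μ ((z - x) / 2) * u μ x z)
      (G := fun x z => (l - μ) * (q₁ ((z - x) / 2) * u μ x z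
        + q l ((z - x) / 2) * D μ l x z)) (c1.sub c2) c3 0 x 0 z
    have e3 : ∀ x' z', -(1 / 4) * q l ((z' - x') / 2) * (u l x' z' - (u μ x' z'
        + (l - μ) * D μ l x' z')) = -(1 / 4) * (q l ((z' - x') / 2) * u l x' z'
        - q μ ((z' - x') / 2) * u μ x' z' - (l - μ) * (q₁ ((z' - x') / 2) * u μ x' z'
        + q l ((z' - x') / 2) * D μ l x' z')) := by
      intro x' z'
      simp only [hq]
      ring
    simp only [e3, intervalIntegral.integral_const_mul]
    rw [e2, e1, (hu l).eq, (hu μ).eq, eD, stepData_add_mul h₀ h₁, stepData_add_mul h₀ h₁]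
    simp only [intervalIntegral.integral_const_mul]
    ring
  -- Differentiating the integral equations in time gives explicit expressions, affine in `q` and
  -- in the solutions, so that their difference quotients in `l` are continuous too.
  set k : ℝ → ℝ → ℝ → ℝ := fun l x z => stepVel (q l) x z + charOp (q l) (u l) x z with hk
  set kk : ℝ → ℝ → ℝ → ℝ := fun l x z => stepAcc (q l) x z + charOp (q l) (k l) x z with hkk
  set Dk : ℝ → ℝ → ℝ → ℝ → ℝ := fun μ l x z =>
    stepVel q₁ x z + charOp q₁ (u μ) x z + charOp (q l) (D μ l) x z with hDk
  set Dkk : ℝ → ℝ → ℝ → ℝ → ℝ := fun μ l x z =>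
    stepAcc q₁ x z + charOp q₁ (k μ) x z + charOp (q l) (Dk μ l) x z with hDkk
  have hqc' : ∀ {r : ℝ → ℝ}, Continuous r → Continuous fun v : ℝ × ℝ => r v.2 :=
    fun hr => hr.comp continuous_snd
  have hch : ∀ {r : ℝ → ℝ} {f : ℝ → ℝ → ℝ}, Continuous r →
      (Continuous fun v : ℝ × ℝ => f v.1 v.2) → Continuous fun v : ℝ × ℝ => charOp r f v.1 v.2 := by
    intro r f hr hf
    exact (continuous_charOp (q := fun _ => r) (f := fun _ => f) (hqc' hr)
      (hf.comp continuous_snd)).comp (f := fun v : ℝ × ℝ => ((0 : ℝ), v.1, v.2)) (by fun_prop)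
  have hkl : ∀ l, Continuous fun v : ℝ × ℝ => k l v.1 v.2 := fun l =>
    (continuous_stepVel (hql l)).add (hch (hql l) (hul l))
  have hkkl : ∀ l, Continuous fun v : ℝ × ℝ => kk l v.1 v.2 := fun l =>
    (continuous_stepAcc (hql l)).add (hch (hql l) (hkl l))
  have hDkc : ∀ μ, Continuous fun v : ℝ × ℝ × ℝ => Dk μ v.1 v.2.1 v.2.2 := fun μ =>
    (((continuous_stepVel h₁).comp continuous_snd).add
      ((hch h₁ (hul μ)).comp continuous_snd)).add (continuous_charOp hqc (hDc μ))
  have hDkkc : ∀ μ, Continuous fun v : ℝ × ℝ × ℝ => Dkk μ v.1 v.2.1 v.2.2 := fun μ =>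
    (((continuous_stepAcc h₁).comp continuous_snd).add
      ((hch h₁ (hkl μ)).comp continuous_snd)).add (continuous_charOp hqc (hDkc μ))
  have hDkl : ∀ μ l, Continuous fun v : ℝ × ℝ => Dk μ l v.1 v.2 := fun μ l =>
    (hDkc μ).comp (f := fun v : ℝ × ℝ => (l, v.1, v.2)) (by fun_prop)
  have op : ∀ (f g : ℝ → ℝ → ℝ), (Continuous fun v : ℝ × ℝ => f v.1 v.2) →
      (Continuous fun v : ℝ × ℝ => g v.1 v.2) → ∀ μ l x z,
      charOp (q l) (fun x z => f x z + (l - μ) * g x z) x z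
        = charOp (q μ) f x z + (l - μ) * (charOp q₁ f x z + charOp (q l) g x z) := by
    intro f g hf hg μ l x z
    rw [charOp_add_mul_right (hql l) hf hg, charOp_add_mul_left h₀ h₁ hf,
      charOp_add_mul_left (l := μ) h₀ h₁ hf]
    ring
  have hDk_eq : ∀ μ l x z, k l x z = k μ x z + (l - μ) * Dk μ l x z := by
    intro μ l x z
    simp only [hk, hDk]
    rw [show u l = fun x z => u μ x z + (l - μ) * D μ l x z from
      funext fun x => funext fun z => hD μ l x z, op _ _ (hul μ) (hDl μ l),
      stepVel_add_mul h₀ h₁, stepVel_add_mul h₀ h₁]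
    ring
  have hDkk_eq : ∀ μ l x z, kk l x z = kk μ x z + (l - μ) * Dkk μ l x z := by
    intro μ l x z
    simp only [hkk, hDkk]
    rw [show k l = fun x z => k μ x z + (l - μ) * Dk μ l x z from
      funext fun x => funext fun z => hDk_eq μ l x z, op _ _ (hkl μ) (hDkl μ l),
      stepAcc_add_mul, stepAcc_add_mul]
    ring
  have reg_u : ∀ l, (∀ z, u l 0 z = 0) ∧ (∀ x, u l x 0 = 0) ∧ ∃ fx fz, HasPartials (u l) fx fz ∧
      ∀ x z, fx x z + fz x z = k l x z := by
    intro l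
    obtain ⟨a1, a2, fx, fz, h, e⟩ := step_regularity (r := q l) (r₁ := fun _ => 0) (hql l)
      continuous_const (hql l) (u := fun _ _ => 0) continuous_const (hul l) (fun x z => by
        simpa using (hu l).eq x z)
    refine ⟨a1, a2, fx, fz, h, fun x z => ?_⟩
    rw [e]
    simp [hk, charOp]
  have reg_D : ∀ l, (∀ z, D l l 0 z = 0) ∧ (∀ x, D l l x 0 = 0) ∧
      ∃ fx fz, HasPartials (D l l) fx fz ∧ ∀ x z, fx x z + fz x z = Dk l l x z := fun l =>
    step_regularity h₁ h₁ (hql l) (hul l) (hDl l l) (fun x z => eD l l x z)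
  have time : ∀ {f fx fz : ℝ → ℝ → ℝ}, HasPartials f fx fz → ∀ y t : ℝ,
      HasDerivAt (fun t => f (t - y) (t + y)) (fx (t - y) (t + y) + fz (t - y) (t + y)) t := by
    intro f fx fz h y t
    simpa using h.comp_hasDerivAt ((hasDerivAt_id t).sub_const y) ((hasDerivAt_id t).add_const y)
  refine ⟨u, k, kk, fun l => D l l, fun l => Dk l l, fun l => Dkk l l, hu, ?_, ?_, ?_, ?_, ?_, ?_,
    fun l => (reg_D l).1, ?_, hkkl, fun l => hDl l l, fun l => hDkl l l, fun l =>
      (hDkkc l).comp (f := fun v : ℝ × ℝ => (l, v.1, v.2)) (by fun_prop)⟩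
  · intro l y t
    obtain ⟨-, -, fx, fz, h, e⟩ := reg_u l
    rw [← e]
    exact time h y t
  · intro l y t hx hz
    obtain ⟨a1, a2, fx, fz, h, e⟩ := reg_u l
    have := (hasDerivAt_stepVel (hql l) hx hz).add (hasDerivAt_charOp (hql l) h a1 a2 y t)
    simpa only [e] using! this
  · intro l x z
    exact hasDerivAt_of_eq_add_mul (fun m => hD l m x z)
      ((hDc l).comp (f := fun m : ℝ => (m, x, z)) (by fun_prop)).continuousAt
  · intro l x z
    exact hasDerivAt_of_eq_add_mul (fun m => hDkk_eq l m x z)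
      ((hDkkc l).comp (f := fun m : ℝ => (m, x, z)) (by fun_prop)).continuousAt
  · intro l y t
    obtain ⟨-, -, fx, fz, h, e⟩ := reg_D l
    have := time h y t
    simpa only [e] using! this
  · intro l y t hx hz
    obtain ⟨a1, a2, fx, fz, h, e⟩ := reg_D l
    obtain ⟨b1, b2, gx, gz, h', e'⟩ := reg_u l
    have := ((hasDerivAt_stepVel h₁ hx hz).add (hasDerivAt_charOp h₁ h' b1 b2 y t)).add
      (hasDerivAt_charOp (hql l) h a1 a2 y t)
    simpa only [e, e'] using! this
  · intro l z
    simp only [hDk]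
    rw [charOp_zero_left (reg_u l).1, charOp_zero_left (reg_D l).1]
    simp [stepVel, evenPrim_zero]

/-! ### The zero-order wave -/

lemma continuous_integral_between {X : Type*} [TopologicalSpace X] {F : X → ℝ → ℝ}
    (hF : Continuous fun v : X × ℝ => F v.1 v.2) {a b : X → ℝ} (ha : Continuous a)
    (hb : Continuous b) : Continuous fun x => ∫ t in (a x)..(b x), F x t := by
  have i : ∀ x c d, IntervalIntegrable (F x) volume c d := fun x c d =>
    (hF.comp (f := fun t => (x, t)) (by fun_prop)).intervalIntegrable c d
  have e : ∀ x, ∫ t in (a x)..(b x), F x t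
      = (∫ t in (0 : ℝ)..(b x), F x t) - ∫ t in (0 : ℝ)..(a x), F x t := fun x =>
    (intervalIntegral.integral_interval_sub_left (i _ _ _) (i _ _ _)).symm
  simp only [e]
  exact (intervalIntegral.continuous_parametric_intervalIntegral_of_continuous hF hb).sub
    (intervalIntegral.continuous_parametric_intervalIntegral_of_continuous hF ha)

section Duality

variable {q : ℝ → ℝ} {u W B H : ℝ → ℝ → ℝ} {Z : ℝ}

/-- `u = -¼ ∫∫ q (sgn + u)`. -/
lemma IsStepProfile.eq_integral (hq : Continuous q) (he : ∀ w, q (-w) = q w)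
    (hu : IsStepProfile q u) (x z : ℝ) : u x z = -(1 / 4) * ∫ x' in (0 : ℝ)..x,
      ∫ z' in (0 : ℝ)..z, (sgn ((z' - x') / 2) * q ((z' - x') / 2)
        + q ((z' - x') / 2) * u x' z') := by
  have hc := hu.cont
  have c1 : Continuous fun v : ℝ × ℝ => q ((v.2 - v.1) / 2) * u v.1 v.2 := by fun_prop
  have hE := continuous_evenPrim hq
  have e : ∀ x', ∫ z' in (0 : ℝ)..z, (sgn ((z' - x') / 2) * q ((z' - x') / 2)
        + q ((z' - x') / 2) * u x' z')
      = (∫ z' in (0 : ℝ)..z, sgn ((z' - x') / 2) * q ((z' - x') / 2))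
        + ∫ z' in (0 : ℝ)..z, q ((z' - x') / 2) * u x' z' := fun x' =>
    intervalIntegral.integral_add (intervalIntegrable_sgn_mul hq x' 0 z)
      ((continuous_slice_fst (F := fun x z => q ((z - x) / 2) * u x z) c1 x').intervalIntegrable
        _ _)
  have h1 : Continuous fun x' => ∫ z' in (0 : ℝ)..z,
      sgn ((z' - x') / 2) * q ((z' - x') / 2) := by
    simp only [integral_sgn_char hq he]
    fun_prop
  simp only [e]
  rw [intervalIntegral.integral_add (h1.intervalIntegrable _ _)
    ((continuous_slice_integral (F := fun x z => q ((z - x) / 2) * u x z) c1 0 z).intervalIntegrable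
      _ _), hu.eq, stepData_eq hq he]
  ring

/-- The wave `(1 + u) 1_{x > 0}` tested with an odd solution `W` of `4 Wₓ_z + q W = H`: the boundary
term `2 ∫∫ B`, `B = Wₓ_z`, over the triangle `0 < x < z < Z` is the pairing with `H`. Both `u` and
`W` are odd under `x ↔ z`, so that the triangle may be replaced by the square, where this is the
duality of integration over lower and upper rectangles. -/
lemma IsStepProfile.integral_triangle_eq (hq : Continuous q) (he : ∀ w, q (-w) = q w)
    (hu : IsStepProfile q u) (hZ : 0 ≤ Z) (hB : Continuous fun v : ℝ × ℝ => B v.1 v.2)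
    (hWc : Continuous fun v : ℝ × ℝ => W v.1 v.2)
    (hW : ∀ x z, W x z = ∫ x' in x..Z, ∫ z' in z..Z, B x' z') (hWs : ∀ x z, W z x = -W x z)
    (hBs : ∀ x z, B z x = -B x z)
    (hH : ∀ x z, 4 * B x z + q ((z - x) / 2) * W x z = H x z) :
    2 * ∫ x in (0 : ℝ)..Z, ∫ z in x..Z, B x z
      = 1 / 2 * ∫ x in (0 : ℝ)..Z, ∫ z in x..Z, (1 + u x z) * H x z := by
  have hc := hu.cont
  have hE := continuous_evenPrim hq
  have c1 : Continuous fun v : ℝ × ℝ => q ((v.2 - v.1) / 2) * u v.1 v.2 := by fun_prop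
  set F : ℝ → ℝ → ℝ := fun x z => sgn ((z - x) / 2) * q ((z - x) / 2) + q ((z - x) / 2) * u x z
    with hF
  have hFi : ∀ x a b, IntervalIntegrable (F x) volume a b := fun x a b =>
    (intervalIntegrable_sgn_mul hq x a b).add ((continuous_slice_fst
      (F := fun x z => q ((z - x) / 2) * u x z) c1 x).intervalIntegrable _ _)
  have hF1 : Continuous fun v : ℝ × ℝ => ∫ z in (0 : ℝ)..v.2, F v.1 z := by
    have e : ∀ v : ℝ × ℝ, ∫ z in (0 : ℝ)..v.2, F v.1 z
        = 2 * (evenPrim q ((v.2 - v.1) / 2) - evenPrim q (v.1 / 2))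
          + ∫ z in (0 : ℝ)..v.2, q ((z - v.1) / 2) * u v.1 z := fun v => by
      rw [← integral_sgn_char hq he]
      exact intervalIntegral.integral_add (intervalIntegrable_sgn_mul hq _ _ _)
        ((continuous_slice_fst (F := fun x z => q ((z - x) / 2) * u x z) c1 _).intervalIntegrable
          _ _)
    simp only [e]
    have := (hasPartials_double_primitive (F := fun x z => q ((z - x) / 2) * u x z) c1 0 0).cont_fst
    fun_prop
  have dual := integral_double_primitive_mul hZ hZ hF1 (fun x => hFi x 0 Z) hB
  -- `u (4 B) + q (sgn + u) W` above and below the diagonal of the square; the two expressions are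
  -- exchanged by `x ↔ z`
  set T₁ : ℝ → ℝ → ℝ := fun x z => 4 * (u x z * B x z) + q ((z - x) / 2) * (1 + u x z) * W x z
    with hT₁
  set T₂ : ℝ → ℝ → ℝ := fun x z => 4 * (u x z * B x z) + q ((z - x) / 2) * (-1 + u x z) * W x z
    with hT₂
  have cT₁ : Continuous fun v : ℝ × ℝ => T₁ v.1 v.2 := by simp only [hT₁]; fun_prop
  have cT₂ : Continuous fun v : ℝ × ℝ => T₂ v.1 v.2 := by simp only [hT₂]; fun_prop
  have hus := hu.swap hq he
  have hTs : ∀ x z, T₂ x z = T₁ z x := by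
    intro x z
    simp only [hT₁, hT₂]
    rw [hus x z, hWs x z, hBs x z, show (x - z) / 2 = -((z - x) / 2) by ring, he]
    ring
  have lhs : ∀ x z, (∫ x' in (0 : ℝ)..x, ∫ z' in (0 : ℝ)..z, F x' z') * B x z
      = -4 * (u x z * B x z) := by
    intro x z
    rw [hu.eq_integral hq he x z]
    ring
  simp only [lhs, ← hW] at dual
  have cuB : Continuous fun v : ℝ × ℝ => -4 * (u v.1 v.2 * B v.1 v.2) := by fun_prop
  have inner : ∀ x ∈ uIcc 0 Z, (∫ z in (0 : ℝ)..Z, F x z * W x z)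
      = (∫ z in (0 : ℝ)..x, T₂ x z) + (∫ z in x..Z, T₁ x z)
        + ∫ z in (0 : ℝ)..Z, -4 * (u x z * B x z) := by
    intro x hx
    rw [uIcc_of_le hZ] at hx
    have i1 : ∀ a b, IntervalIntegrable (T₁ x) volume a b := fun a b =>
      (continuous_slice_fst cT₁ x).intervalIntegrable a b
    have i2 : ∀ a b, IntervalIntegrable (T₂ x) volume a b := fun a b =>
      (continuous_slice_fst cT₂ x).intervalIntegrable a b
    have i3 : ∀ a b, IntervalIntegrable (fun z => -4 * (u x z * B x z)) volume a b := fun a b =>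
      (continuous_slice_fst (F := fun x z => -4 * (u x z * B x z)) cuB x).intervalIntegrable a b
    have hi : ∀ a b, IntervalIntegrable (fun z => F x z * W x z) volume a b := fun a b =>
      (hFi x a b).mul_continuousOn (continuous_slice_fst hWc x).continuousOn
    rw [← intervalIntegral.integral_add_adjacent_intervals (hi 0 x) (hi x Z),
      ← intervalIntegral.integral_add_adjacent_intervals (i3 0 x) (i3 x Z)]
    have l1 : ∫ z in (0 : ℝ)..x, F x z * W x z
        = ∫ z in (0 : ℝ)..x, (T₂ x z + -4 * (u x z * B x z)) := by
      refine intervalIntegral.integral_congr fun z hz => ?_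
      rw [uIcc_of_le hx.1] at hz
      have : ¬ 0 < (z - x) / 2 := by linarith [hz.2]
      simp only [hF, hT₂, sgn, this, if_false]
      ring
    have l2 : ∫ z in x..Z, F x z * W x z
        = ∫ z in x..Z, (T₁ x z + -4 * (u x z * B x z)) := by
      rw [intervalIntegral.integral_of_le hx.2, intervalIntegral.integral_of_le hx.2]
      refine setIntegral_congr_fun measurableSet_Ioc fun z hz => ?_
      have : 0 < (z - x) / 2 := by linarith [hz.1]
      simp only [hF, hT₁, sgn, this, if_true]
      ring
    rw [l1, l2, intervalIntegral.integral_add (i2 _ _) (i3 _ _),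
      intervalIntegral.integral_add (i1 _ _) (i3 _ _)]
    ring
  have k1 := continuous_integral_between (F := T₁) cT₁ (a := fun x => x)
    continuous_id (b := fun _ => Z) continuous_const
  have k2 : Continuous fun x => ∫ z in (0 : ℝ)..x, T₂ x z := by fun_prop
  have k3 := continuous_slice_integral (F := fun x z => -4 * (u x z * B x z)) cuB 0 Z
  have k12 : Continuous fun x => (∫ z in (0 : ℝ)..x, T₂ x z) + ∫ z in x..Z, T₁ x z := k2.add k1
  rw [intervalIntegral.integral_congr inner, intervalIntegral.integral_add
    (k12.intervalIntegrable _ _) (k3.intervalIntegrable _ _),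
    intervalIntegral.integral_add (k2.intervalIntegrable _ _) (k1.intervalIntegrable _ _),
    integral_triangle_swap_of_continuous hZ cT₂] at dual
  simp only [hTs] at dual
  have hzero : ∫ x in (0 : ℝ)..Z, ∫ z in x..Z, T₁ x z = 0 := by linarith
  have cB := continuous_integral_between (F := fun x z => 4 * B x z)
    (by fun_prop) (a := fun x => x)
    continuous_id (b := fun _ => Z) continuous_const
  have e : ∀ x, ∫ z in x..Z, (1 + u x z) * H x z
      = (∫ z in x..Z, 4 * B x z) + ∫ z in x..Z, T₁ x z := by
    intro x
    have := continuous_slice_fst hB x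
    rw [← intervalIntegral.integral_add (Continuous.intervalIntegrable (by fun_prop) _ _)
      ((continuous_slice_fst cT₁ x).intervalIntegrable _ _)]
    refine intervalIntegral.integral_congr fun z _ => ?_
    simp only [hT₁, ← hH]
    ring
  simp only [e]
  rw [intervalIntegral.integral_add (cB.intervalIntegrable _ _) (k1.intervalIntegrable _ _), hzero]
  simp only [intervalIntegral.integral_const_mul]
  ring

end Duality

lemma HasCharDerivs.add {W P Q B W' P' Q' B' : ℝ → ℝ → ℝ} (h : HasCharDerivs W P Q B)
    (h' : HasCharDerivs W' P' Q' B') :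
    HasCharDerivs (fun x z => W x z + W' x z) (fun x z => P x z + P' x z)
      (fun x z => Q x z + Q' x z) (fun x z => B x z + B' x z) := by
  obtain ⟨Px, hP⟩ := h.second_fst
  obtain ⟨Qz, hQ⟩ := h.second_snd
  obtain ⟨Px', hP'⟩ := h'.second_fst
  obtain ⟨Qz', hQ'⟩ := h'.second_snd
  exact ⟨h.first.add h'.first, ⟨_, hP.add hP'⟩, ⟨_, hQ.add hQ'⟩⟩

/-- Odd test functions: for `a`, `b` supported below `Z`, the solution of
`4 Wₓ_z + q W = a(x) b(z) - b(x) a(z)` that vanishes beyond `Z` is odd under `x ↔ z`, hence zero at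
`y = 0`. -/
lemma exists_odd_goursat {q : ℝ → ℝ} (hq : Continuous q) (he : ∀ w, q (-w) = q w) {a b : ℝ → ℝ}
    (ha : ContDiff ℝ 1 a) (hb : ContDiff ℝ 1 b) {Z : ℝ} (aZ : ∀ x, Z ≤ x → a x = 0)
    (bZ : ∀ x, Z ≤ x → b x = 0) :
    ∃ W P Q B, HasCharDerivs W P Q B ∧
      (∀ x z, 4 * B x z + q ((z - x) / 2) * W x z = a x * b z - b x * a z) ∧
      (∀ x z, Z ≤ x → W x z = 0) ∧ (∀ x z, Z ≤ z → W x z = 0) ∧ (∀ x z, W z x = -W x z) ∧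
      (∀ x z, B z x = -B x z) ∧ (∀ x z, W x z = ∫ x' in x..Z, ∫ z' in z..Z, B x' z') ∧
      (∀ t, Q t t - P t t = 2 * ∫ z in t..Z, B t z) := by
  have hg := ((hasCharDerivs_primitive_mul ha hb Z Z).const_mul (1 / 4)).add
    ((hasCharDerivs_primitive_mul hb ha Z Z).const_mul (-(1 / 4)))
  obtain ⟨W, P, Q, B, hW, hB, eW, -, hWx, hWz⟩ := exists_goursat hq hg Z Z
  have prim : ∀ {c : ℝ → ℝ}, (∀ x, Z ≤ x → c x = 0) → ∀ x, Z ≤ x → ∫ t in Z..x, c t = 0 := by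
    intro c hc x hx
    rw [intervalIntegral.integral_congr (g := fun _ => (0 : ℝ))]
    · simp
    · intro t ht
      rw [uIcc_of_le hx] at ht
      exact hc t ht.1
  have hx := hWx fun x z h => by simp [prim aZ x h, prim bZ x h]
  have hz := hWz fun x z h => by simp [prim aZ z h, prim bZ z h]
  have hWc := hW.first.continuous
  have hodd : ∀ x z, W z x = -W x z := by
    intro X Y
    have hWc' : Continuous fun v : ℝ × ℝ => W v.2 v.1 := hWc.comp continuous_swap
    have h0 := volterra_unique (κ := fun x z => -(1 / 4) * q ((z - x) / 2))
      (f := fun x z => W x z + W z x) (x₀ := Z) (z₀ := Z) (X := X) (Z := Y) (by fun_prop)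
      (hWc.add hWc') (fun x _ z _ => ?_) X right_mem_uIcc Y right_mem_uIcc
    · linarith
    have c1 : Continuous fun v : ℝ × ℝ => -(1 / 4) * q ((v.2 - v.1) / 2) * W v.1 v.2 := by
      fun_prop
    have c2 : Continuous fun v : ℝ × ℝ => -(-(1 / 4) * q ((v.1 - v.2) / 2) * W v.2 v.1) := by
      fun_prop
    have e2 := integral_integral_sub
      (F := fun x' z' => -(1 / 4) * q ((z' - x') / 2) * W x' z')
      (G := fun x' z' => -(-(1 / 4) * q ((x' - z') / 2) * W z' x')) c1 c2 Z x Z z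
    have e3 := integral_swap_of_continuous
      (F := fun x' z' => -(-(1 / 4) * q ((x' - z') / 2) * W z' x')) c2 Z x Z z
    have e1 : ∀ x' z', -(1 / 4) * q ((z' - x') / 2) * (W x' z' + W z' x')
        = -(1 / 4) * q ((z' - x') / 2) * W x' z'
          - -(-(1 / 4) * q ((x' - z') / 2) * W z' x') := by
      intro x' z'
      rw [show (x' - z') / 2 = -((z' - x') / 2) by ring, he]
      ring
    simp only [e1]
    rw [e2, e3, eW x z, eW z x]
    simp only [intervalIntegral.integral_neg]
    ring
  have hBs : ∀ x z, B z x = -B x z := by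
    intro x z
    have h1 := hB x z
    have h2 := hB z x
    rw [show (x - z) / 2 = -((z - x) / 2) by ring, he, hodd x z] at h2
    linarith
  obtain ⟨Px, hP⟩ := hW.second_fst
  obtain ⟨Qz, hQ⟩ := hW.second_snd
  have hPZ : ∀ x, P x Z = 0 := fun x =>
    (hW.first.fst x Z).unique <| by
      simpa only [fun x => hz x Z le_rfl] using! hasDerivAt_const x (0 : ℝ)
  have hQZ : ∀ z, Q Z z = 0 := fun z =>
    (hW.first.snd Z z).unique <| by
      simpa only [fun z => hx Z z le_rfl] using! hasDerivAt_const z (0 : ℝ)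
  have hBc : Continuous fun v : ℝ × ℝ => B v.1 v.2 := hP.cont_snd
  have hPB : ∀ x z, P x z = -∫ z' in z..Z, B x z' := by
    intro x z
    rw [intervalIntegral.integral_eq_sub_of_hasDerivAt (fun z' _ => hP.snd x z')
      ((continuous_slice_fst hBc x).intervalIntegrable _ _), hPZ]
    ring
  have hWP : ∀ x z, W x z = -∫ x' in x..Z, P x' z := by
    intro x z
    rw [intervalIntegral.integral_eq_sub_of_hasDerivAt (fun x' _ => hW.first.fst x' z)
      ((hW.first.cont_fst.comp (f := fun x => (x, z)) (by fun_prop)).intervalIntegrable _ _),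
      hx Z z le_rfl]
    ring
  refine ⟨W, P, Q, B, hW, fun x z => ?_, hx, hz, hodd, hBs, fun x z => ?_, fun t => ?_⟩
  · rw [hB]
    ring
  · rw [hWP]
    simp only [hPB, intervalIntegral.integral_neg, neg_neg]
  · have hQP : Q t t = -P t t := by
      refine (hW.first.snd t t).unique ?_
      have := (hW.first.fst t t).neg
      simpa only [Pi.neg_def, ← hodd] using! this
    rw [hQP, hPB]
    ring

/-- The zero-order wave is `(1 + u) / √σ` behind the front and zero ahead of it. -/
theorem IsZeroOrderWave.eq_profile {ρ : ℝ} {n₀ s : ℝ → ℝ} {ξ : Plane} {U u : ℝ → ℝ → ℝ}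
    (hρ : 0 < ρ) (hpos : ∀ y, 0 ≤ y → 0 < n₀ y) (hs : IsAmplitude ρ n₀ s)
    (hq : Continuous (potential n₀ s (‖ξ‖ ^ 2))) (hu : IsStepProfile (potential n₀ s (‖ξ‖ ^ 2)) u)
    (hU : IsZeroOrderWave ρ n₀ ξ U) {y t : ℝ} (hy : 0 < y) (ht : 0 < t) (hne : t ≠ y) :
    s y * U y t = if y < t then 1 + u (t - y) (t + y) else 0 := by
  set q := potential n₀ s (‖ξ‖ ^ 2) with hqdef
  have he : ∀ w, q (-w) = q w := potential_neg n₀ s _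
  set x₀ := t - y with hx₀
  set z₀ := t + y with hz₀
  have hx₀ne : 0 < |x₀| := abs_pos.2 (sub_ne_zero.2 hne)
  set ε := min (min y t) |x₀| with hε
  have hε0 : 0 < ε := lt_min (lt_min hy ht) hx₀ne
  have hε1 : ε ≤ y := (min_le_left _ _).trans (min_le_left _ _)
  have hε2 : ε ≤ t := (min_le_left _ _).trans (min_le_right _ _)
  have hε3 : ε ≤ |x₀| := min_le_right _ _
  have ey : y = (z₀ - x₀) / 2 := by rw [hz₀, hx₀]; ring
  have et : t = (z₀ + x₀) / 2 := by rw [hz₀, hx₀]; ring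
  have hsc := hs.contDiff.continuous
  have hF1 : ContinuousOn (fun v : ℝ × ℝ => s v.1 * U v.1 v.2)
      {v | |v.2 - v.1 - x₀| < ε ∧ |v.2 + v.1 - z₀| < ε} := by
    refine (hsc.comp continuous_fst).continuousOn.mul (hU.continuousOn.mono fun v hv => ?_)
    change 0 < v.1 ∧ v.2 ≠ v.1
    simp only [mem_ofPred_eq, abs_lt] at hv
    refine ⟨by linarith [hv.1.2, hv.2.1], fun h => ?_⟩
    rw [h, sub_self, zero_sub] at hv
    exact absurd hε3 (not_le.2 (abs_lt.2 ⟨by linarith [hv.1.2], by linarith [hv.1.1]⟩))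
  have hcu := hu.cont
  have hF2 : ContinuousOn (fun v : ℝ × ℝ => if v.1 < v.2 then 1 + u (v.2 - v.1) (v.2 + v.1) else 0)
      {v | |v.2 - v.1 - x₀| < ε ∧ |v.2 + v.1 - z₀| < ε} := by
    rcases lt_or_gt_of_ne hne with h | h
    · refine (continuousOn_const (c := (0 : ℝ))).congr fun v hv => ?_
      simp only [mem_ofPred_eq, abs_lt] at hv
      rw [abs_of_neg (by linarith)] at hε3
      simp only [if_neg (show ¬ v.1 < v.2 by linarith [hv.1.2])]
    · refine (Continuous.continuousOn (f := fun v : ℝ × ℝ => 1 + u (v.2 - v.1) (v.2 + v.1))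
        (continuous_const.add (hcu.comp (f := fun v : ℝ × ℝ => (v.2 - v.1, v.2 + v.1))
          (by fun_prop)))).congr fun v hv => ?_
      simp only [mem_ofPred_eq, abs_lt] at hv
      rw [abs_of_pos (by linarith)] at hε3
      simp only [if_pos (show v.1 < v.2 by linarith [hv.1.1])]
  have := eq_of_integral_bump_eq hε0 hF1 hF2 fun a b ha hb ha0 hb0 => ?_
  · rwa [← ey, ← et] at this
  set Z := |x₀| + |z₀| + ε with hZ
  have hx1 := abs_le.1 (le_refl |x₀|)
  have hz1 := abs_le.1 (le_refl |z₀|)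
  have hZ0 : 0 ≤ Z := by positivity
  have aZ : ∀ x, Z ≤ x → a x = 0 := fun x hx => ha0 x (by rw [abs_of_nonneg] <;> linarith)
  have bZ : ∀ x, Z ≤ x → b x = 0 := fun x hx => hb0 x (by rw [abs_of_nonneg] <;> linarith)
  have b0 : ∀ z, z ≤ x₀ + y → b z = 0 := fun z hz => hb0 z (by rw [abs_of_nonpos] <;> linarith)
  have a0 : ∀ x, x₀ + y ≤ x → a x = 0 := fun x hx => ha0 x (by rw [abs_of_nonneg] <;> linarith)
  -- above the diagonal `z = x` only the first term of `a(x) b(z) - b(x) a(z)` is present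
  have hba : ∀ x z, x < z → b x * a z = 0 := by
    intro x z h
    rcases le_total x (x₀ + y) with h1 | h1
    · rw [b0 x h1, zero_mul]
    · rw [a0 z (by linarith), mul_zero]
  obtain ⟨W, P, Q, B, hW, hB, hWx, hWz, hodd, hBs, hWB, hQP⟩ := exists_odd_goursat hq he ha hb aZ bZ
  have hBc : Continuous fun v : ℝ × ℝ => B v.1 v.2 := by
    obtain ⟨Px, hP⟩ := hW.second_fst
    exact hP.cont_snd
  have can := hU.canonical hρ hpos hs hW (fun t => by linarith [hodd t t]) hWx hWz
  have e1 : ∫ v : ℝ × ℝ, s v.1 * U v.1 v.2 * (a (v.2 - v.1) * b (v.2 + v.1))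
      = 2 * ∫ x in (0 : ℝ)..Z, ∫ z in x..Z, B x z := by
    have l1 : ∫ v : ℝ × ℝ, s v.1 * U v.1 v.2 * (a (v.2 - v.1) * b (v.2 + v.1))
        = ∫ t in Ioi (0 : ℝ), (Q t t - P t t) := by
      rw [← can, ← setIntegral_eq_integral_of_forall_compl_eq_zero
        (s := Ioi (0 : ℝ) ×ˢ Ioi (0 : ℝ))]
      · refine setIntegral_congr_fun (measurableSet_Ioi.prod measurableSet_Ioi) fun v hv => ?_
        have := hB (v.2 - v.1) (v.2 + v.1)
        rw [show (v.2 + v.1 - (v.2 - v.1)) / 2 = v.1 by ring,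
          hba _ _ (by linarith [mem_Ioi.1 hv.1]), sub_zero] at this
        simp only [← hqdef]
        rw [this]
      · intro v hv
        by_cases h1 : v.2 + v.1 ≤ x₀ + y
        · rw [b0 _ h1, mul_zero, mul_zero]
        by_cases h2 : x₀ + ε / 2 ≤ v.2 - v.1
        · rw [ha0 _ (by rw [abs_of_nonneg] <;> linarith), zero_mul, mul_zero]
        by_cases h3 : v.2 - v.1 ≤ x₀ - ε / 2
        · rw [ha0 _ (by rw [abs_of_nonpos] <;> linarith), zero_mul, mul_zero]
        by_cases h4 : v.2 + v.1 ≤ z₀ - ε / 2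
        · rw [hb0 _ (by rw [abs_of_nonpos] <;> linarith), mul_zero, mul_zero]
        exact absurd (show v ∈ Ioi (0 : ℝ) ×ˢ Ioi (0 : ℝ) from
          ⟨by change 0 < v.1; linarith, by change 0 < v.2; linarith⟩) hv
    rw [l1]
    simp only [hQP]
    rw [integral_const_mul, intervalIntegral.integral_of_le hZ0]
    congr 1
    refine setIntegral_eq_of_subset_of_forall_sdiff_eq_zero measurableSet_Ioi
      Ioc_subset_Ioi_self fun x hx => ?_
    have hxZ : Z ≤ x := le_of_not_ge fun h => hx.2 ⟨hx.1, h⟩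
    rw [intervalIntegral.integral_congr (g := fun _ => (0 : ℝ))]
    · simp
    · intro z hz
      rw [uIcc_of_ge hxZ] at hz
      have := hB x z
      rw [hWx x z hxZ, aZ x hxZ, bZ x hxZ] at this
      simp only
      linarith
  have hcc := bump_mul_continuous (half_lt_self hε0) hF2 ha.continuous hb.continuous ha0 hb0
  rw [e1, integral_char_coords hcc.1 hcc.2,
    hu.integral_triangle_eq hq he hZ0 hBc hW.first.continuous hWB hodd hBs hB]
  congr 1
  have e2 : ∀ x z : ℝ, (if (z - x) / 2 < (z + x) / 2 then
      1 + u ((z + x) / 2 - (z - x) / 2) ((z + x) / 2 + (z - x) / 2) else 0)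
        * (a ((z + x) / 2 - (z - x) / 2) * b ((z + x) / 2 + (z - x) / 2))
      = if 0 < x then (1 + u x z) * (a x * b z) else 0 := by
    intro x z
    rw [show (z + x) / 2 - (z - x) / 2 = x by ring, show (z + x) / 2 + (z - x) / 2 = z by ring]
    by_cases h : 0 < x
    · rw [if_pos h, if_pos (by linarith)]
    · rw [if_neg h, if_neg (by linarith), zero_mul]
  simp only [e2]
  rw [integral_eq_intervalIntegral (a := 0) (b := Z)]
  · rw [intervalIntegral.integral_of_le hZ0, intervalIntegral.integral_of_le hZ0]
    refine setIntegral_congr_fun measurableSet_Ioc fun x hx => ?_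
    simp only [if_pos hx.1]
    have hab : ∀ z, z ≤ x → a x * b z = 0 := by
      intro z h
      rcases le_total z (x₀ + y) with h1 | h1
      · rw [b0 z h1, mul_zero]
      · rw [a0 x (by linarith), zero_mul]
    rw [integral_eq_intervalIntegral (a := x) (b := Z), intervalIntegral.integral_of_le hx.2,
      intervalIntegral.integral_of_le hx.2]
    · refine setIntegral_congr_fun measurableSet_Ioc fun z hz => ?_
      simp only [hba x z hz.1, sub_zero]
    · exact fun z hz => by rw [hab z hz, mul_zero]
    · exact fun z hz => by rw [bZ z hz, mul_zero, mul_zero]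
  · intro x hx
    simp [not_lt.2 hx]
  · intro x hx
    simp [aZ x hx]

/-! ### Backward solutions and the first-order wave -/

section Backward

variable {q : ℝ → ℝ} {R : ℝ → ℝ → ℝ → ℝ} {Ψ : ℝ → ℝ} {Z : ℝ}

/-- The kernel by which data on the front `t = y` at depth `Y` act on the backward solution at
`y = η`, `t = τ`: the derivative `∂R/∂p` of the Riemann function with vertex `(η, 0)`, at the point
`(Y, Y - τ)`. -/
noncomputable def frontKernel (q : ℝ → ℝ) (R : ℝ → ℝ → ℝ → ℝ) (η τ Y : ℝ) : ℝ :=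
  riemannDeriv q R η (Y - (η + τ) / 2) ((τ - η) / 2)

lemma IsRiemann.continuous_frontKernel (hq : Continuous q) (hR : IsRiemann q R) :
    Continuous fun v : ℝ × ℝ × ℝ => frontKernel q R v.1 v.2.1 v.2.2 :=
  (hR.continuous_deriv hq).comp (f := fun v : ℝ × ℝ × ℝ =>
    (v.1, v.2.2 - (v.1 + v.2.1) / 2, (v.2.1 - v.1) / 2)) (by fun_prop)

lemma hasCharDerivs_comp_snd (hΨ : ContDiff ℝ 2 Ψ) :
    HasCharDerivs (fun _ z => Ψ (z / 2)) (fun _ _ => 0) (fun _ z => 1 / 2 * deriv Ψ (z / 2))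
      (fun _ _ => 0) := by
  have h1 : ContDiff ℝ 1 (deriv Ψ) := by
    rw [show (2 : WithTop ℕ∞) = 1 + 1 by norm_num, contDiff_succ_iff_deriv] at hΨ
    exact hΨ.2.2
  have c1 := h1.continuous
  have c2 := h1.continuous_deriv le_rfl
  have hz : ∀ z : ℝ, HasDerivAt (fun z : ℝ => z / 2) (1 / 2) z := fun z =>
    (hasDerivAt_id z).div_const 2
  refine ⟨⟨fun x z => hasDerivAt_const _ _, fun x z => ?_, continuous_const, by fun_prop⟩,
    ⟨fun _ _ => 0, fun x z => hasDerivAt_const _ _, fun x z => hasDerivAt_const _ _,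
      continuous_const, continuous_const⟩,
    ⟨fun _ z => 1 / 2 * (deriv (deriv Ψ) (z / 2) * (1 / 2)), fun x z => hasDerivAt_const _ _,
      fun x z => ?_, continuous_const, by fun_prop⟩⟩
  · refine ((hΨ.differentiable (by norm_num) (z / 2)).hasDerivAt.comp z (hz z)).congr_deriv ?_
    ring
  · exact ((h1.differentiable (by norm_num) (z / 2)).hasDerivAt.comp z (hz z)).const_mul _

/-- The solution of the homogeneous equation with values `Ψ` on the front `t = y` that vanishes for
`t + y ≥ 2Z`, and its representation by the Riemann function. -/
lemma exists_backward_goursat (hq : Continuous q) (hR : IsRiemann q R) (hΨ : ContDiff ℝ 2 Ψ)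
    (hZ : ∀ y, Z ≤ y → Ψ y = 0) :
    ∃ W P Q B, HasCharDerivs W P Q B ∧ (∀ x z, 4 * B x z + q ((z - x) / 2) * W x z = 0) ∧
      (∀ x z, 2 * Z ≤ z → W x z = 0) ∧ (∀ z, W 0 z = Ψ (z / 2)) ∧
      (∀ y t, y ≤ t → (t + y) / 2 ≤ Z → W (t - y) (t + y)
        = Ψ ((t + y) / 2) + ∫ Y in ((t + y) / 2)..Z, Ψ Y * frontKernel q R y t Y) := by
  obtain ⟨W, P, Q, B, hW, hB, eW, -, -, hz⟩ :=
    exists_goursat hq (hasCharDerivs_comp_snd hΨ) 0 (2 * Z)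
  refine ⟨W, P, Q, B, hW, fun x z => by simpa using hB x z,
    hz fun x z h => hZ _ (by linarith), fun z => by rw [eW]; simp, fun y t hyt hζ => ?_⟩
  set ζ := (t + y) / 2 with hζdef
  set m := (t - y) / 2 with hm
  have hm0 : 0 ≤ m := by rw [hm]; linarith
  have hWc := hW.first.continuous
  set w : ℝ → ℝ → ℝ := fun p m' => W (2 * m - 2 * m') (2 * ζ + 2 * p) with hw
  have hwc : Continuous fun v : ℝ × ℝ => w v.1 v.2 :=
    hWc.comp (f := fun v : ℝ × ℝ => (2 * m - 2 * v.2, 2 * ζ + 2 * v.1)) (by fun_prop)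
  set κ : ℝ → ℝ → ℝ := fun p m' => q (y + p + m') with hκ
  have hκc : Continuous fun v : ℝ × ℝ => κ v.1 v.2 := by simp only [hκ]; fun_prop
  have hΨc := hΨ.continuous
  have ew : ∀ p m', w p m' = Ψ (ζ + p)
      + ∫ p' in p..(Z - ζ), ∫ m'' in m'..m, κ p' m'' * w p' m'' := by
    intro p m'
    have hc : Continuous fun v : ℝ × ℝ => κ v.2 v.1 * w v.2 v.1 :=
      (hκc.comp continuous_swap).mul (hwc.comp continuous_swap)
    simp only [hw]
    rw [eW, ← integral_swap_of_continuous (F := fun m'' p' => κ p' m'' * w p' m'') hc,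
      show (2 * ζ + 2 * p) / 2 = ζ + p by ring]
    congr 1
    have l1 := integral_affine_sub (fun x' => ∫ z' in (2 * Z)..(2 * ζ + 2 * p),
      -(1 / 4) * q ((z' - x') / 2) * W x' z') (2 * m) m' m
    rw [sub_self] at l1
    rw [l1, ← intervalIntegral.integral_const_mul]
    refine intervalIntegral.integral_congr fun m'' _ => ?_
    have l2 := integral_affine_add (fun z' => -(1 / 4) * q ((z' - (2 * m - 2 * m'')) / 2)
      * W (2 * m - 2 * m'') z') (2 * ζ) (Z - ζ) p
    rw [show 2 * ζ + 2 * (Z - ζ) = 2 * Z by ring] at l2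
    rw [l2, intervalIntegral.integral_symm p (Z - ζ)]
    have : ∀ p', -(1 / 4) * q ((2 * ζ + 2 * p' - (2 * m - 2 * m'')) / 2)
        * W (2 * m - 2 * m'') (2 * ζ + 2 * p') = -(1 / 4) * (κ p' m'' * w p' m'') := by
      intro p'
      simp only [hκ, hw]
      rw [show (2 * ζ + 2 * p' - (2 * m - 2 * m'')) / 2 = y + p' + m'' by rw [hζdef, hm]; ring]
      ring
    simp only [this, intervalIntegral.integral_const_mul]
    ring
  have key := volterra_resolvent (g := fun p _ => Ψ (ζ + p)) (sub_nonneg.2 hζ) hm0 hκc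
    (hR.cont_slice y) hwc (by fun_prop) (fun p m => hR.eq y p m) ew
  have e0 : w 0 0 = W (t - y) (t + y) := by
    simp only [hw]
    congr 1 <;> linarith
  rw [← e0, key, add_zero]
  congr 1
  have shift := intervalIntegral.integral_comp_add_left (a := 0) (b := Z - ζ)
    (fun Y => Ψ Y * frontKernel q R y t Y) ζ
  rw [add_zero, add_sub_cancel] at shift
  rw [← shift]
  refine intervalIntegral.integral_congr fun p _ => ?_
  simp only [frontKernel, riemannDeriv]
  rw [show ζ + p - (y + t) / 2 = p by rw [hζdef]; ring, ← hm,
    intervalIntegral.integral_mul_const, mul_comm]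

/-- Integrals of the backward solution over a vertical segment, in terms of its values on the
front. -/
lemma integral_backward {W : ℝ → ℝ → ℝ} (hq : Continuous q) (hR : IsRiemann q R)
    (hΨ : Continuous Ψ) {y : ℝ} (hy : y ≤ Z)
    (hW : ∀ t, y ≤ t → (t + y) / 2 ≤ Z → W (t - y) (t + y)
        = Ψ ((t + y) / 2) + ∫ Y in ((t + y) / 2)..Z, Ψ Y * frontKernel q R y t Y)
    {f : ℝ → ℝ} (hf : Continuous f) :
    ∫ t in y..(2 * Z - y), f t * W (t - y) (t + y) = ∫ Y in y..Z, Ψ Y * (2 * f (2 * Y - y)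
      + ∫ t in y..(2 * Y - y), f t * frontKernel q R y t Y) := by
  have hK := hR.continuous_frontKernel hq
  have hK1 : Continuous fun v : ℝ × ℝ => frontKernel q R y (-y + 2 * v.1) v.2 :=
    hK.comp (f := fun v : ℝ × ℝ => (y, -y + 2 * v.1, v.2)) (by fun_prop)
  have sub : ∀ (F : ℝ → ℝ) (b : ℝ), ∫ t in y..(2 * b - y), F t
      = 2 * ∫ ζ in y..b, F (-y + 2 * ζ) := by
    intro F b
    have := integral_affine_add F (-y) y b
    rwa [show -y + 2 * y = y by ring, show -y + 2 * b = 2 * b - y by ring] at this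
  set M : ℝ → ℝ → ℝ := fun ζ Y => f (-y + 2 * ζ) * (Ψ Y * frontKernel q R y (-y + 2 * ζ) Y) with hM
  have cM : Continuous fun v : ℝ × ℝ => M v.1 v.2 := by
    simp only [hM]
    fun_prop
  have e1 : ∫ ζ in y..Z, f (-y + 2 * ζ) * W (-y + 2 * ζ - y) (-y + 2 * ζ + y)
      = ∫ ζ in y..Z, (f (-y + 2 * ζ) * Ψ ζ + ∫ Y in ζ..Z, M ζ Y) := by
    refine intervalIntegral.integral_congr fun ζ hζ => ?_
    rw [uIcc_of_le hy] at hζ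
    have eζ : (-y + 2 * ζ + y) / 2 = ζ := by ring
    have := hW (-y + 2 * ζ) (by linarith [hζ.1]) (by rw [eζ]; exact hζ.2)
    rw [eζ] at this
    simp only [this, hM, intervalIntegral.integral_const_mul]
    ring
  have i1 : Continuous fun ζ => f (-y + 2 * ζ) * Ψ ζ := by fun_prop
  have i2 := continuous_integral_between (F := M) cM (a := fun x => x)
    continuous_id (b := fun _ => Z) continuous_const
  have cM' : Continuous fun v : ℝ × ℝ => M v.2 v.1 := cM.comp continuous_swap
  have swap := integral_triangle_swap_of_continuous (F := fun Y ζ => M ζ Y) hy cM'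
  have i3 : Continuous fun Y => ∫ ζ in y..Y, M ζ Y := by fun_prop
  rw [sub, e1, intervalIntegral.integral_add (i1.intervalIntegrable _ _)
    (i2.intervalIntegrable _ _), ← swap, ← intervalIntegral.integral_add
    (i1.intervalIntegrable _ _) (i3.intervalIntegrable _ _), ← intervalIntegral.integral_const_mul]
  refine intervalIntegral.integral_congr fun Y _ => ?_
  rw [sub, show 2 * Y - y = -y + 2 * Y by ring]
  have e2 : ∀ ζ, M ζ Y = Ψ Y * (f (-y + 2 * ζ) * frontKernel q R y (-y + 2 * ζ) Y) := fun ζ => by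
    simp only [hM]; ring
  simp only [e2, intervalIntegral.integral_const_mul]
  ring

end Backward

/-- The time derivatives of a `C²` function given in characteristic variables. -/
lemma HasCharDerivs.time {W P Q B : ℝ → ℝ → ℝ} (h : HasCharDerivs W P Q B) :
    ∃ Wt Wtt : ℝ → ℝ → ℝ,
      (∀ y t, HasDerivAt (fun t => W (t - y) (t + y)) (Wt y t) t) ∧
      (∀ y t, HasDerivAt (fun t => Wt y t) (Wtt y t) t) ∧
      (Continuous fun v : ℝ × ℝ => Wt v.1 v.2) ∧ Continuous fun v : ℝ × ℝ => Wtt v.1 v.2 := by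
  obtain ⟨Px, hP⟩ := h.second_fst
  obtain ⟨Qz, hQ⟩ := h.second_snd
  have hPQ := hP.add hQ
  have time : ∀ {f fx fz : ℝ → ℝ → ℝ}, HasPartials f fx fz → ∀ y t : ℝ,
      HasDerivAt (fun t => f (t - y) (t + y)) (fx (t - y) (t + y) + fz (t - y) (t + y)) t := by
    intro f fx fz h y t
    simpa using h.comp_hasDerivAt ((hasDerivAt_id t).sub_const y) ((hasDerivAt_id t).add_const y)
  have c : ∀ {f : ℝ → ℝ → ℝ}, (Continuous fun v : ℝ × ℝ => f v.1 v.2) →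
      Continuous fun v : ℝ × ℝ => f (v.2 - v.1) (v.2 + v.1) := fun hf =>
    hf.comp (f := fun v : ℝ × ℝ => (v.2 - v.1, v.2 + v.1)) (by fun_prop)
  exact ⟨_, _, time h.first, time hPQ, (c h.first.cont_fst).add (c h.first.cont_snd),
    (c (f := fun x z => Px x z + B x z) hPQ.cont_fst).add
      (c (f := fun x z => B x z + Qz x z) hPQ.cont_snd)⟩

lemma deriv_eq_zero_of_forall_ge {f f' : ℝ → ℝ} {b : ℝ} (hf : ∀ t, HasDerivAt f (f' t) t)
    (h0 : ∀ t, b ≤ t → f t = 0) (t : ℝ) (ht : b ≤ t) : f' t = 0 := by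
  refine (uniqueDiffOn_Ici t t self_mem_Ici).eq_deriv _
    (hf t).hasDerivWithinAt ?_
  exact (hasDerivWithinAt_const t (Ici t) (0 : ℝ)).congr (fun τ hτ => h0 τ (ht.trans hτ)) (h0 t ht)

/-- A source `c(y) N_tt 1_{t > y}`, `N = 0` on the front, tested with `W` vanishing for
`t + y ≥ 2Z`: integrating by parts twice leaves the jump of `N_t` on the front. -/
lemma setIntegral_source {W P Q B Wt Wtt N Nt Ntt : ℝ → ℝ → ℝ} {c : ℝ → ℝ} {Z : ℝ} (hZ : 0 ≤ Z)
    (hW : HasCharDerivs W P Q B) (hz : ∀ x z, 2 * Z ≤ z → W x z = 0)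
    (h1 : ∀ y t, HasDerivAt (fun t => W (t - y) (t + y)) (Wt y t) t)
    (h2 : ∀ y t, HasDerivAt (fun t => Wt y t) (Wtt y t) t)
    (cWt : Continuous fun v : ℝ × ℝ => Wt v.1 v.2) (cWtt : Continuous fun v : ℝ × ℝ => Wtt v.1 v.2)
    (hc : Continuous c) (cN : Continuous fun v : ℝ × ℝ => N v.1 v.2)
    (cNt : Continuous fun v : ℝ × ℝ => Nt v.1 v.2)
    (cNtt : Continuous fun v : ℝ × ℝ => Ntt v.1 v.2)
    (dN : ∀ y t, HasDerivAt (fun t => N (t - y) (t + y)) (Nt (t - y) (t + y)) t)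
    (dNt : ∀ y t, 0 < t - y → 0 < t + y →
      HasDerivAt (fun t => Nt (t - y) (t + y)) (Ntt (t - y) (t + y)) t)
    (hN0 : ∀ z, N 0 z = 0) :
    ∫ v in Ioi (0 : ℝ) ×ˢ Ioi (0 : ℝ),
        (if v.1 < v.2 then c v.1 * N (v.2 - v.1) (v.2 + v.1) else 0) * Wtt v.1 v.2
      = (∫ y in (0 : ℝ)..Z, c y * Nt 0 (2 * y) * W 0 (2 * y))
        + ∫ y in (0 : ℝ)..Z, ∫ t in y..(2 * Z - y),
            c y * Ntt (t - y) (t + y) * W (t - y) (t + y) := by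
  have hWc := hW.first.continuous
  have comp : ∀ {f : ℝ → ℝ → ℝ}, (Continuous fun v : ℝ × ℝ => f v.1 v.2) →
      Continuous fun v : ℝ × ℝ => f (v.2 - v.1) (v.2 + v.1) := fun hf =>
    hf.comp (f := fun v : ℝ × ℝ => (v.2 - v.1, v.2 + v.1)) (by fun_prop)
  have hWt0 : ∀ y t, 2 * Z - y ≤ t → Wt y t = 0 := fun y =>
    deriv_eq_zero_of_forall_ge (h1 y) fun t ht => hz _ _ (by linarith)
  have hWtt0 : ∀ y t, 2 * Z - y ≤ t → Wtt y t = 0 := fun y =>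
    deriv_eq_zero_of_forall_ge (h2 y) (hWt0 y)
  set h : ℝ × ℝ → ℝ := fun v => c v.1 * N (v.2 - v.1) (v.2 + v.1) * Wtt v.1 v.2 with hh
  have ch : Continuous h := ((hc.comp continuous_fst).mul (comp cN)).mul cWtt
  have hm : MeasurableSet {v : ℝ × ℝ | v.1 < v.2} := measurableSet_lt measurable_fst measurable_snd
  have e1 : ∫ v in Ioi (0 : ℝ) ×ˢ Ioi (0 : ℝ),
        (if v.1 < v.2 then c v.1 * N (v.2 - v.1) (v.2 + v.1) else 0) * Wtt v.1 v.2
      = ∫ v in Ioc 0 Z ×ˢ Ioc 0 (2 * Z), {v : ℝ × ℝ | v.1 < v.2}.indicator h v := by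
    have e : ∀ v : ℝ × ℝ, (if v.1 < v.2 then c v.1 * N (v.2 - v.1) (v.2 + v.1) else 0)
        * Wtt v.1 v.2 = {v : ℝ × ℝ | v.1 < v.2}.indicator h v := by
      intro v
      simp only [indicator, mem_ofPred_eq, hh]
      split_ifs <;> simp
    simp only [e]
    refine setIntegral_eq_of_subset_of_forall_sdiff_eq_zero
      (measurableSet_Ioi.prod measurableSet_Ioi)
      (Set.prod_mono Ioc_subset_Ioi_self Ioc_subset_Ioi_self) fun v hv => ?_
    rw [indicator_apply_eq_zero]
    intro hlt
    have hlt' : v.1 < v.2 := hlt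
    have p1 : 0 < v.1 := hv.1.1
    have p2 : 0 < v.2 := hv.1.2
    simp only [hh]
    rw [hWtt0, mul_zero]
    by_contra hcon
    exact hv.2 ⟨⟨p1, by linarith⟩, ⟨p2, by linarith⟩⟩
  have hint : IntegrableOn ({v : ℝ × ℝ | v.1 < v.2}.indicator h) (Ioc 0 Z ×ˢ Ioc 0 (2 * Z)) :=
    ((ch.continuousOn.integrableOn_compact (isCompact_Icc.prod isCompact_Icc)).mono_set
      (Set.prod_mono Ioc_subset_Icc_self Ioc_subset_Icc_self)).indicator hm
  have i0 : Continuous fun y => c y * Nt 0 (2 * y) * W 0 (2 * y) := by fun_prop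
  have cNW : Continuous fun v : ℝ × ℝ =>
      c v.1 * Ntt (v.2 - v.1) (v.2 + v.1) * W (v.2 - v.1) (v.2 + v.1) :=
    ((hc.comp continuous_fst).mul (comp cNtt)).mul (comp hWc)
  have i1 := continuous_integral_between
    (F := fun y t => c y * Ntt (t - y) (t + y) * W (t - y) (t + y)) cNW (a := fun y => y)
    continuous_id
    (b := fun y => 2 * Z - y) (by fun_prop)
  rw [e1, Measure.volume_eq_prod, setIntegral_prod _ (by rwa [← Measure.volume_eq_prod]),
    ← intervalIntegral.integral_add (i0.intervalIntegrable _ _) (i1.intervalIntegrable _ _),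
    intervalIntegral.integral_of_le hZ]
  refine setIntegral_congr_fun measurableSet_Ioc fun y hy => ?_
  have hyZ : y ≤ 2 * Z - y := by linarith [hy.2]
  have e2 : ∫ t in Ioc 0 (2 * Z), {v : ℝ × ℝ | v.1 < v.2}.indicator h (y, t)
      = ∫ t in y..(2 * Z - y), h (y, t) := by
    rw [intervalIntegral.integral_of_le hyZ]
    have : ∀ t ∈ Ioc y (2 * Z - y), h (y, t) = {v : ℝ × ℝ | v.1 < v.2}.indicator h (y, t) :=
      fun t ht => (indicator_of_mem (s := {v : ℝ × ℝ | v.1 < v.2})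
        (show (y, t) ∈ {v : ℝ × ℝ | v.1 < v.2} from ht.1) h).symm
    rw [setIntegral_congr_fun measurableSet_Ioc this]
    refine setIntegral_eq_of_subset_of_forall_sdiff_eq_zero measurableSet_Ioc
      (Ioc_subset_Ioc hy.1.le (by linarith [hy.1])) fun t ht => ?_
    rw [indicator_apply_eq_zero]
    intro hlt
    have hlt' : y < t := hlt
    simp only [hh]
    rw [hWtt0 y t (le_of_not_ge fun hle => ht.2 ⟨hlt', hle⟩), mul_zero]
  rw [e2]
  -- The boundary terms at `t = 2Z - y` vanish, and so does `N` on the front; `Nₜ W` on the front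
  -- remains.
  have k : ∀ {f : ℝ → ℝ → ℝ}, (Continuous fun v : ℝ × ℝ => f v.1 v.2) →
      Continuous fun t => f (t - y) (t + y) := fun hf =>
    hf.comp (f := fun t => (t - y, t + y)) (by fun_prop)
  have b1 := intervalIntegral.integral_mul_deriv_eq_deriv_mul (a := y) (b := 2 * Z - y)
    (u := fun t => N (t - y) (t + y)) (v := fun t => Wt y t) (fun t _ => dN y t)
    (fun t _ => h2 y t) ((k cNt).intervalIntegrable _ _)
    ((continuous_slice_fst cWtt y).intervalIntegrable _ _)
  have b2 := intervalIntegral.integral_mul_deriv_eq_deriv_mul_of_hasDerivAt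
    (a := y) (b := 2 * Z - y)
    (u := fun t => Nt (t - y) (t + y)) (v := fun t => W (t - y) (t + y))
    (k cNt).continuousOn (k hWc).continuousOn
    (fun t ht => by
      rw [min_eq_left hyZ] at ht
      exact dNt y t (by linarith [ht.1]) (by linarith [ht.1, hy.1]))
    (fun t _ => h1 y t) ((k cNtt).intervalIntegrable _ _)
    ((continuous_slice_fst cWt y).intervalIntegrable _ _)
  simp only [sub_self, ← two_mul, hN0, hWt0 y (2 * Z - y) le_rfl, mul_zero, zero_mul, zero_sub,
    hz _ (2 * Z - y + y) (by linarith)] at b1 b2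
  simp only [hh, mul_assoc, intervalIntegral.integral_const_mul]
  rw [b1, b2]
  ring

lemma ae_fst_ne_snd : ∀ᵐ v : ℝ × ℝ, v.2 ≠ v.1 := by
  have hm : MeasurableSet {v : ℝ × ℝ | v.2 = v.1} :=
    measurableSet_eq_fun measurable_snd measurable_fst
  rw [ae_iff]
  simp only [not_not]
  rw [Measure.volume_eq_prod, Measure.measure_prod_null hm]
  refine Filter.Eventually.of_forall fun y => ?_
  simp

/-- The values on the front `t = y` of the source of the first-order wave, in terms of the response:
the identity obtained by testing the weak equation with all backward solutions. -/
theorem IsFirstOrderWave.front_identity {ρ : ℝ} {n₀ s : ℝ → ℝ} {nbar : ℝ → Plane}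
    {U₀ : ℝ → ℝ → Plane → ℝ} {ξ : Plane} {U : ℝ → ℝ → ℝ} {r r' c : ℝ → ℝ} {R : ℝ → ℝ → ℝ → ℝ}
    {N Nt Ntt : ℝ → ℝ → ℝ} (hρ : 0 < ρ) (hpos : ∀ y, 0 ≤ y → 0 < n₀ y)
    (hs : IsAmplitude ρ n₀ s) (hU : IsFirstOrderWave ρ n₀ nbar U₀ ξ U r)
    (hU₀ : ∀ ζ y t, 0 < y → t ≤ 0 → U₀ y t ζ = 0)
    (hq : Continuous (potential n₀ s (‖ξ‖ ^ 2))) (hR : IsRiemann (potential n₀ s (‖ξ‖ ^ 2)) R)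
    (hsource : ∀ y t, 0 < y → 0 < t → t ≠ y →
      s y * (inner ℝ (nbar y) (gradient (fun ζ => U₀ y t ζ) ξ) / n₀ y ^ 2)
        = if y < t then c y * N (t - y) (t + y) else 0)
    (hc : Continuous c) (hr' : Continuous r') (hrr' : ∀ t, 0 ≤ t → r t = r' t)
    (cN : Continuous fun v : ℝ × ℝ => N v.1 v.2)
    (cNt : Continuous fun v : ℝ × ℝ => Nt v.1 v.2)
    (cNtt : Continuous fun v : ℝ × ℝ => Ntt v.1 v.2)
    (dN : ∀ y t, HasDerivAt (fun t => N (t - y) (t + y)) (Nt (t - y) (t + y)) t)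
    (dNt : ∀ y t, 0 < t - y → 0 < t + y →
      HasDerivAt (fun t => Nt (t - y) (t + y)) (Ntt (t - y) (t + y)) t)
    (hN0 : ∀ z, N 0 z = 0) {y : ℝ} (hy : 0 < y) :
    c y * Nt 0 (2 * y) + ∫ η in (0 : ℝ)..y, (2 * (c η * Ntt (2 * y - η - η) (2 * y - η + η))
        + ∫ τ in η..(2 * y - η), c η * Ntt (τ - η) (τ + η)
            * frontKernel (potential n₀ s (‖ξ‖ ^ 2)) R η τ y)
      = s 0 / n₀ 0 * (2 * r' (2 * y) + ∫ τ in (0 : ℝ)..(2 * y), r' τ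
            * frontKernel (potential n₀ s (‖ξ‖ ^ 2)) R 0 τ y) := by
  set q := potential n₀ s (‖ξ‖ ^ 2) with hqdef
  have hK := hR.continuous_frontKernel hq
  set E : ℝ → ℝ → ℝ := fun η Y => 2 * (c η * Ntt (2 * Y - η - η) (2 * Y - η + η))
    + ∫ τ in η..(2 * Y - η), c η * Ntt (τ - η) (τ + η) * frontKernel q R η τ Y with hE
  set S : ℝ → ℝ := fun Y => 2 * r' (2 * Y) + ∫ τ in (0 : ℝ)..(2 * Y), r' τ
    * frontKernel q R 0 τ Y with hS
  have cE : Continuous fun v : ℝ × ℝ => E v.1 v.2 := by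
    refine Continuous.add (Continuous.mul continuous_const ((hc.comp continuous_fst).mul
      (cNtt.comp (f := fun v : ℝ × ℝ => (2 * v.2 - v.1 - v.1, 2 * v.2 - v.1 + v.1))
        (by fun_prop)))) ?_
    refine continuous_integral_between (F := fun (v : ℝ × ℝ) τ => c v.1 * Ntt (τ - v.1) (τ + v.1)
      * frontKernel q R v.1 τ v.2) ?_ (a := fun v => v.1) (by fun_prop)
      (b := fun v => 2 * v.2 - v.1) (by fun_prop)
    exact ((hc.comp (f := fun w : (ℝ × ℝ) × ℝ => w.1.1) (by fun_prop)).mul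
      (cNtt.comp (f := fun w : (ℝ × ℝ) × ℝ => (w.2 - w.1.1, w.2 + w.1.1)) (by fun_prop))).mul
      (hK.comp (f := fun w : (ℝ × ℝ) × ℝ => (w.1.1, w.2, w.1.2)) (by fun_prop))
  have cS : Continuous S := by
    refine Continuous.add (by fun_prop) ?_
    refine continuous_integral_between (F := fun Y τ => r' τ * frontKernel q R 0 τ Y) ?_
      (a := fun _ => 0) (by fun_prop) (b := fun Y => 2 * Y) (by fun_prop)
    exact (hr'.comp continuous_snd).mul
      (hK.comp (f := fun w : ℝ × ℝ => (0, w.2, w.1)) (by fun_prop))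
  set D : ℝ → ℝ := fun Y => c Y * Nt 0 (2 * Y) + (∫ η in (0 : ℝ)..Y, E η Y)
    - s 0 / n₀ 0 * S Y with hD
  have cED : Continuous fun Y => ∫ η in (0 : ℝ)..Y, E η Y :=
    continuous_integral_between (F := fun Y η => E η Y) (cE.comp continuous_swap)
      (a := fun _ => 0) continuous_const (b := fun Y => Y) continuous_id
  have cD0 : Continuous fun Y => c Y * Nt 0 (2 * Y) := by fun_prop
  have cD : Continuous D := (cD0.add cED).sub (continuous_const.mul cS)
  have test : ∀ Ψ : ℝ → ℝ, ContDiff ℝ ((⊤ : ℕ∞) : WithTop ℕ∞) Ψ → HasCompactSupport Ψ →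
      tsupport Ψ ⊆ Ioi 0 → ∫ Y, Ψ Y • D Y = 0 := by
    intro Ψ hΨ hcs hsupp
    have h0 : ∀ Y, Y ≤ 0 → Ψ Y = 0 := fun Y hY =>
      image_eq_zero_of_notMem_tsupport fun h => absurd (mem_Ioi.1 (hsupp h)) (not_lt.2 hY)
    obtain ⟨Z, hZ0, hZ⟩ : ∃ Z, 0 ≤ Z ∧ ∀ Y, Z ≤ Y → Ψ Y = 0 := by
      obtain ⟨C, hC⟩ := hcs.isCompact.isBounded.exists_norm_le
      refine ⟨|C| + 1, by positivity, fun Y hY => image_eq_zero_of_notMem_tsupport fun h => ?_⟩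
      have h1 := (le_abs_self Y).trans (hC Y h)
      linarith [le_abs_self C]
    have hΨc := hΨ.continuous
    obtain ⟨W, P, Q, B, hW, hB, hz, hW0, hrep⟩ :=
      exists_backward_goursat hq hR (by exact_mod_cast contDiff_infty.1 hΨ 2) hZ
    obtain ⟨Wt, Wtt, h1, h2, cWt, cWtt⟩ := hW.time
    have can := hU.canonical hρ hpos hs hU₀ hW hz (fun y t _ _ => by
      have := hB (t - y) (t + y)
      rwa [show (t + y - (t - y)) / 2 = y by ring] at this) h1 h2
    have l1 : ∫ v in Ioi (0 : ℝ) ×ˢ Ioi (0 : ℝ), s v.1 * (inner ℝ (nbar v.1)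
          (gradient (fun ζ => U₀ v.1 v.2 ζ) ξ) / n₀ v.1 ^ 2) * Wtt v.1 v.2
        = ∫ v in Ioi (0 : ℝ) ×ˢ Ioi (0 : ℝ),
          (if v.1 < v.2 then c v.1 * N (v.2 - v.1) (v.2 + v.1) else 0) * Wtt v.1 v.2 := by
      refine setIntegral_congr_ae (measurableSet_Ioi.prod measurableSet_Ioi) ?_
      filter_upwards [ae_fst_ne_snd] with v hv hv'
      rw [hsource v.1 v.2 hv'.1 hv'.2 hv]
    have l2 : ∫ t in Ioi (0 : ℝ), s 0 * (r t / n₀ 0) * W t t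
        = s 0 / n₀ 0 * ∫ Y in (0 : ℝ)..Z, Ψ Y * S Y := by
      have hb := integral_backward (W := W) hq hR hΨc hZ0 (fun t h1 h2 => hrep 0 t h1 h2) hr'
      simp only [sub_zero, add_zero] at hb
      simp only [hS]
      rw [← hb, ← intervalIntegral.integral_const_mul,
        intervalIntegral.integral_of_le (by linarith)]
      refine (setIntegral_eq_of_subset_of_forall_sdiff_eq_zero measurableSet_Ioi
        Ioc_subset_Ioi_self fun t ht => ?_).trans
        (setIntegral_congr_fun measurableSet_Ioc fun t ht => ?_)
      · rw [hz t t (le_of_not_ge fun h => ht.2 ⟨ht.1, h⟩), mul_zero]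
      · simp only [hrr' t ht.1.le]
        ring
    have l3 : ∫ y in (0 : ℝ)..Z, ∫ t in y..(2 * Z - y),
        c y * Ntt (t - y) (t + y) * W (t - y) (t + y)
        = ∫ Y in (0 : ℝ)..Z, Ψ Y * ∫ η in (0 : ℝ)..Y, E η Y := by
      have e1 : ∀ y ∈ uIcc 0 Z, ∫ t in y..(2 * Z - y),
          c y * Ntt (t - y) (t + y) * W (t - y) (t + y) = ∫ Y in y..Z, Ψ Y * E y Y := by
        intro y hy
        rw [uIcc_of_le hZ0] at hy
        exact integral_backward (f := fun t => c y * Ntt (t - y) (t + y)) hq hR hΨc hy.2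
          (fun t h1 h2 => hrep y t h1 h2) (continuous_const.mul
            (cNtt.comp (f := fun t => (t - y, t + y)) (by fun_prop)))
      rw [intervalIntegral.integral_congr e1]
      have cM : Continuous fun v : ℝ × ℝ => Ψ v.1 * E v.2 v.1 :=
        (hΨc.comp continuous_fst).mul (cE.comp continuous_swap)
      rw [← integral_triangle_swap_of_continuous (F := fun Y η => Ψ Y * E η Y) hZ0 cM]
      simp only [intervalIntegral.integral_const_mul]
    have l4 : ∫ y in (0 : ℝ)..Z, c y * Nt 0 (2 * y) * W 0 (2 * y)
        = ∫ Y in (0 : ℝ)..Z, Ψ Y * (c Y * Nt 0 (2 * Y)) := by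
      refine intervalIntegral.integral_congr fun Y _ => ?_
      simp only [hW0]
      rw [show 2 * Y / 2 = Y by ring]
      ring
    rw [l1, setIntegral_source hZ0 hW hz h1 h2 cWt cWtt hc cN cNt cNtt dN dNt hN0, l2, l3, l4,
      ← intervalIntegral.integral_const_mul] at can
    simp only [smul_eq_mul]
    rw [integral_eq_intervalIntegral (a := 0) (b := Z) (fun Y h => by rw [h0 Y h, zero_mul])
      (fun Y h => by rw [hZ Y h, zero_mul])]
    have i1 : IntervalIntegrable (fun Y => Ψ Y * (c Y * Nt 0 (2 * Y))) volume 0 Z :=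
      (hΨc.mul cD0).intervalIntegrable 0 Z
    have i2 : IntervalIntegrable (fun Y => Ψ Y * ∫ η in (0 : ℝ)..Y, E η Y) volume 0 Z :=
      (hΨc.mul cED).intervalIntegrable 0 Z
    have i12 : IntervalIntegrable (fun Y => Ψ Y * (c Y * Nt 0 (2 * Y))
      + Ψ Y * ∫ η in (0 : ℝ)..Y, E η Y) volume 0 Z := i1.add i2
    have i3 : IntervalIntegrable (fun Y => s 0 / n₀ 0 * (Ψ Y * S Y)) volume 0 Z :=
      (continuous_const.mul (hΨc.mul cS)).intervalIntegrable 0 Z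
    rw [← sub_eq_zero, ← intervalIntegral.integral_add i1 i2,
      ← intervalIntegral.integral_sub i12 i3] at can
    refine Eq.trans ?_ can
    refine intervalIntegral.integral_congr fun Y _ => ?_
    simp only [hD]
    ring
  have hae := isOpen_Ioi.ae_eq_zero_of_integral_contDiff_smul_eq_zero
    (cD.locallyIntegrable (μ := volume) |>.locallyIntegrableOn _) test
  have hDy : D y = 0 := by
    refine Measure.eqOn_open_of_ae_eq (g := fun _ => (0 : ℝ)) (μ := volume) (U := Ioi 0) ?_
      isOpen_Ioi cD.continuousOn continuousOn_const (mem_Ioi.2 hy)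
    exact (ae_restrict_iff' measurableSet_Ioi).2 hae
  exact sub_eq_zero.1 hDy

/-! ### The kernels of the integral equations -/

/-- The kernels agree with continuous functions only inside the intervals of integration: at the
end points the point lies on the boundary of the cone, on the front, or on `y = 0`. -/
lemma intervalIntegrable_and_integral_eq_of_Ioo {f g : ℝ → ℝ} {a b : ℝ} (hab : a ≤ b)
    (hg : Continuous g) (h : ∀ x ∈ Ioo a b, f x = g x) :
    IntervalIntegrable f volume a b ∧ ∫ x in a..b, f x = ∫ x in a..b, g x := by
  exact ⟨(hg.intervalIntegrable a b).congr_uIoo (by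
    rw [uIoo_of_le hab]
    exact fun x hx => (h x hx).symm),
    intervalIntegral.integral_congr_Ioo_of_le hab h⟩

lemma contDiffOn_two_of_hasDerivAt {f f' f'' : ℝ → ℝ} {S : Set ℝ} (hS : IsOpen S)
    (h1 : ∀ t ∈ S, HasDerivAt f (f' t) t) (h2 : ∀ t ∈ S, HasDerivAt f' (f'' t) t)
    (hc : ContinuousOn f'' S) : ContDiffOn ℝ 2 f S := by
  rw [show (2 : WithTop ℕ∞) = 1 + 1 by norm_num, contDiffOn_succ_iff_deriv_of_isOpen hS]
  refine ⟨fun t ht => (h1 t ht).differentiableAt.differentiableWithinAt, by simp, ?_⟩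
  have : ContDiffOn ℝ 1 f' S := by
    rw [show (1 : WithTop ℕ∞) = 0 + 1 by norm_num, contDiffOn_succ_iff_deriv_of_isOpen hS]
    refine ⟨fun t ht => (h2 t ht).differentiableAt.differentiableWithinAt, by simp, ?_⟩
    exact contDiffOn_zero.2 (hc.congr fun t ht => (h2 t ht).deriv)
  exact this.congr fun t ht => (h1 t ht).deriv

lemma hasGradientAt_comp_norm_sq {F : ℝ → ℝ} {F' : ℝ} {ξ : Plane}
    (h : HasDerivAt F F' (‖ξ‖ ^ 2)) :
    HasGradientAt (fun ζ : Plane => F (‖ζ‖ ^ 2)) ((2 * F') • ξ) ξ := by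
  rw [hasGradientAt_iff_hasFDerivAt]
  refine (h.comp_hasFDerivAt ξ (hasStrictFDerivAt_norm_sq ξ).hasFDerivAt).congr_fderiv ?_
  ext v
  simp
  ring

section Green

variable {ρ : ℝ} {n₀ s : ℝ → ℝ} {ξ : Plane} {η : ℝ} {G : ℝ → ℝ → ℝ → Plane → ℝ}
  {R : ℝ → ℝ → ℝ → ℝ}

lemma green₁_eq (hρ : 0 < ρ) (hpos : ∀ y, 0 ≤ y → 0 < n₀ y)
    (hs : IsAmplitude ρ n₀ s) (hq : Continuous (potential n₀ s (‖ξ‖ ^ 2)))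
    (hR : IsRiemann (potential n₀ s (‖ξ‖ ^ 2)) R) (hη : 0 ≤ η)
    (hg : IsSpaceCausalGreen ρ n₀ ξ η fun y t => G y η t ξ) {y t : ℝ} (hyt : |t| ≤ y - η) :
    green₁ ρ n₀ G y η t ξ = -(s η / 2) * R η ((y - η + t) / 2) ((y - η - t) / 2) := by
  rw [green₁, ← hs.eq y (by linarith [abs_nonneg t])]
  exact hg.eq_riemann hρ hpos hs hq hR hη hyt

lemma isOpen_cone (η : ℝ) : IsOpen {x : ℝ × ℝ | |x.2| < x.1 - η} :=
  isOpen_lt (by fun_prop) (by fun_prop)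

lemma contDiffOn_green₁ (hρ : 0 < ρ) (hpos : ∀ y, 0 ≤ y → 0 < n₀ y)
    (hs : IsAmplitude ρ n₀ s) (hq : Continuous (potential n₀ s (‖ξ‖ ^ 2)))
    (hR : IsRiemann (potential n₀ s (‖ξ‖ ^ 2)) R) (hη : 0 ≤ η)
    (hg : IsSpaceCausalGreen ρ n₀ ξ η fun y t => G y η t ξ) :
    ContDiffOn ℝ 1 (fun x : ℝ × ℝ => green₁ ρ n₀ G x.1 η x.2 ξ) {x | |x.2| < x.1 - η} := by
  obtain ⟨Rm, h⟩ := hR.hasPartials hq η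
  have hc : ContDiff ℝ 1 fun x : ℝ × ℝ =>
      -(s η / 2) * R η ((x.1 - η + x.2) / 2) ((x.1 - η - x.2) / 2) :=
    contDiff_const.mul (h.contDiff.comp (f := fun x : ℝ × ℝ =>
      ((x.1 - η + x.2) / 2, (x.1 - η - x.2) / 2)) (by fun_prop))
  exact hc.contDiffOn.congr fun x hx => green₁_eq hρ hpos hs hq hR hη hg (le_of_lt hx)

/-- `∂ₜ + ∂ᵧ` is the derivative in `p = (y - η + t)/2`. -/
lemma green₂_eq (hρ : 0 < ρ) (hpos : ∀ y, 0 ≤ y → 0 < n₀ y)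
    (hs : IsAmplitude ρ n₀ s) (hq : Continuous (potential n₀ s (‖ξ‖ ^ 2)))
    (hR : IsRiemann (potential n₀ s (‖ξ‖ ^ 2)) R) (hη : 0 ≤ η)
    (hg : IsSpaceCausalGreen ρ n₀ ξ η fun y t => G y η t ξ) {y τ : ℝ} (h1 : η < τ)
    (h2 : τ < 2 * y - η) :
    green₂ ρ n₀ G y η (y - τ) ξ
      = -(s η / 2) * frontKernel (potential n₀ s (‖ξ‖ ^ 2)) R η τ y := by
  obtain ⟨Rm, h⟩ := hR.hasPartials hq η
  have hcone : (y, y - τ) ∈ {x : ℝ × ℝ | |x.2| < x.1 - η} :=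
    show |y - τ| < y - η from abs_lt.2 ⟨by linarith, by linarith⟩
  have hev := (isOpen_cone η).eventually_mem hcone
  have e1 : (fun t => green₁ ρ n₀ G y η t ξ) =ᶠ[nhds (y - τ)]
      fun t => -(s η / 2) * R η ((y - η + t) / 2) ((y - η - t) / 2) := by
    filter_upwards [(Continuous.tendsto (f := fun t : ℝ => (y, t)) (by fun_prop)
      (y - τ)).eventually hev] with t ht
    exact green₁_eq hρ hpos hs hq hR hη hg (le_of_lt ht)
  have e2 : (fun x => green₁ ρ n₀ G x η (y - τ) ξ) =ᶠ[nhds y]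
      fun x => -(s η / 2) * R η ((x - η + (y - τ)) / 2) ((x - η - (y - τ)) / 2) := by
    filter_upwards [(Continuous.tendsto (f := fun x : ℝ => (x, y - τ)) (by fun_prop)
      y).eventually hev] with t ht
    exact green₁_eq hρ hpos hs hq hR hη hg (le_of_lt ht)
  have d1 := (h.comp_hasDerivAt (((hasDerivAt_id (y - τ)).const_add (y - η)).div_const 2)
    (((hasDerivAt_id (y - τ)).const_sub (y - η)).div_const 2)).const_mul (-(s η / 2))
  have d2 := (h.comp_hasDerivAt
    ((((hasDerivAt_id y).sub_const η).add_const (y - τ)).div_const 2)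
    ((((hasDerivAt_id y).sub_const η).sub_const (y - τ)).div_const 2)).const_mul (-(s η / 2))
  simp only [id] at d1 d2
  rw [green₂, e1.deriv_eq, e2.deriv_eq, d1.deriv, d2.deriv, frontKernel,
    show (y - η + (y - τ)) / 2 = y - (η + τ) / 2 by ring,
    show (y - η - (y - τ)) / 2 = (τ - η) / 2 by ring]
  ring

end Green

section ZeroOrder

variable {ρ : ℝ} {n₀ s : ℝ → ℝ} {U₀ : ℝ → ℝ → Plane → ℝ} {u k kk Du Dkk : ℝ → ℝ → ℝ → ℝ}

lemma zeroOrder_behind (hs : IsAmplitude ρ n₀ s)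
    (hU : ∀ ξ y t, 0 < y → 0 < t → t ≠ y → s y * U₀ y t ξ
      = if y < t then 1 + u (‖ξ‖ ^ 2) (t - y) (t + y) else 0)
    {y t : ℝ} (hy : 0 < y) (hyt : y < t) (ξ : Plane) :
    U₀ y t ξ = (1 + u (‖ξ‖ ^ 2) (t - y) (t + y)) / s y := by
  rw [eq_div_iff (hs.pos y).ne', mul_comm, hU ξ y t hy (hy.trans hyt) hyt.ne', if_pos hyt]

lemma dtt_eq (hs : IsAmplitude ρ n₀ s)
    (hU : ∀ ξ y t, 0 < y → 0 < t → t ≠ y → s y * U₀ y t ξ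
      = if y < t then 1 + u (‖ξ‖ ^ 2) (t - y) (t + y) else 0)
    (hk : ∀ l y t, HasDerivAt (fun t => u l (t - y) (t + y)) (k l (t - y) (t + y)) t)
    (hkk : ∀ l y t, 0 < t - y → 0 < t + y →
        HasDerivAt (fun t => k l (t - y) (t + y)) (kk l (t - y) (t + y)) t)
    (ckk : ∀ l, Continuous fun v : ℝ × ℝ => kk l v.1 v.2)
    {y t : ℝ} (hy : 0 < y) (hyt : y < t) (ξ : Plane) :
    ContDiffAt ℝ 2 (fun t => U₀ y t ξ) t ∧
      dtt U₀ y t ξ = kk (‖ξ‖ ^ 2) (t - y) (t + y) / s y := by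
  set l := ‖ξ‖ ^ 2
  have h1 : ∀ t ∈ Ioi y, HasDerivAt (fun t => U₀ y t ξ) (k l (t - y) (t + y) / s y) t := by
    intro t ht
    refine (((hk l y t).const_add 1).div_const (s y)).congr_of_eventuallyEq ?_
    filter_upwards [Ioi_mem_nhds ht] with τ hτ
    exact zeroOrder_behind hs hU hy hτ ξ
  have h2 : ∀ t ∈ Ioi y, HasDerivAt (fun t => k l (t - y) (t + y) / s y)
      (kk l (t - y) (t + y) / s y) t := fun t ht =>
    (hkk l y t (sub_pos.2 ht) (by linarith [mem_Ioi.1 ht])).div_const _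
  have hc : Continuous fun t => kk l (t - y) (t + y) / s y :=
    ((ckk l).comp (f := fun t => (t - y, t + y)) (by fun_prop)).div_const _
  refine ⟨(contDiffOn_two_of_hasDerivAt isOpen_Ioi h1 h2 hc.continuousOn).contDiffAt
    (Ioi_mem_nhds hyt), ?_⟩
  rw [dtt, iteratedDeriv_succ, iteratedDeriv_one]
  have : deriv (fun t => U₀ y t ξ) =ᶠ[nhds t] fun t => k l (t - y) (t + y) / s y := by
    filter_upwards [Ioi_mem_nhds hyt] with τ hτ
    exact (h1 τ hτ).deriv
  rw [this.deriv_eq]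
  exact (h2 t hyt).deriv

lemma evenPrim_slowness (n₀ : ℝ → ℝ) {y : ℝ} (hy : 0 ≤ y) :
    evenPrim (slowness n₀) y = ∫ η in (0 : ℝ)..y, 1 / n₀ η ^ 2 := by
  rw [evenPrim, abs_of_nonneg hy]
  refine intervalIntegral.integral_congr fun η hη => ?_
  rw [uIcc_of_le hy] at hη
  simp only [slowness, abs_of_nonneg hη.1]

lemma pFactor_ne_zero (hpos : ∀ y, 0 ≤ y → 0 < n₀ y) (hc : Continuous (slowness n₀)) {y : ℝ}
    (hy : 0 < y) : pFactor n₀ y ≠ 0 := by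
  have h1 : 0 < n₀ y := hpos y hy.le
  have h2 : 0 < ∫ η in (0 : ℝ)..y, 1 / n₀ η ^ 2 := by
    rw [← evenPrim_slowness n₀ hy.le, evenPrim, abs_of_pos hy]
    exact intervalIntegral.intervalIntegral_pos_of_pos (hc.intervalIntegrable _ _)
      (fun w => div_pos one_pos (pow_pos (hpos _ (abs_nonneg w)) 2)) hy
  exact mul_ne_zero (neg_ne_zero.2 (by positivity)) h2.ne'

end ZeroOrder

end LayeredWave

open LayeredWave

theorem proposition2
    (ρ : ℝ) (hρ : 0 < ρ)
    (n₀ : ℝ → ℝ) (hn₀_pos : ∀ y, 0 ≤ y → 0 < n₀ y) (hn₀ : ContDiffOn ℝ 3 n₀ (Set.Ici 0))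
    (nbar : ℝ → LayeredWave.Plane) (hnbar : ContinuousOn nbar (Set.Ici 0))
    -- the zero-order wave `U⁰(y, t, ξ)`
    (U₀ : ℝ → ℝ → LayeredWave.Plane → ℝ)
    (hU₀ : ∀ ξ, LayeredWave.IsZeroOrderWave ρ n₀ ξ (fun y t => U₀ y t ξ))
    -- the first-order wave `U¹(y, t, ξ)` and its response `r̂₁(t, ξ)`
    (U₁ : ℝ → ℝ → LayeredWave.Plane → ℝ) (rhat : ℝ → LayeredWave.Plane → ℝ)
    (hU₁ : ∀ ξ, LayeredWave.IsFirstOrderWave ρ n₀ nbar U₀ ξ (fun y t => U₁ y t ξ)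
      (fun t => rhat t ξ))
    -- the space-causal Green's function `G(y, η, t; ξ)`
    (G : ℝ → ℝ → ℝ → LayeredWave.Plane → ℝ)
    (hG : ∀ ξ, ∀ η, 0 ≤ η →
      LayeredWave.IsSpaceCausalGreen ρ n₀ ξ η (fun y t => G y η t ξ))
    (a : ℝ) (ha : a ≠ 0) :
    -- the derivatives in the kernels exist in the classical sense
    (∀ η τ : ℝ, ∀ ξ : LayeredWave.Plane, 0 < η → η < τ →
      ContDiffAt ℝ 2 (fun t => U₀ η t ξ) τ ∧
      DifferentiableAt ℝ (fun ζ => LayeredWave.dtt U₀ η τ ζ) ξ) ∧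
    (∀ η : ℝ, ∀ ξ : LayeredWave.Plane, 0 ≤ η →
      ContDiffOn ℝ 1 (fun x : ℝ × ℝ => LayeredWave.green₁ ρ n₀ G x.1 η x.2 ξ)
        {x | |x.2| < x.1 - η}) ∧
    -- the integral equations, for `ξ₁ = (a, 0)` and `ξ₂ = (0, a)`
    ∀ i : Fin 2, ∀ ξ : LayeredWave.Plane, ξ = EuclideanSpace.single i a →
    ∀ φ : ℝ → LayeredWave.Plane, φ = LayeredWave.phiBar n₀ nbar →
    ∀ y : ℝ, 0 < y →
      IntervalIntegrable (fun η => LayeredWave.green₁ ρ n₀ G y η (η - y) ξ *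
        LayeredWave.forcing n₀ φ U₀ η (2 * y - η) ξ) MeasureTheory.volume 0 y ∧
      (∀ η ∈ Set.Ioo 0 y, IntervalIntegrable
        (fun τ => LayeredWave.green₂ ρ n₀ G y η (y - τ) ξ *
          LayeredWave.forcing n₀ φ U₀ η τ ξ) MeasureTheory.volume η (2 * y - η)) ∧
      IntervalIntegrable (fun η => ∫ τ in η..(2 * y - η),
        LayeredWave.green₂ ρ n₀ G y η (y - τ) ξ *
          LayeredWave.forcing n₀ φ U₀ η τ ξ) MeasureTheory.volume 0 y ∧
      IntervalIntegrable (fun τ => LayeredWave.green₂ ρ n₀ G y 0 (y - τ) ξ * rhat τ ξ)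
        MeasureTheory.volume 0 (2 * y) ∧
      a * φ y i =
        2 * (∫ η in (0 : ℝ)..y, LayeredWave.green₁ ρ n₀ G y η (η - y) ξ *
          LayeredWave.forcing n₀ φ U₀ η (2 * y - η) ξ)
        - 2 / n₀ 0 * LayeredWave.green₁ ρ n₀ G y 0 (-y) ξ * rhat (2 * y) ξ
        + (∫ η in (0 : ℝ)..y, ∫ τ in η..(2 * y - η),
            LayeredWave.green₂ ρ n₀ G y η (y - τ) ξ *
              LayeredWave.forcing n₀ φ U₀ η τ ξ)
        - 1 / n₀ 0 * ∫ τ in (0 : ℝ)..(2 * y),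
            LayeredWave.green₂ ρ n₀ G y 0 (y - τ) ξ * rhat τ ξ := by
  obtain ⟨s, hs⟩ := exists_isAmplitude hρ hn₀_pos hn₀
  have hq₀ := hs.continuous_basePotential
  have hq₁ := continuous_slowness hn₀_pos hn₀.continuousOn
  have hq : ∀ l, Continuous (potential n₀ s l) := fun l => hq₀.add (continuous_const.mul hq₁)
  obtain ⟨u, k, kk, Du, Dk, Dkk, hu, hk, hkk, hDu, hDkk, hDk, hDkk', hDu0, hDk0, ckk, cDu, cDk,
    cDkk⟩ := exists_stepProfile hq₀ hq₁
  have hU : ∀ ξ y t, 0 < y → 0 < t → t ≠ y → s y * U₀ y t ξ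
      = if y < t then 1 + u (‖ξ‖ ^ 2) (t - y) (t + y) else 0 := fun ξ y t hy ht hne =>
    (hU₀ ξ).eq_profile hρ hn₀_pos hs (hq _) (hu _) hy ht hne
  have hdtt : ∀ {y t : ℝ}, 0 < y → y < t → ∀ ξ, HasGradientAt (fun ζ => dtt U₀ y t ζ)
      ((2 * (Dkk (‖ξ‖ ^ 2) (t - y) (t + y) / s y)) • ξ) ξ := by
    intro y t hy hyt ξ
    rw [show (fun ζ => dtt U₀ y t ζ) = fun ζ => kk (‖ζ‖ ^ 2) (t - y) (t + y) / s y from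
      funext fun ζ => (dtt_eq hs hU hk hkk ckk hy hyt ζ).2]
    exact hasGradientAt_comp_norm_sq (F := fun l => kk l (t - y) (t + y) / s y)
      ((hDkk _ _ _).div_const _)
  refine ⟨fun η τ ξ hη hητ => ⟨(dtt_eq hs hU hk hkk ckk hη hητ ξ).1,
    (hdtt hη hητ ξ).differentiableAt⟩, fun η ξ hη => ?_, ?_⟩
  · obtain ⟨R, hR⟩ := exists_isRiemann (hq (‖ξ‖ ^ 2))
    exact contDiffOn_green₁ hρ hn₀_pos hs (hq _) hR hη (hG ξ η hη)
  intro i ξ hξ φ hφ y hy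
  obtain ⟨R, hR⟩ := exists_isRiemann (hq (‖ξ‖ ^ 2))
  set l := ‖ξ‖ ^ 2 with hl
  have hK := hR.continuous_frontKernel (hq _)
  -- Even extensions of the data are continuous on the whole line.
  set c : ℝ → ℝ := fun η => 2 * (inner ℝ (nbar |η|) ξ * slowness n₀ η) with hc
  have cc : Continuous c := by
    have h1 : Continuous fun η => nbar |η| :=
      hnbar.comp_continuous continuous_abs fun η => mem_Ici.2 (abs_nonneg η)
    exact continuous_const.mul ((h1.inner continuous_const).mul hq₁)
  have hcη : ∀ η, 0 < η → c η = 2 * (inner ℝ (nbar η) ξ / n₀ η ^ 2) := by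
    intro η hη
    simp only [hc, slowness, abs_of_pos hη]
    ring
  set r' : ℝ → ℝ := fun t => rhat |t| ξ with hr'
  have cr' : Continuous r' := (hU₁ ξ).response_continuousOn.comp_continuous continuous_abs
    fun t => mem_Ici.2 (abs_nonneg t)
  have hrr' : ∀ t, 0 ≤ t → rhat t ξ = r' t := fun t ht => by simp only [hr', abs_of_nonneg ht]
  -- `p(η) ≠ 0` for `η > 0` cancels, leaving `⟨n̄, ∇_ξ U⁰_tt⟩ / n₀²`.
  have hforce : ∀ η τ, 0 < η → η < τ →
      forcing n₀ φ U₀ η τ ξ = c η * Dkk l (τ - η) (τ + η) / s η := by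
    intro η τ hη hητ
    have h1 := pFactor_ne_zero hn₀_pos hq₁ hη
    have h2 := (hn₀_pos η hη.le).ne'
    have h3 := (hs.pos η).ne'
    rw [forcing, (hdtt hη hητ ξ).gradient, hφ, phiBar, inner_smul_left, inner_smul_right, hcη η hη]
    simp only [conj_trivial, ← hl]
    field_simp
  have hfront := (hU₁ ξ).front_identity (c := c) (r' := r') (N := Du l) (Nt := Dk l) (Ntt := Dkk l)
    hρ hn₀_pos hs (fun ζ y t hy ht => (hU₀ ζ).initial y t hy ht) (hq _) hR
    (fun y t hy ht hne => by
      have h3 := (hs.pos y).ne'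
      by_cases hyt : y < t
      · have : HasGradientAt (fun ζ => U₀ y t ζ) ((2 * (Du l (t - y) (t + y) / s y)) • ξ) ξ := by
          rw [show (fun ζ => U₀ y t ζ) = fun ζ => (1 + u (‖ζ‖ ^ 2) (t - y) (t + y)) / s y from
            funext fun ζ => zeroOrder_behind hs hU hy hyt ζ]
          exact hasGradientAt_comp_norm_sq (F := fun l => (1 + u l (t - y) (t + y)) / s y)
            (((hDu _ _ _).const_add 1).div_const _)
        rw [this.gradient, if_pos hyt, inner_smul_right, hcη y hy]
        field_simp
      · have : (fun ζ => U₀ y t ζ) = fun _ => 0 := by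
          funext ζ
          have := hU ζ y t hy ht hne
          rw [if_neg hyt] at this
          exact (mul_eq_zero.1 this).resolve_left h3
        rw [this, if_neg hyt, gradient_fun_const]
        simp)
    cc cr' hrr' (cDu l) (cDk l) (cDkk l) (hDk l) (hDkk' l) (hDu0 l) hy
  have g1 : ∀ η, 0 ≤ η → η ≤ y → green₁ ρ n₀ G y η (η - y) ξ = -(s η / 2) := by
    intro η hη hηy
    rw [green₁_eq hρ hn₀_pos hs (hq _) hR hη (hG ξ η hη)
      (by rw [abs_of_nonpos (by linarith)]; linarith),
      show (y - η + (η - y)) / 2 = 0 by ring, hR.zero_left, mul_one]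
  have g2 : ∀ η τ, 0 ≤ η → η < τ → τ < 2 * y - η → green₂ ρ n₀ G y η (y - τ) ξ
      = -(s η / 2) * frontKernel (potential n₀ s l) R η τ y := fun η τ hη h1 h2 =>
    green₂_eq hρ hn₀_pos hs (hq _) hR hη (hG ξ η hη) h1 h2
  set K := frontKernel (potential n₀ s l) R with hKdef
  have i1 := intervalIntegrable_and_integral_eq_of_Ioo hy.le
    (f := fun η => green₁ ρ n₀ G y η (η - y) ξ * forcing n₀ φ U₀ η (2 * y - η) ξ)
    (g := fun η => -(1 / 2) * (c η * Dkk l (2 * y - η - η) (2 * y - η + η)))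
    (continuous_const.mul (cc.mul ((cDkk l).comp
      (f := fun η => (2 * y - η - η, 2 * y - η + η)) (by fun_prop)))) fun η hη => by
      have h3 := (hs.pos η).ne'
      rw [g1 η hη.1.le hη.2.le, hforce η _ hη.1 (by linarith [hη.2])]
      field_simp
  have i2 : ∀ η, 0 < η → η ≤ y → _ := fun η hη hηy =>
    intervalIntegrable_and_integral_eq_of_Ioo (a := η) (b := 2 * y - η) (by linarith)
    (f := fun τ => green₂ ρ n₀ G y η (y - τ) ξ * forcing n₀ φ U₀ η τ ξ)
    (g := fun τ => -(1 / 2) * (c η * Dkk l (τ - η) (τ + η) * K η τ y))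
    (continuous_const.mul ((continuous_const.mul ((cDkk l).comp
      (f := fun τ => (τ - η, τ + η)) (by fun_prop))).mul
      (hK.comp (f := fun τ => (η, τ, y)) (by fun_prop)))) fun τ hτ => by
      have h3 := (hs.pos η).ne'
      rw [g2 η τ hη.le hτ.1 hτ.2, hforce η τ hη hτ.1]
      field_simp
  have cI : Continuous fun η => ∫ τ in η..(2 * y - η),
      c η * Dkk l (τ - η) (τ + η) * K η τ y := by
    refine continuous_integral_between (F := fun η τ => c η * Dkk l (τ - η) (τ + η) * K η τ y) ?_
      (a := fun η => η) (by fun_prop) (b := fun η => 2 * y - η) (by fun_prop)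
    exact ((cc.comp continuous_fst).mul ((cDkk l).comp
      (f := fun v : ℝ × ℝ => (v.2 - v.1, v.2 + v.1)) (by fun_prop))).mul
      (hK.comp (f := fun v : ℝ × ℝ => (v.1, v.2, y)) (by fun_prop))
  have i3 := intervalIntegrable_and_integral_eq_of_Ioo hy.le
    (f := fun η => ∫ τ in η..(2 * y - η),
      green₂ ρ n₀ G y η (y - τ) ξ * forcing n₀ φ U₀ η τ ξ)
    (g := fun η => -(1 / 2) * ∫ τ in η..(2 * y - η), c η * Dkk l (τ - η) (τ + η) * K η τ y)
    (continuous_const.mul cI) fun η hη => by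
      rw [(i2 η hη.1 hη.2.le).2, intervalIntegral.integral_const_mul]
  have i4 := intervalIntegrable_and_integral_eq_of_Ioo (a := 0) (b := 2 * y) (by linarith)
    (f := fun τ => green₂ ρ n₀ G y 0 (y - τ) ξ * rhat τ ξ)
    (g := fun τ => -(s 0 / 2) * (r' τ * K 0 τ y))
    (continuous_const.mul (cr'.mul (hK.comp (f := fun τ => (0, τ, y)) (by fun_prop))))
    fun τ hτ => by
      rw [g2 0 τ le_rfl hτ.1 (by linarith [hτ.2]), hrr' τ hτ.1.le]
      ring
  refine ⟨i1.1, fun η hη => (i2 η hη.1 hη.2.le).1, i3.1, i4.1, ?_⟩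
  -- the jump of the velocity of the source on the front
  have hφy : c y * Dk l 0 (2 * y) = 2 * (a * φ y i) := by
    rw [hDk0, show 2 * y / 2 = y by ring, evenPrim_slowness n₀ hy.le, hcη y hy, hφ, phiBar, pFactor,
      hξ, EuclideanSpace.inner_single_right, PiLp.smul_apply, smul_eq_mul, conj_trivial]
    ring
  have g10 := g1 0 le_rfl hy.le
  rw [zero_sub] at g10
  have c0 : Continuous fun η => 2 * (c η * Dkk l (2 * y - η - η) (2 * y - η + η)) :=
    continuous_const.mul (cc.mul ((cDkk l).comp
      (f := fun η => (2 * y - η - η, 2 * y - η + η)) (by fun_prop)))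
  rw [hφy, intervalIntegral.integral_add (c0.intervalIntegrable _ _) (cI.intervalIntegrable _ _),
    intervalIntegral.integral_const_mul] at hfront
  rw [i1.2, i3.2, i4.2, g10, hrr' (2 * y) (by linarith)]
  simp only [intervalIntegral.integral_const_mul]
  linear_combination (1 / 2) * hfront
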